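/- Let $G$ be a simple real Lie group of Hermitian type of tube type, of real rank $r\ge 1$, with Lie algebra $\mathfrak g$. Fix a Cartan involution $\sigma$ of $\mathfrak g$, with eigenspaces $\mathfrak k$ and $\mathfrak p$ for the eigenvalues $1$ and $-1$, and a maximal abelian subspace $\mathfrak a\subset\mathfrak p$. "Hermitian type" means that $\mathfrak p$ carries a $\mathfrak k$-invariant complex structure that is orthogonal for the Killing form; "tube type" means that the restricted root system is of type $C_r$, i.e. $\mathfrak a^*$ has a basis $\varepsilon_1,\dots,\varepsilon_r$ such that $\Sigma=\{\pm\varepsilon_i\pm\varepsilon_j\mid 1\le i\le j\le r\}\smallsetminus\{0\}$. Take the simple roots $\alpha_i=\varepsilon_i-\varepsilon_{i+1}$ $(i<r)$ and $\alpha_r=2\varepsilon_r$. Let $\mathfrak u^{\pm}$ be the sum of the root spaces $\mathfrak g_{\pm\alpha}$ over the positive roots $\alpha\notin\operatorname{Span}(\alpha_1,\dots,\alpha_{r-1})$, and let $P$, $P^-$ be the normalizers in $G$ of $\mathfrak u^+$, $\mathfrak u^-$. The Shilov boundary is $\mathbf{Sb}(G)=G/P$ with the quotient topology (the standard topology). A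 point $x\in G/P$ and a point $\xi\in G/P^-$ are transverse if $(x,\xi)=(gP,gP^-)$ for some $g\in G$; $\operatorname Z_\xi\subset\mathbf{Sb}(G)$ is the set of points not transverse to $\xi$. A domain is a nonempty connected open subset $\Omega\subset\mathbf{Sb}(G)$; it is proper if $\overline\Omega\cap\operatorname Z_\xi=\emptyset$ for some $\xi\in G/P^-$. Let $v^{\pm}\in\mathfrak g_{\pm\alpha_r}$ be such that $(v^+,[v^+,v^-],v^-)$ is an $\mathfrak{sl}_2$-triple. The formulas $\mathsf i([1:t])=\exp(tv^-)P$ for $t\in\mathbb R$ and $\mathsf i([0:1])=\exp(v^+)\exp(-v^-)P=\lim_{t\to\infty}\exp(tv^-)P$ define an embedding $\mathsf i:\mathbb P(\mathbb R^2)\to\mathbf{Sb}(G)$, with image $\Lambda_{\mathsf{std}}$. The photons are the sets $g\cdot\Lambda_{\mathsf{std}}$, $g\in G$, parametrized by $\mathsf i_g=g\cdot\mathsf i$. For a proper open interval $I\subset\mathbb P(\mathbb R^2)$ with (possibly equal) endpoints $t_1,t_2$ and for $s_1,s_2\in I$ such that $t_1,s_1,s_2,t_2$ are aligned in this order, let $H_I(s_1,s_2)=\log(t_1:s_1:s_2:t_2)$,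 where the cross ratio is normalized by $([1:0]:[1:1]:[1:t]:[0:1])=t$; let $H_I=0$ for $I=\mathbb P(\mathbb R^2)$. Two points $x,y$ of a domain $\Omega$ are conjugate if there is a photon $\Lambda$ such that $x$ and $y$ lie in the same connected component $I$ of $\Lambda\cap\Omega$; if $\Lambda=g\cdot\Lambda_{\mathsf{std}}$, put $\mathsf k_\Omega(x,y)=H_{\mathsf i_g^{-1}(I)}(\mathsf i_g^{-1}(x),\mathsf i_g^{-1}(y))$, which does not depend on the choices. For $x,y\in\Omega$ let $$K_\Omega(x,y)=\inf\sum_{i=0}^{N-1}\mathsf k_\Omega(x_i,x_{i+1})\in[0,+\infty],$$ the infimum being over all $N\ge1$ and all chains $x_0=x,x_1,\dots,x_N=y$ of points of $\Omega$ in which any two consecutive points are conjugate. Proposition. If $\Omega\subset\mathbf{Sb}(G)$ is a proper domain, then $\Omega$ is Kobayashi hyperbolic, that is, $K_\Omega$ is a metric on $\Omega$ (in particular it is finite and separates points). Moreover, the topology on $\Omega$ induced by the metric $K_\Omega$ is the standard topology, i.e. the subspace topology from $\mathbf{Sb}(G)$. -/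

import Mathlib

open Set Topology
open scoped Manifold ContDiff ENNReal

noncomputable section

/-! ### Cross ratio and Hilbert pseudo-metric on the real projective line

The projective line `ℙ(ℝ²)`, with its topology of a circle, is `OnePoint ℝ`: the real number `t` is
the point `[1 : t]`, and `∞` is the point `[0 : 1]`. -/

namespace ProjLine

/-- A vector of `ℝ²` spanning the given point of the projective line. -/
def lift : OnePoint ℝ → ℝ × ℝ
  | OnePoint.infty => (0, 1)
  | OnePoint.some t => (1, t)

/-- The determinant of two points of the projective line, computed with their lifts. -/
def det (a b : OnePoint ℝ) : ℝ := (lift a).1 * (lift b).2 - (lift a).2 * (lift b).1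

/-- The cross ratio, normalized by `([1:0] : [1:1] : [1:t] : [0:1]) = t`. -/
def crossRatio (a b c d : OnePoint ℝ) : ℝ := (det a c * det b d) / (det a b * det c d)

/-- The Hilbert pseudo-metric `H_I` of an open interval `I` of the projective line.
If `I` has endpoints `a ≠ b`, the set below is `{0, |log (a : s : t : b)|}`, and `|log (a : s : t : b)|`
equals `log (a : s : t : b)` when `a, s, t, b` are aligned in this order (exchanging `a` and `b`
inverts the cross ratio). If the two endpoints agree, or if `I` is the whole line, the value is `0`. -/
def hilbert (I : Set (OnePoint ℝ)) (s t : OnePoint ℝ) : ℝ :=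
  sSup {c | ∃ a ∈ frontier I, ∃ b ∈ frontier I, c = |Real.log (crossRatio a s t b)|}

end ProjLine

/-! ### Simple Lie algebras of Hermitian type of tube type -/

section LieAlgebraDefs

variable {𝔤 : Type*} [LieRing 𝔤] [LieAlgebra ℝ 𝔤]

/-- A Cartan involution: an involutive automorphism `σ` of the Lie algebra such that
`(X, Y) ↦ -B(X, σ Y)` is positive definite, `B` being the Killing form. -/
structure IsCartanInvolution (σ : 𝔤 ≃ₗ⁅ℝ⁆ 𝔤) : Prop where
  involutive : ∀ X, σ (σ X) = X
  pos : ∀ X, X ≠ 0 → 0 < -(killingForm ℝ 𝔤 X (σ X))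

/-- The symmetric space attached to `σ` is Hermitian. Writing `𝔨` and `𝔭` for the eigenspaces of `σ`
for the eigenvalues `1` and `-1`, so that `𝔭` is the tangent space of the symmetric space at its base
point, this says that `𝔭` carries a `𝔨`-invariant complex structure `J` which is orthogonal for the
Killing form. (Only the values of `J` on `𝔭` matter.) -/
def IsHermitianType (σ : 𝔤 ≃ₗ⁅ℝ⁆ 𝔤) : Prop :=
  ∃ J : 𝔤 →ₗ[ℝ] 𝔤,
    (∀ X, σ X = -X → σ (J X) = -J X) ∧
    (∀ X, σ X = -X → J (J X) = -X) ∧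
    (∀ Z X, σ Z = Z → σ X = -X → J ⁅Z, X⁆ = ⁅Z, J X⁆) ∧
    (∀ X Y, σ X = -X → σ Y = -Y → killingForm ℝ 𝔤 (J X) (J Y) = killingForm ℝ 𝔤 X Y)

/-- `𝔞` is a maximal abelian subspace of `𝔭 = {X | σ X = -X}`. -/
structure IsMaximalAbelianIn (σ : 𝔤 ≃ₗ⁅ℝ⁆ 𝔤) (𝔞 : Submodule ℝ 𝔤) : Prop where
  sub_p : ∀ H ∈ 𝔞, σ H = -H
  abelian : ∀ H ∈ 𝔞, ∀ H' ∈ 𝔞, ⁅H, H'⁆ = 0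
  maximal : ∀ X, σ X = -X → (∀ H ∈ 𝔞, ⁅H, X⁆ = 0) → X ∈ 𝔞

/-- The space `𝔤_α = {X | [H, X] = α(H) X for all H ∈ 𝔞}`, for a linear form `α` on `𝔞`. -/
def restrictedRootSpace (𝔞 : Submodule ℝ 𝔤) (α : Module.Dual ℝ 𝔞) : Submodule ℝ 𝔤 where
  carrier := {X | ∀ H : 𝔞, ⁅(H : 𝔤), X⁆ = α H • X}
  add_mem' := by
    intro X Y hX hY H
    rw [lie_add, hX H, hY H, smul_add]
  zero_mem' := by
    intro H
    simp
  smul_mem' := by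
    intro c X hX H
    rw [lie_smul, hX H, smul_comm]

/-- The set `Σ` of restricted roots of `(𝔤, 𝔞)`. -/
def restrictedRoots (𝔞 : Submodule ℝ 𝔤) : Set (Module.Dual ℝ 𝔞) :=
  {α | α ≠ 0 ∧ restrictedRootSpace 𝔞 α ≠ ⊥}

end LieAlgebraDefs

/-- A simple real Lie algebra of Hermitian type of tube type (an HTT Lie algebra), together with the
usual choices: a Cartan involution `σ`, a maximal abelian subspace `𝔞` of `𝔭`, a basis
`ε_1, …, ε_r` of the dual of `𝔞` (`r = rk + 1 ≥ 1` is the real rank, and the index set is `Fin r`) in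
which the restricted root system has the form `C_r`, and vectors `v⁺`, `v⁻` of root spaces
of `2ε_r`, `-2ε_r` that are part of an `𝔰𝔩₂`-triple. Among the simple Lie algebras of Hermitian type,
those of tube type are the ones whose restricted root system is of type `C_r` (for the other ones, it
is of type `BC_r`). -/
structure HTTData (𝔤 : Type*) [LieRing 𝔤] [LieAlgebra ℝ 𝔤] where
  simple : LieAlgebra.IsSimple ℝ 𝔤
  σ : 𝔤 ≃ₗ⁅ℝ⁆ 𝔤
  cartan : IsCartanInvolution σ
  hermitian : IsHermitianType σ
  𝔞 : Submodule ℝ 𝔤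
  maximalAbelian : IsMaximalAbelianIn σ 𝔞
  rk : ℕ
  ε : Module.Basis (Fin (rk + 1)) ℝ (Module.Dual ℝ 𝔞)
  roots_eq : restrictedRoots 𝔞 =
    {α | α ≠ 0 ∧ ∃ i j, α = ε i + ε j ∨ α = ε i - ε j ∨ α = -ε i - ε j}
  vPlus : 𝔤
  vMinus : 𝔤
  vPlus_mem : vPlus ∈ restrictedRootSpace 𝔞 ((2 : ℝ) • ε (Fin.last rk))
  vMinus_mem : vMinus ∈ restrictedRootSpace 𝔞 (-((2 : ℝ) • ε (Fin.last rk)))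
  sl2 : IsSl2Triple ⁅vPlus, vMinus⁆ vPlus vMinus

namespace HTTData

section Algebra

variable {𝔤 : Type*} [LieRing 𝔤] [LieAlgebra ℝ 𝔤] (D : HTTData 𝔤)

/-- The simple roots `α_i = ε_i - ε_{i+1}` for `i < r` and `α_r = 2ε_r`. -/
def simpleRoot (i : Fin (D.rk + 1)) : Module.Dual ℝ D.𝔞 :=
  if h : (i : ℕ) < D.rk then D.ε i - D.ε ⟨i + 1, Nat.succ_lt_succ h⟩ else (2 : ℝ) • D.ε i

/-- The positive roots: the roots that are combinations of the simple roots with coefficients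
in `ℕ`. -/
def positiveRoots : Set (Module.Dual ℝ D.𝔞) :=
  {α | α ∈ restrictedRoots D.𝔞 ∧ ∃ c : Fin (D.rk + 1) → ℕ, α = ∑ i, c i • D.simpleRoot i}

/-- `Σ_Θ⁺ = Σ⁺ ∖ Span(Δ ∖ Θ)` for `Θ = {α_r}`. -/
def thetaRoots : Set (Module.Dual ℝ D.𝔞) :=
  {α | α ∈ D.positiveRoots ∧
    α ∉ Submodule.span ℝ (D.simpleRoot '' {i | i ≠ Fin.last D.rk})}

/-- `𝔲⁺`, the sum of the root spaces of the elements of `Σ_Θ⁺`. -/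
def uPlus : Submodule ℝ 𝔤 := ⨆ α ∈ D.thetaRoots, restrictedRootSpace D.𝔞 α

/-- `𝔲⁻`, the sum of the root spaces of the opposites of the elements of `Σ_Θ⁺`. -/
def uMinus : Submodule ℝ 𝔤 := ⨆ α ∈ D.thetaRoots, restrictedRootSpace D.𝔞 (-α)

end Algebra

end HTTData

/-! ### Lie groups: adjoint action and exponential map -/

namespace LieGrp

section

variable {n : ℕ} {G : Type*} [TopologicalSpace G] [ChartedSpace (EuclideanSpace ℝ (Fin n)) G]
  [Group G]

/-- Smooth Lie groups have the regularity under which Mathlib defines their Lie algebra. -/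
instance instLieGroupMinSmoothness [LieGroup (𝓡 n) ∞ G] :
    LieGroup (𝓡 n) (minSmoothness ℝ 3) G :=
  LieGroup.of_le (n := ∞) (by
    rw [minSmoothness_of_isRCLikeNormedField]
    exact WithTop.coe_le_coe.2 (le_top : (3 : ℕ∞) ≤ ⊤))

/-- The adjoint action of `g`: the derivative at `1` of `x ↦ g x g⁻¹`. -/
def Ad (g : G) : GroupLieAlgebra (𝓡 n) G →L[ℝ] GroupLieAlgebra (𝓡 n) G :=
  (mfderiv (𝓡 n) (𝓡 n) (fun x : G => g * x * g⁻¹) (1 : G) :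
    EuclideanSpace ℝ (Fin n) →L[ℝ] EuclideanSpace ℝ (Fin n))

theorem Ad_one : Ad (n := n) (1 : G) = ContinuousLinearMap.id ℝ _ := by
  have h : (fun x : G => 1 * x * 1⁻¹) = id := by
    ext x
    simp
  unfold Ad
  rw [h]
  exact mfderiv_id

variable [LieGroup (𝓡 n) ∞ G]

theorem mdifferentiable_conj (g : G) :
    MDifferentiable (𝓡 n) (𝓡 n) (fun x : G => g * x * g⁻¹) := by
  have h : ContMDiff (𝓡 n) (𝓡 n) ∞ (fun x : G => g * x * g⁻¹) :=
    (contMDiff_mul_right (a := g⁻¹)).comp (contMDiff_mul_left (a := g))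
  exact h.mdifferentiable (by simp)

theorem Ad_mul (g h : G) : Ad (n := n) (g * h) = (Ad g).comp (Ad h) := by
  have e : (fun x : G => (g * h) * x * (g * h)⁻¹) =
      (fun x : G => g * x * g⁻¹) ∘ (fun x : G => h * x * h⁻¹) := by
    ext x
    simp [mul_assoc]
  have h1 : (fun x : G => h * x * h⁻¹) 1 = 1 := by simp
  have key : HasMFDerivAt (𝓡 n) (𝓡 n) (fun x : G => g * x * g⁻¹)
      ((fun x : G => h * x * h⁻¹) 1) (Ad (n := n) g) := by
    rw [h1]
    exact (mdifferentiable_conj g 1).hasMFDerivAt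
  have key2 := key.comp (1 : G) (mdifferentiable_conj (n := n) h 1).hasMFDerivAt
  unfold Ad
  rw [e]
  exact key2.mfderiv

end

section

variable {n : ℕ} {G : Type*} [TopologicalSpace G] [ChartedSpace (EuclideanSpace ℝ (Fin n)) G]
  [Group G]

/-- `γ` is the one-parameter subgroup of `G` with initial velocity `X`. (Such a `γ` exists, is unique
and is smooth.) -/
def IsOneParam (γ : ℝ → G) (X : GroupLieAlgebra (𝓡 n) G) : Prop :=
  (∀ s t, γ (s + t) = γ s * γ t) ∧
    HasMFDerivAt 𝓘(ℝ, ℝ) (𝓡 n) γ 0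
      (ContinuousLinearMap.toSpanSingleton ℝ (X : EuclideanSpace ℝ (Fin n)))

open Classical in
/-- The exponential map: `exp X = γ 1` for the one-parameter subgroup `γ` with velocity `X`. -/
def exp (X : GroupLieAlgebra (𝓡 n) G) : G :=
  if h : ∃ γ : ℝ → G, IsOneParam γ X then h.choose 1 else 1

variable [LieGroup (𝓡 n) ∞ G]

/-- The normalizer in `G` of a subspace of the Lie algebra, for the adjoint action. -/
def normalizer (V : Submodule ℝ (GroupLieAlgebra (𝓡 n) G)) : Subgroup G where
  carrier := {g | ∀ X, Ad g X ∈ V ↔ X ∈ V}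
  mul_mem' := by
    intro g h hg hh X
    rw [Ad_mul]
    exact (hg _).trans (hh X)
  one_mem' := by
    intro X
    rw [Ad_one]
    rfl
  inv_mem' := by
    intro g hg X
    have h : Ad g (Ad g⁻¹ X) = X := by
      have e := Ad_mul (n := n) g g⁻¹
      rw [mul_inv_cancel, Ad_one] at e
      exact (congrArg (fun φ => φ X) e).symm
    rw [← hg (Ad g⁻¹ X), h]

end

end LieGrp

/-! ### The Shilov boundary, its photons and the Kobayashi pseudo-metric -/

namespace HTTData

section Geometry

variable {n : ℕ} {G : Type*} [TopologicalSpace G] [ChartedSpace (EuclideanSpace ℝ (Fin n)) G]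
  [Group G] [LieGroup (𝓡 n) ∞ G] (D : HTTData (GroupLieAlgebra (𝓡 n) G))

/-- The parabolic subgroup `P`, normalizer of `𝔲⁺`. -/
def parabolic : Subgroup G := LieGrp.normalizer D.uPlus

/-- The opposite parabolic subgroup `P⁻`, normalizer of `𝔲⁻`. -/
def oppParabolic : Subgroup G := LieGrp.normalizer D.uMinus

/-- The Shilov boundary `Sb(G) = G/P`, with the quotient topology. -/
abbrev ShilovBoundary : Type _ := G ⧸ D.parabolic

/-- The opposite flag manifold `G/P⁻`. -/
abbrev OppShilovBoundary : Type _ := G ⧸ D.oppParabolic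

/-- Transversality: `(x, ξ)` belongs to the `G`-orbit of `(P, P⁻)`. -/
def Transverse (x : D.ShilovBoundary) (ξ : D.OppShilovBoundary) : Prop :=
  ∃ g : G, x = (g : D.ShilovBoundary) ∧ ξ = (g : D.OppShilovBoundary)

/-- `Z_ξ`, the set of points that are not transverse to `ξ`. -/
def nonTransverse (ξ : D.OppShilovBoundary) : Set D.ShilovBoundary :=
  {x | ¬ D.Transverse x ξ}

/-- A domain: a nonempty connected open subset. -/
def IsFlagDomain (Ω : Set D.ShilovBoundary) : Prop := IsOpen Ω ∧ IsConnected Ω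

/-- Properness: the closure avoids `Z_ξ` for some `ξ`. -/
def IsProperSet (Ω : Set D.ShilovBoundary) : Prop :=
  ∃ ξ, closure Ω ∩ D.nonTransverse ξ = ∅

/-- The parametrization `i` of the standard photon: `i [1 : t] = exp(t v⁻) P`, and
`i [0 : 1] = exp(v⁺) exp(-v⁻) P` because `[0 : 1]` is the image of `[1 : 0]` under
`!![1, 1; 0, 1] * !![1, 0; -1, 1]`. -/
def stdPhoton : OnePoint ℝ → D.ShilovBoundary
  | OnePoint.infty => ((LieGrp.exp D.vPlus * LieGrp.exp (-D.vMinus) : G) : D.ShilovBoundary)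
  | OnePoint.some t => ((LieGrp.exp (t • D.vMinus) : G) : D.ShilovBoundary)

/-- The parametrization `i_g = g · i` of the photon `g · Λ_std`. -/
def photonParam (g : G) (s : OnePoint ℝ) : D.ShilovBoundary := g • D.stdPhoton s

/-- The set of photons: the translates of the standard photon. -/
def photons : Set (Set D.ShilovBoundary) := {Λ | ∃ g : G, Λ = range (D.photonParam g)}

/-- Two points of `Ω` are conjugate if they lie in the same connected component of `Λ ∩ Ω` for some
photon `Λ`. -/
def Conjugate (Ω : Set D.ShilovBoundary) (x y : D.ShilovBoundary) : Prop :=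
  ∃ Λ ∈ D.photons, x ∈ Λ ∩ Ω ∧ y ∈ connectedComponentIn (Λ ∩ Ω) x

/-- `c 0, …, c N` is an `N`-chain from `x` to `y` in `Ω`. -/
structure IsChain (Ω : Set D.ShilovBoundary) (x y : D.ShilovBoundary) (N : ℕ)
    (c : ℕ → D.ShilovBoundary) : Prop where
  mem : ∀ i ≤ N, c i ∈ Ω
  start : c 0 = x
  finish : c N = y
  conj : ∀ i < N, D.Conjugate Ω (c i) (c (i + 1))

/-- The number `k_Ω(x, y)` for conjugate points `x, y`: the Hilbert pseudo-distance
`H_{i_g⁻¹(I)}(i_g⁻¹ x, i_g⁻¹ y)`, where `g · Λ_std` is the photon through `x` and `y`, and `I` is the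
component of its intersection with `Ω` that contains `x` and `y`. This number does not depend on
`g` (and is `0` for `x = y`), so that the infimum below is over a set with one value. -/
def kob (Ω : Set D.ShilovBoundary) (x y : D.ShilovBoundary) : ℝ≥0∞ :=
  ⨅ (g : G) (s : OnePoint ℝ) (t : OnePoint ℝ) (_ : D.photonParam g s = x)
    (_ : D.photonParam g t = y)
    (_ : x ∈ Ω ∧ y ∈ connectedComponentIn (range (D.photonParam g) ∩ Ω) x),
    ENNReal.ofReal (ProjLine.hilbert
      (D.photonParam g ⁻¹' connectedComponentIn (range (D.photonParam g) ∩ Ω) x) s t)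

/-- The Kobayashi pseudo-metric `K_Ω`, with values in `[0, ∞]`. -/
def kobayashi (Ω : Set D.ShilovBoundary) (x y : D.ShilovBoundary) : ℝ≥0∞ :=
  ⨅ (N : ℕ) (_ : 1 ≤ N) (c : ℕ → D.ShilovBoundary) (_ : D.IsChain Ω x y N c),
    ∑ i ∈ Finset.range N, D.kob Ω (c i) (c (i + 1))

/-- `m` is the Kobayashi pseudo-metric of `Ω`. In particular the latter is then finite and separates
points. -/
def IsKobayashiMetric (Ω : Set D.ShilovBoundary) (m : MetricSpace Ω) : Prop :=
  ∀ x y : Ω, D.kobayashi Ω x y = ENNReal.ofReal (m.dist x y)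

/-- `Ω` is Kobayashi hyperbolic: `K_Ω` is a metric on `Ω`. -/
def KobayashiHyperbolic (Ω : Set D.ShilovBoundary) : Prop :=
  ∃ m : MetricSpace Ω, D.IsKobayashiMetric Ω m

end Geometry

end HTTData

end

/-! Properness puts the closure of `Ω` inside one affine chart `X ↦ g exp(X) P`, `X ∈ 𝔲⁻`
(`isOpenEmbedding_expChart`, `IsProperSet.exists_closure_subset`). There a photon becomes an affine
line whose direction lies in the orbit of `v⁻` under the Levi subgroup, with one extra point outside
the chart, and the photon parameter is the affine parameter up to a homography (`exists_isMoebius`).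
So `k_Ω` is the Hilbert metric of the components of `Ω` on affine lines with these rank one
directions (`kob_le`, `le_kob`), and the task is to compare it with a norm on `𝔲⁻`.

Lower bound: the point at infinity of a rank one line is not in the chart, hence not in `closure Ω`.
It depends continuously on the line, and the unit rank one vectors form a compact set, so the lines
through points near `X₀` leave `Ω` within a uniform length (`exists_uniform_bound`). Along them the
Hilbert metric dominates a multiple of the norm; the truncated distance to `X₀` is therefore
Lipschitz for `k_Ω`, hence for `K_Ω` (`exists_le_kobayashi`). This separates points and makes small
`K_Ω`-balls small in the chart.

Upper bound: the orbit of `v⁻` spans a subspace of `𝔲⁻` stable under degree `0`, which is all of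
`𝔲⁻` because `𝔤` is simple (`span_direction`). A point close to `X` is reached by moving along the
vectors of a basis of rank one directions in turn, inside a ball contained in `Ω`, each move costing
at most a multiple of its length (`tendsto_kobayashi`). This gives continuity of `K_Ω` on the
diagonal, and finiteness by connectedness.

The algebra behind this: the element `h₀ ∈ 𝔞` with `ε_i(h₀) = 1/2` grades `𝔤` in degrees `-1, 0, 1`,
with `𝔲⁻` and `𝔲⁺` as extreme parts. The complex structure forces the root space of `2ε_r` to be a
line (`exists_eq_smul_of_longRoot`), so `(ad v⁻)²` has image in `ℝ v⁻`; hence `exp 𝔲⁺` acts on the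
standard photon by homographies. The chart is open because two transverse filtrations come from a
common grading (`exists_common_grading`), derivations of `𝔤` being inner. -/

noncomputable section

/-! ### One-parameter subgroups and the exponential map -/

namespace LieGrp

section OneParam

variable {n : ℕ} {G : Type*} [TopologicalSpace G] [ChartedSpace (EuclideanSpace ℝ (Fin n)) G]
  [Group G]

variable (n G) in
theorem isTopologicalGroup [LieGroup (𝓡 n) ∞ G] : IsTopologicalGroup G :=
  topologicalGroup_of_lieGroup (𝓡 n) ∞

-- A locally Euclidean space has closed points, and a topological group with closed points is
-- Hausdorff. Uniqueness of integral curves needs this.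
variable (n G) in
theorem t2Space [LieGroup (𝓡 n) ∞ G] : T2Space G := by
  have : IsTopologicalGroup G := isTopologicalGroup n G
  have : T1Space G := ChartedSpace.t1Space (EuclideanSpace ℝ (Fin n)) G
  exact IsTopologicalGroup.t2Space_iff_one_closed.2 isClosed_singleton

/-- Linear maps out of `ℝ` are determined by their value at `1`, so velocities can be compared as
vectors of the model space, whatever base points index the tangent spaces. -/
theorem hasMFDerivWithinAt_curve_congr {γ γ' : ℝ → G} {t : ℝ} {s : Set ℝ}
    {L L' : ℝ →L[ℝ] EuclideanSpace ℝ (Fin n)} (h : HasMFDerivWithinAt 𝓘(ℝ, ℝ) (𝓡 n) γ s t L)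
    (e : γ' = γ) (hL : L' 1 = L 1) : HasMFDerivWithinAt 𝓘(ℝ, ℝ) (𝓡 n) γ' s t L' := by
  subst e
  have : L' = L := by ext1; exact hL
  rw [this]
  exact h

theorem hasMFDerivAt_curve_congr {γ γ' : ℝ → G} {t : ℝ}
    {L L' : ℝ →L[ℝ] EuclideanSpace ℝ (Fin n)} (h : HasMFDerivAt 𝓘(ℝ, ℝ) (𝓡 n) γ t L)
    (e : γ' = γ) (hL : L' 1 = L 1) : HasMFDerivAt 𝓘(ℝ, ℝ) (𝓡 n) γ' t L' := by
  subst e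
  have : L' = L := by ext1; exact hL
  rw [this]
  exact h

theorem IsOneParam.zero {γ : ℝ → G} {X : GroupLieAlgebra (𝓡 n) G} (h : IsOneParam γ X) :
    γ 0 = 1 := by
  have := h.1 0 0
  simpa using this

variable [LieGroup (𝓡 n) ∞ G]

theorem hasMFDerivAt_mul_left (g h : G) :
    HasMFDerivAt (𝓡 n) (𝓡 n) (fun x : G => g * x) h
      (mfderiv (𝓡 n) (𝓡 n) (fun x : G => g * x) h) :=
  ((contMDiff_mul_left (I := 𝓡 n) (n := ∞) (a := g)).mdifferentiable (by simp) h).hasMFDerivAt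

theorem contMDiff_invariant (X : GroupLieAlgebra (𝓡 n) G) :
    ContMDiff (𝓡 n) (𝓡 n).tangent 1
      (fun g : G => (⟨g, mulInvariantVectorField X g⟩ : TangentBundle (𝓡 n) G)) := by
  refine (contMDiff_mulInvariantVectorField X).of_le ?_
  rw [minSmoothness_of_isRCLikeNormedField]
  norm_num

theorem IsMIntegralCurve.mul_left {γ : ℝ → G} {X : GroupLieAlgebra (𝓡 n) G} {t : ℝ} {s : Set ℝ}
    (g : G) (h : HasMFDerivWithinAt 𝓘(ℝ, ℝ) (𝓡 n) γ s t
      ((1 : ℝ →L[ℝ] ℝ).smulRight (mulInvariantVectorField X (γ t)))) :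
    HasMFDerivWithinAt 𝓘(ℝ, ℝ) (𝓡 n) (fun t => g * γ t) s t
      ((1 : ℝ →L[ℝ] ℝ).smulRight (mulInvariantVectorField X (g * γ t))) := by
  have h1 := (hasMFDerivAt_mul_left (n := n) g (γ t)).comp_hasMFDerivWithinAt t h
  refine hasMFDerivWithinAt_curve_congr h1 rfl ?_
  have h2 := ((hasMFDerivAt_mul_left (n := n) g (γ t * 1)).comp (1 : G)
    (hasMFDerivAt_mul_left (n := n) (γ t) 1)).mfderiv
  have h3 : (fun x : G => g * x) ∘ (fun x : G => γ t * x) = fun x => (g * γ t) * x := by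
    ext x; simp [mul_assoc]
  rw [h3] at h2
  have h4 := congrArg (fun φ => φ X) h2
  rw [mul_one] at h4
  change (1 : ℝ) • (mulInvariantVectorField X (g * γ t) : EuclideanSpace ℝ (Fin n)) =
    mfderiv (𝓡 n) (𝓡 n) (fun x : G => g * x) (γ t)
      ((1 : ℝ) • (mulInvariantVectorField X (γ t) : EuclideanSpace ℝ (Fin n)))
  rw [one_smul, one_smul]
  exact h4

/-- Write `γ s = γ t * γ (s - t)` and differentiate at `s = t`: the velocity is the left translate
of the initial one. -/
theorem IsOneParam.isMIntegralCurve {γ : ℝ → G} {X : GroupLieAlgebra (𝓡 n) G}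
    (h : IsOneParam γ X) : IsMIntegralCurve γ (mulInvariantVectorField X) := by
  intro t
  have h0 : HasMFDerivAt 𝓘(ℝ, ℝ) (𝓡 n) (fun s => γ (s - t)) t
      ((1 : ℝ →L[ℝ] ℝ).smulRight (X : EuclideanSpace ℝ (Fin n))) := by
    have h1 : HasMFDerivAt 𝓘(ℝ, ℝ) 𝓘(ℝ, ℝ) (fun s : ℝ => s - t) t (1 : ℝ →L[ℝ] ℝ) :=
      ((hasFDerivAt_id t).sub_const t).hasMFDerivAt
    have h2 := h.2
    have h3 : t - t = 0 := sub_self t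
    rw [← h3] at h2
    have h4 := HasMFDerivAt.comp (f := fun s : ℝ => s - t) t h2 h1
    refine hasMFDerivAt_curve_congr h4 rfl ?_
    change (1 : ℝ) • (X : EuclideanSpace ℝ (Fin n)) =
      ContinuousLinearMap.toSpanSingleton ℝ (X : EuclideanSpace ℝ (Fin n)) 1
    simp
  have hmul := hasMFDerivAt_mul_left (n := n) (γ t) (γ (t - t))
  have h5 := hmul.comp t h0
  have e : (fun x : G => γ t * x) ∘ (fun s => γ (s - t)) = γ := by
    ext s
    simp [← h.1]
  rw [e] at h5
  refine hasMFDerivAt_curve_congr h5 rfl ?_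
  have : γ (t - t) = 1 := by rw [sub_self, h.zero]
  change (1 : ℝ) • (mulInvariantVectorField X (γ t) : EuclideanSpace ℝ (Fin n)) =
    mfderiv (𝓡 n) (𝓡 n) (fun x : G => γ t * x) (γ (t - t))
      ((1 : ℝ) • (X : EuclideanSpace ℝ (Fin n)))
  rw [one_smul, one_smul, this]
  rfl

theorem IsOneParam.unique {γ γ' : ℝ → G} {X : GroupLieAlgebra (𝓡 n) G}
    (h : IsOneParam γ X) (h' : IsOneParam γ' X) : γ = γ' := by
  have : T2Space G := t2Space n G
  have : IsManifold (𝓡 n) 1 G := IsManifold.of_le (n := ∞) (by simp)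
  exact isMIntegralCurve_Ioo_eq_of_contMDiff_boundaryless (t₀ := 0) (contMDiff_invariant X)
    h.isMIntegralCurve h'.isMIntegralCurve (by rw [h.zero, h'.zero])

/-- Left translates of a local integral curve through `1` give integral curves through every point
with the same lifetime, so the left-invariant field is complete. The homomorphism property is
uniqueness: `t ↦ γ s * γ t` and `t ↦ γ (s + t)` are integral curves that agree at `0`. -/
theorem exists_isOneParam (X : GroupLieAlgebra (𝓡 n) G) : ∃ γ : ℝ → G, IsOneParam γ X := by
  have : T2Space G := t2Space n G
  have : IsManifold (𝓡 n) 1 G := IsManifold.of_le (n := ∞) (by simp)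
  have hv := contMDiff_invariant (n := n) X
  obtain ⟨γ, hγ0, hγ⟩ := exists_isMIntegralCurveAt_of_contMDiffAt_boundaryless (t₀ := 0)
    (hv.contMDiffAt (x := (1 : G)))
  rw [isMIntegralCurveAt_iff'] at hγ
  obtain ⟨ε, hε, hγ⟩ := hγ
  obtain ⟨γ, hγ0, hγ⟩ := exists_isMIntegralCurve_of_isMIntegralCurveOn hv hε (fun x => by
    refine ⟨fun t => x * γ t, by simp [hγ0], ?_⟩
    rw [Real.ball_eq_Ioo, zero_sub, zero_add] at hγ
    intro t ht
    exact IsMIntegralCurve.mul_left x (hγ t ht)) (1 : G)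
  refine ⟨γ, ?_, ?_⟩
  · intro s t
    have h1 : IsMIntegralCurve (fun t => γ s * γ t) (mulInvariantVectorField X) := by
      intro t
      exact hasMFDerivWithinAt_univ.1
        (IsMIntegralCurve.mul_left _ (hγ t).hasMFDerivWithinAt)
    have h2 := hγ.comp_add s
    have h3 := isMIntegralCurve_Ioo_eq_of_contMDiff_boundaryless (t₀ := 0) hv h2 h1
      (by simp [hγ0])
    have h4 := congrFun h3 t
    simp only [Function.comp] at h4
    rw [← h4, add_comm]
  · have h1 := hγ 0
    refine hasMFDerivAt_curve_congr h1 rfl ?_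
    rw [hγ0]
    have e : (fun x : G => 1 * x) = id := by ext; simp
    change (1 : ℝ) • (X : EuclideanSpace ℝ (Fin n)) =
      (1 : ℝ) • (mfderiv (𝓡 n) (𝓡 n) (fun x : G => 1 * x) 1 X : EuclideanSpace ℝ (Fin n))
    rw [e, mfderiv_id]
    rfl

/-- The one-parameter subgroup with initial velocity `X`. -/
def oneParam (X : GroupLieAlgebra (𝓡 n) G) : ℝ → G := (exists_isOneParam X).choose

theorem oneParam_spec (X : GroupLieAlgebra (𝓡 n) G) : IsOneParam (oneParam X) X :=
  (exists_isOneParam X).choose_spec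

theorem IsOneParam.exp_eq {γ : ℝ → G} {X : GroupLieAlgebra (𝓡 n) G} (h : IsOneParam γ X) :
    exp X = γ 1 := by
  have hex : ∃ γ : ℝ → G, IsOneParam γ X := ⟨γ, h⟩
  rw [exp, dif_pos hex, hex.choose_spec.unique h]

theorem IsOneParam.smul {γ : ℝ → G} {X : GroupLieAlgebra (𝓡 n) G} (h : IsOneParam γ X) (c : ℝ) :
    IsOneParam (fun t => γ (t * c)) (c • X) := by
  refine ⟨fun s t => by simp only [← h.1, add_mul], ?_⟩
  have h1 : HasMFDerivAt 𝓘(ℝ, ℝ) 𝓘(ℝ, ℝ) (fun s : ℝ => s * c) 0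
      (ContinuousLinearMap.toSpanSingleton ℝ c) := by
    have := (hasDerivAt_id (0 : ℝ)).mul_const c
    simp only [one_mul, id] at this
    exact this.hasFDerivAt.hasMFDerivAt
  have h2 := h.2
  have h3 : (0 : ℝ) * c = 0 := zero_mul c
  rw [← h3] at h2
  have h4 := HasMFDerivAt.comp (f := fun s : ℝ => s * c) 0 h2 h1
  refine hasMFDerivAt_curve_congr h4 rfl ?_
  change (1 : ℝ) • (c • X : EuclideanSpace ℝ (Fin n)) =
    ((1 : ℝ) • c) • (X : EuclideanSpace ℝ (Fin n))
  simp

theorem IsOneParam.exp_smul_eq {γ : ℝ → G} {X : GroupLieAlgebra (𝓡 n) G} (h : IsOneParam γ X)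
    (t : ℝ) : exp (t • X) = γ t := by
  rw [(h.smul t).exp_eq, one_mul]

theorem isOneParam_exp (X : GroupLieAlgebra (𝓡 n) G) : IsOneParam (fun t => (exp (t • X) : G)) X := by
  have h := oneParam_spec X
  have : (fun t : ℝ => (exp (t • X) : G)) = oneParam X := by
    ext t
    rw [h.exp_smul_eq]
  rw [this]
  exact h

theorem exp_add_smul (X : GroupLieAlgebra (𝓡 n) G) (s t : ℝ) :
    (exp ((s + t) • X) : G) = exp (s • X) * exp (t • X) := (isOneParam_exp X).1 s t

theorem exp_zero : (exp (0 : GroupLieAlgebra (𝓡 n) G) : G) = 1 := by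
  have := (isOneParam_exp (0 : GroupLieAlgebra (𝓡 n) G)).zero
  simpa using this

theorem exp_neg (X : GroupLieAlgebra (𝓡 n) G) : (exp (-X) : G) = (exp X)⁻¹ := by
  have h := exp_add_smul X (-1) 1
  rw [neg_add_cancel, zero_smul, exp_zero, one_smul, neg_smul, one_smul] at h
  exact eq_inv_of_mul_eq_one_left h.symm

theorem continuous_exp_smul (X : GroupLieAlgebra (𝓡 n) G) :
    Continuous (fun t : ℝ => (exp (t • X) : G)) := by
  rw [continuous_iff_continuousAt]
  intro t
  exact ((isOneParam_exp X).isMIntegralCurve t).continuousAt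

theorem exp_conj (g : G) (X : GroupLieAlgebra (𝓡 n) G) :
    (exp (Ad g X) : G) = g * exp X * g⁻¹ := by
  have h := isOneParam_exp X
  have h2 : IsOneParam (fun t : ℝ => g * exp (t • X) * g⁻¹) (Ad g X) := by
    refine ⟨fun s t => ?_, ?_⟩
    · simp only [exp_add_smul]
      group
    · have h3 := (mdifferentiable_conj (n := n) g 1).hasMFDerivAt
      have h4 := h.2
      have h5 : (1 : G) = exp ((0 : ℝ) • X) := h.zero.symm
      rw [h5] at h3
      have h6 := h3.comp 0 h4
      refine hasMFDerivAt_curve_congr h6 rfl ?_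
      rw [← h5]
      change (1 : ℝ) • (Ad g X : EuclideanSpace ℝ (Fin n)) =
        mfderiv (𝓡 n) (𝓡 n) (fun x : G => g * x * g⁻¹) 1 ((1 : ℝ) • (X : EuclideanSpace ℝ (Fin n)))
      rw [one_smul, one_smul]
      rfl
  rw [h2.exp_eq, one_smul]

end OneParam

end LieGrp

/-! ### The differential of the adjoint representation is the bracket -/

namespace LieGrp

section Chart

variable {n : ℕ} {G : Type*} [TopologicalSpace G] [ChartedSpace (EuclideanSpace ℝ (Fin n)) G]
  [Group G]

/-- The chart at the identity. -/
def chart (n : ℕ) (G : Type*) [TopologicalSpace G] [ChartedSpace (EuclideanSpace ℝ (Fin n)) G]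
    [Group G] : PartialEquiv G (EuclideanSpace ℝ (Fin n)) := extChartAt (𝓡 n) (1 : G)

/-- The multiplication, read in the chart at the identity. -/
def chartMul (n : ℕ) (G : Type*) [TopologicalSpace G] [ChartedSpace (EuclideanSpace ℝ (Fin n)) G]
    [Group G] (p : EuclideanSpace ℝ (Fin n) × EuclideanSpace ℝ (Fin n)) :
    EuclideanSpace ℝ (Fin n) :=
  chart n G ((chart n G).symm p.1 * (chart n G).symm p.2)

theorem chart_symm_one : (chart n G).symm (chart n G 1) = 1 := extChartAt_to_inv _

theorem chart_target_mem : (chart n G).target ∈ 𝓝 (chart n G 1) := extChartAt_target_mem_nhds _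

theorem chart_source_mem : (chart n G).source ∈ 𝓝 (1 : G) := extChartAt_source_mem_nhds _

/-- Tangent vectors at `1` are by definition read in the preferred chart at `1`, which is this
chart. -/
theorem hasMFDerivAt_chart_one :
    HasMFDerivAt (𝓡 n) 𝓘(ℝ, EuclideanSpace ℝ (Fin n)) (chart n G) (1 : G)
      (ContinuousLinearMap.id ℝ (EuclideanSpace ℝ (Fin n))) := by
  refine ⟨continuousAt_extChartAt _, ?_⟩
  have h : HasFDerivWithinAt (id : EuclideanSpace ℝ (Fin n) → _)
    (ContinuousLinearMap.id ℝ (EuclideanSpace ℝ (Fin n))) (range (𝓡 n))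
    (extChartAt (𝓡 n) (1 : G) 1) := (hasFDerivAt_id _).hasFDerivWithinAt
  refine h.congr_of_eventuallyEq ?_ ?_
  · refine Filter.eventuallyEq_of_mem (extChartAt_target_mem_nhdsWithin (1 : G)) ?_
    intro y hy
    simp only [writtenInExtChartAt, extChartAt_model_space_eq_id, PartialEquiv.refl_coe, id,
      Function.comp]
    exact (extChartAt (𝓡 n) (1 : G)).right_inv hy
  · simp only [writtenInExtChartAt, extChartAt_model_space_eq_id, PartialEquiv.refl_coe, id,
      Function.comp]
    exact congrArg _ (extChartAt_to_inv _)

theorem hasMFDerivAt_chart_symm :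
    HasMFDerivAt 𝓘(ℝ, EuclideanSpace ℝ (Fin n)) (𝓡 n) (chart n G).symm (chart n G 1)
      (ContinuousLinearMap.id ℝ (EuclideanSpace ℝ (Fin n))) := by
  refine ⟨continuousAt_extChartAt_symm _, ?_⟩
  have h : HasFDerivWithinAt (id : EuclideanSpace ℝ (Fin n) → _)
    (ContinuousLinearMap.id ℝ (EuclideanSpace ℝ (Fin n)))
    (range 𝓘(ℝ, EuclideanSpace ℝ (Fin n)))
    (extChartAt 𝓘(ℝ, EuclideanSpace ℝ (Fin n)) (chart n G 1) (chart n G 1)) :=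
    (hasFDerivAt_id _).hasFDerivWithinAt
  have e : (chart n G).symm (chart n G 1) = 1 := chart_symm_one
  refine h.congr_of_eventuallyEq ?_ ?_
  · refine Filter.eventuallyEq_of_mem (mem_nhdsWithin_of_mem_nhds (chart_target_mem (G := G))) ?_
    intro y hy
    simp only [writtenInExtChartAt, extChartAt_model_space_eq_id, PartialEquiv.refl_coe, id,
      Function.comp, e, PartialEquiv.refl_symm]
    exact (extChartAt (𝓡 n) (1 : G)).right_inv hy
  · simp only [writtenInExtChartAt, extChartAt_model_space_eq_id, PartialEquiv.refl_coe, id,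
      Function.comp, e, PartialEquiv.refl_symm]
    rfl

variable [LieGroup (𝓡 n) ∞ G]

theorem hasMFDerivAt_chart {g : G} (hg : g ∈ (chart n G).source) :
    HasMFDerivAt (𝓡 n) 𝓘(ℝ, EuclideanSpace ℝ (Fin n)) (chart n G) g
      (mfderiv (𝓡 n) 𝓘(ℝ, EuclideanSpace ℝ (Fin n)) (chart n G) g) := by
  have : IsManifold (𝓡 n) 1 G := IsManifold.of_le (n := ∞) (by simp)
  have h : g ∈ (chartAt (EuclideanSpace ℝ (Fin n)) (1 : G)).source := by
    rwa [chart, extChartAt_source] at hg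
  exact (mdifferentiableAt_extChartAt h).hasMFDerivAt

/-- The differential of the left translation by `g` at the identity. -/
def dLeft (g : G) : EuclideanSpace ℝ (Fin n) →L[ℝ] EuclideanSpace ℝ (Fin n) :=
  mfderiv (𝓡 n) (𝓡 n) (fun x : G => g * x) (1 : G)

/-- The differential of the right translation by `g` at the identity. -/
def dRight (g : G) : EuclideanSpace ℝ (Fin n) →L[ℝ] EuclideanSpace ℝ (Fin n) :=
  mfderiv (𝓡 n) (𝓡 n) (fun x : G => x * g) (1 : G)

/-- The differential of the chart at the identity. -/
def dChart (g : G) : EuclideanSpace ℝ (Fin n) →L[ℝ] EuclideanSpace ℝ (Fin n) :=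
  mfderiv (𝓡 n) 𝓘(ℝ, EuclideanSpace ℝ (Fin n)) (chart n G) g

/-- Differentiate `g x = (g x g⁻¹) g` at `x = 1`. This expresses `Ad` through the two partial
differentials of the multiplication. -/
theorem dRight_comp_Ad (g : G) : (dRight g).comp (Ad (n := n) g) = dLeft (n := n) g := by
  have e : (fun x : G => g * x) = (fun x : G => x * g) ∘ (fun x : G => g * x * g⁻¹) := by
    ext x
    simp
  have h1 : g * 1 * g⁻¹ = 1 := by simp
  have key : HasMFDerivAt (𝓡 n) (𝓡 n) (fun x : G => x * g)
      ((fun x : G => g * x * g⁻¹) 1) (dRight (n := n) g) := by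
    beta_reduce
    rw [h1]
    exact ((contMDiff_mul_right (I := 𝓡 n) (n := ∞) (a := g)).mdifferentiable (by simp)
      1).hasMFDerivAt
  have key2 := key.comp (1 : G) (mdifferentiable_conj (n := n) g 1).hasMFDerivAt
  rw [← e] at key2
  exact key2.mfderiv.symm

theorem hasFDerivAt_chart_comp {F : G → G} {g : G} (hg : g ∈ (chart n G).source)
    (hF1 : F 1 = g) {L : EuclideanSpace ℝ (Fin n) →L[ℝ] EuclideanSpace ℝ (Fin n)}
    (hF : HasMFDerivAt (𝓡 n) (𝓡 n) F 1 L) :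
    HasFDerivAt (fun y => chart n G (F ((chart n G).symm y))) ((dChart g).comp L)
      (chart n G 1) := by
  subst hF1
  have h0 := hasMFDerivAt_chart_symm (n := n) (G := G)
  have e : (chart n G).symm (chart n G 1) = 1 := chart_symm_one
  rw [← e] at hF
  have h1 := hF.comp _ h0
  have h2 := hasMFDerivAt_chart hg
  have e2 : F 1 = (F ∘ (chart n G).symm) (chart n G 1) := by simp only [Function.comp, e]
  have h3 : ∀ g g' : G, g = g' →
      HasMFDerivAt (𝓡 n) 𝓘(ℝ, EuclideanSpace ℝ (Fin n)) (chart n G) g (dChart g) →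
      HasMFDerivAt (𝓡 n) 𝓘(ℝ, EuclideanSpace ℝ (Fin n)) (chart n G) g' (dChart g) := by
    rintro g g' rfl h
    exact h
  replace h3 := h3 _ _ e2 h2
  exact (h3.comp _ h1).hasFDerivAt

theorem hasFDerivAt_chart_mul_left {x : EuclideanSpace ℝ (Fin n)} (hx : x ∈ (chart n G).target) :
    HasFDerivAt (fun y => chartMul n G (x, y))
      ((dChart ((chart n G).symm x)).comp (dLeft (n := n) ((chart n G).symm x)))
      (chart n G 1) :=
  hasFDerivAt_chart_comp (F := fun y => (chart n G).symm x * y) ((chart n G).map_target hx)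
    (mul_one _) (hasMFDerivAt_mul_left _ _)

theorem hasFDerivAt_chart_mul_right {x : EuclideanSpace ℝ (Fin n)}
    (hx : x ∈ (chart n G).target) :
    HasFDerivAt (fun y => chartMul n G (y, x))
      ((dChart ((chart n G).symm x)).comp (dRight (n := n) ((chart n G).symm x)))
      (chart n G 1) :=
  hasFDerivAt_chart_comp (F := fun y => y * (chart n G).symm x) ((chart n G).map_target hx)
    (one_mul _) ((contMDiff_mul_right (I := 𝓡 n) (n := ∞)
      (a := (chart n G).symm x)).mdifferentiable (by simp) 1).hasMFDerivAt

theorem contDiffAt_chartMul : ContDiffAt ℝ ∞ (chartMul n G) (chart n G 1, chart n G 1) := by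
  have h1 : ContMDiffAt 𝓘(ℝ, EuclideanSpace ℝ (Fin n)) (𝓡 n) ∞ (chart n G).symm
      (chart n G 1) :=
    (contMDiffOn_extChartAt_symm (n := ∞) (I := 𝓡 n) (1 : G)).contMDiffAt chart_target_mem
  have h2 : ContMDiffAt (𝓡 n) 𝓘(ℝ, EuclideanSpace ℝ (Fin n)) ∞ (chart n G) (1 : G) :=
    contMDiffAt_extChartAt
  have h3 : ContMDiffAt 𝓘(ℝ, EuclideanSpace ℝ (Fin n) × EuclideanSpace ℝ (Fin n)) (𝓡 n) ∞
      (fun p : EuclideanSpace ℝ (Fin n) × EuclideanSpace ℝ (Fin n) =>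
        (chart n G).symm p.1 * (chart n G).symm p.2) (chart n G 1, chart n G 1) := by
    refine ContMDiffAt.mul ?_ ?_
    · exact ContMDiffAt.comp (f := Prod.fst) (chart n G 1, chart n G 1) h1
        contDiff_fst.contMDiff.contMDiffAt
    · exact ContMDiffAt.comp (f := Prod.snd) (chart n G 1, chart n G 1) h1
        contDiff_snd.contMDiff.contMDiffAt
  have h4 : ContMDiffAt (𝓡 n) 𝓘(ℝ, EuclideanSpace ℝ (Fin n)) ∞ (chart n G)
      ((fun p : EuclideanSpace ℝ (Fin n) × EuclideanSpace ℝ (Fin n) =>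
        (chart n G).symm p.1 * (chart n G).symm p.2) (chart n G 1, chart n G 1)) := by
    simp only [chart_symm_one, mul_one]
    exact h2
  exact (ContMDiffAt.comp (f := fun p : EuclideanSpace ℝ (Fin n) × EuclideanSpace ℝ (Fin n) =>
    (chart n G).symm p.1 * (chart n G).symm p.2) (chart n G 1, chart n G 1) h4 h3).contDiffAt

/-- The partial differential of `chartMul` in the second variable, at the identity. -/
def partialSnd (n : ℕ) (G : Type*) [TopologicalSpace G]
    [ChartedSpace (EuclideanSpace ℝ (Fin n)) G] [Group G] (x : EuclideanSpace ℝ (Fin n)) :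
    EuclideanSpace ℝ (Fin n) →L[ℝ] EuclideanSpace ℝ (Fin n) :=
  (fderiv ℝ (chartMul n G) (x, chart n G 1)).comp (ContinuousLinearMap.inr ℝ _ _)

/-- The partial differential of `chartMul` in the first variable, at the identity. -/
def partialFst (n : ℕ) (G : Type*) [TopologicalSpace G]
    [ChartedSpace (EuclideanSpace ℝ (Fin n)) G] [Group G] (x : EuclideanSpace ℝ (Fin n)) :
    EuclideanSpace ℝ (Fin n) →L[ℝ] EuclideanSpace ℝ (Fin n) :=
  (fderiv ℝ (chartMul n G) (chart n G 1, x)).comp (ContinuousLinearMap.inl ℝ _ _)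

theorem eventually_differentiableAt_chartMul :
    ∀ᶠ p in 𝓝 (chart n G 1, chart n G 1), DifferentiableAt ℝ (chartMul n G) p := by
  have h := (contDiffAt_chartMul (n := n) (G := G)).of_le (m := 1) (by simp)
  filter_upwards [h.eventually (by simp)] with p hp
  exact hp.differentiableAt (by simp)

theorem eventually_partialSnd_eq : ∀ᶠ x in 𝓝 (chart n G 1), partialSnd n G x =
    (dChart ((chart n G).symm x)).comp (dLeft (n := n) ((chart n G).symm x)) := by
  have hc : ContinuousAt (fun x => (x, chart n G 1)) (chart n G 1) := by fun_prop
  filter_upwards [hc.eventually eventually_differentiableAt_chartMul, chart_target_mem] with x h1 h2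
  have h3 := HasFDerivAt.comp (f := fun y => (x, y)) (chart n G 1) h1.hasFDerivAt
    ((hasFDerivAt_const x (chart n G 1)).prodMk (hasFDerivAt_id (chart n G 1)))
  exact h3.unique (hasFDerivAt_chart_mul_left h2)

theorem eventually_partialFst_eq : ∀ᶠ x in 𝓝 (chart n G 1), partialFst n G x =
    (dChart ((chart n G).symm x)).comp (dRight (n := n) ((chart n G).symm x)) := by
  have hc : ContinuousAt (fun x => (chart n G 1, x)) (chart n G 1) := by fun_prop
  filter_upwards [hc.eventually eventually_differentiableAt_chartMul, chart_target_mem] with x h1 h2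
  have h3 := HasFDerivAt.comp (f := fun y => (y, x)) (chart n G 1) h1.hasFDerivAt
    ((hasFDerivAt_id (chart n G 1)).prodMk (hasFDerivAt_const x (chart n G 1)))
  exact h3.unique (hasFDerivAt_chart_mul_right h2)

theorem dChart_one : dChart (n := n) (1 : G) = ContinuousLinearMap.id ℝ _ :=
  hasMFDerivAt_chart_one.mfderiv

theorem dLeft_one : dLeft (n := n) (1 : G) = ContinuousLinearMap.id ℝ _ := by
  have h : (fun x : G => 1 * x) = id := by ext x; simp
  unfold dLeft
  rw [h]
  exact mfderiv_id

theorem dRight_one : dRight (n := n) (1 : G) = ContinuousLinearMap.id ℝ _ := by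
  have h : (fun x : G => x * 1) = id := by ext x; simp
  unfold dRight
  rw [h]
  exact mfderiv_id

theorem partialSnd_one : partialSnd n G (chart n G 1) = ContinuousLinearMap.id ℝ _ := by
  rw [eventually_partialSnd_eq.self_of_nhds, chart_symm_one, dChart_one, dLeft_one]
  rfl

theorem partialFst_one : partialFst n G (chart n G 1) = ContinuousLinearMap.id ℝ _ := by
  rw [eventually_partialFst_eq.self_of_nhds, chart_symm_one, dChart_one, dRight_one]
  rfl

/-- The second differential of `chartMul` at the identity. -/
def chartMulSnd (n : ℕ) (G : Type*) [TopologicalSpace G]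
    [ChartedSpace (EuclideanSpace ℝ (Fin n)) G] [Group G] :=
  fderiv ℝ (fderiv ℝ (chartMul n G)) (chart n G 1, chart n G 1)

theorem hasFDerivAt_fderiv_chartMul :
    HasFDerivAt (fderiv ℝ (chartMul n G)) (chartMulSnd n G) (chart n G 1, chart n G 1) := by
  have h := (contDiffAt_chartMul (n := n) (G := G)).fderiv_right (m := 1) (by
    rw [one_add_one_eq_two]
    exact WithTop.coe_le_coe.2 (le_top : (2 : ℕ∞) ≤ ⊤))
  exact (h.differentiableAt (by simp)).hasFDerivAt

theorem chartMulSnd_symm (u v) : chartMulSnd n G u v = chartMulSnd n G v u :=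
  (contDiffAt_chartMul (n := n) (G := G)).isSymmSndFDerivAt (by
    rw [minSmoothness_of_isRCLikeNormedField]
    exact WithTop.coe_le_coe.2 (le_top : (2 : ℕ∞) ≤ ⊤)) u v

/-- The differential of `partialSnd` at the identity. -/
def dPartial (n : ℕ) (G : Type*) [TopologicalSpace G]
    [ChartedSpace (EuclideanSpace ℝ (Fin n)) G] [Group G] : EuclideanSpace ℝ (Fin n) →L[ℝ]
    EuclideanSpace ℝ (Fin n) →L[ℝ] EuclideanSpace ℝ (Fin n) :=
  ((ContinuousLinearMap.compL ℝ (EuclideanSpace ℝ (Fin n)) _ (EuclideanSpace ℝ (Fin n))).flip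
    (ContinuousLinearMap.inr ℝ (EuclideanSpace ℝ (Fin n)) (EuclideanSpace ℝ (Fin n)))).comp
    ((chartMulSnd n G).comp (ContinuousLinearMap.inl ℝ _ _))

theorem hasFDerivAt_partialSnd : HasFDerivAt (partialSnd n G) (dPartial n G) (chart n G 1) := by
  have h1 : HasFDerivAt (fun x => fderiv ℝ (chartMul n G) (x, chart n G 1))
      ((chartMulSnd n G).comp (ContinuousLinearMap.inl ℝ _ _)) (chart n G 1) :=
    HasFDerivAt.comp (f := fun x => (x, chart n G 1)) (chart n G 1) hasFDerivAt_fderiv_chartMul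
      ((hasFDerivAt_id (chart n G 1)).prodMk (hasFDerivAt_const (chart n G 1) (chart n G 1)))
  exact (((ContinuousLinearMap.compL ℝ (EuclideanSpace ℝ (Fin n)) _
    (EuclideanSpace ℝ (Fin n))).flip
    (ContinuousLinearMap.inr ℝ (EuclideanSpace ℝ (Fin n))
      (EuclideanSpace ℝ (Fin n)))).hasFDerivAt).comp (chart n G 1) h1

/-- The two partial differentials have transposed derivatives by symmetry of the second differential
of the multiplication; their difference will be the bracket. -/
theorem hasFDerivAt_partialFst :
    HasFDerivAt (partialFst n G) (dPartial n G).flip (chart n G 1) := by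
  have h1 : HasFDerivAt (fun x => fderiv ℝ (chartMul n G) (chart n G 1, x))
      ((chartMulSnd n G).comp (ContinuousLinearMap.inr ℝ _ _)) (chart n G 1) :=
    HasFDerivAt.comp (f := fun x => (chart n G 1, x)) (chart n G 1) hasFDerivAt_fderiv_chartMul
      ((hasFDerivAt_const (chart n G 1) (chart n G 1)).prodMk (hasFDerivAt_id (chart n G 1)))
  have h2 := (((ContinuousLinearMap.compL ℝ (EuclideanSpace ℝ (Fin n)) _
    (EuclideanSpace ℝ (Fin n))).flip
    (ContinuousLinearMap.inl ℝ (EuclideanSpace ℝ (Fin n))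
      (EuclideanSpace ℝ (Fin n)))).hasFDerivAt).comp (chart n G 1) h1
  refine HasFDerivAt.congr_fderiv h2 ?_
  ext1 u
  ext1 v
  exact chartMulSnd_symm (0, u) (v, 0)

/-- The adjoint representation, as a map to the space of operators of the model space. -/
def adOp (g : G) : EuclideanSpace ℝ (Fin n) →L[ℝ] EuclideanSpace ℝ (Fin n) := Ad (n := n) g

/-- In the chart, `dRight g ∘ Ad g = dLeft g` reads `partialFst * Ad = partialSnd`. The first factor
is the identity at the base point, hence invertible nearby. -/
theorem eventually_Ad_eq : ∀ᶠ x in 𝓝 (chart n G 1), adOp (n := n) ((chart n G).symm x) =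
    Ring.inverse (partialFst n G x) * partialSnd n G x := by
  have hu : ∀ᶠ x in 𝓝 (chart n G 1), IsUnit (partialFst n G x) := by
    have h1 := (hasFDerivAt_partialFst (n := n) (G := G)).continuousAt
    refine h1.eventually (Units.isOpen.mem_nhds ?_)
    rw [partialFst_one]
    exact isUnit_one
  filter_upwards [hu, eventually_partialFst_eq, eventually_partialSnd_eq] with x h1 h2 h3
  have h4 : partialFst n G x * adOp (n := n) ((chart n G).symm x) = partialSnd n G x := by
    rw [h2, h3, ← dRight_comp_Ad]
    rfl
  rw [← h4, ← mul_assoc, Ring.inverse_mul_cancel _ h1, one_mul]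

theorem hasFDerivAt_Ad : HasFDerivAt (fun x => adOp (n := n) ((chart n G).symm x))
    (dPartial n G - (dPartial n G).flip) (chart n G 1) := by
  have h1 : HasFDerivAt (fun x => Ring.inverse (partialFst n G x))
      (-(dPartial n G).flip) (chart n G 1) := by
    have h := hasFDerivAt_ringInverse (𝕜 := ℝ)
      (1 : (EuclideanSpace ℝ (Fin n) →L[ℝ] EuclideanSpace ℝ (Fin n))ˣ)
    have e : ((1 : (EuclideanSpace ℝ (Fin n) →L[ℝ] EuclideanSpace ℝ (Fin n))ˣ) :
      EuclideanSpace ℝ (Fin n) →L[ℝ] EuclideanSpace ℝ (Fin n)) = partialFst n G (chart n G 1) :=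
      partialFst_one.symm
    rw [e] at h
    refine (h.comp _ hasFDerivAt_partialFst).congr_fderiv ?_
    ext1 u
    ext1 v
    simp
  refine ((h1.mul' hasFDerivAt_partialSnd).congr_of_eventuallyEq eventually_Ad_eq).congr_fderiv ?_
  ext1 u
  ext1 v
  simp only [partialSnd_one, partialFst_one]
  have : Ring.inverse (ContinuousLinearMap.id ℝ (EuclideanSpace ℝ (Fin n))) =
    ContinuousLinearMap.id ℝ _ := Ring.inverse_one _
  simp [this, sub_eq_add_neg]

theorem eventually_mpullback_eq (X : GroupLieAlgebra (𝓡 n) G) : ∀ᶠ x in 𝓝 (chart n G 1),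
    VectorField.mpullbackWithin 𝓘(ℝ, EuclideanSpace ℝ (Fin n)) (𝓡 n) (chart n G).symm
      (mulInvariantVectorField X) (range (𝓡 n)) x = partialSnd n G x X := by
  have : IsManifold (𝓡 n) 1 G := IsManifold.of_le (n := ∞) (by simp)
  filter_upwards [eventually_partialSnd_eq, chart_target_mem] with x h1 h2
  rw [VectorField.mpullbackWithin_apply, h1]
  have h3 := ContinuousLinearMap.inverse_eq
    (mfderivWithin_extChartAt_symm_comp_mfderiv_extChartAt (I := 𝓡 n) (x := (1 : G)) h2)
    (mfderiv_extChartAt_comp_mfderivWithin_extChartAt_symm (I := 𝓡 n) (x := (1 : G)) h2)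
  exact congrArg (fun φ => φ (mulInvariantVectorField X ((chart n G).symm x))) h3

/-- Read in the chart, the left-invariant field of `X` is `x ↦ partialSnd x X`, whose value at the
base point is `X` and whose derivative there is given by `dPartial`; the formula is then that of the
bracket of vector fields in a vector space. -/
theorem bracket_eq (X Y : GroupLieAlgebra (𝓡 n) G) :
    ⁅X, Y⁆ = (dPartial n G X Y - dPartial n G Y X : EuclideanSpace ℝ (Fin n)) := by
  rw [GroupLieAlgebra.bracket_def, ← VectorField.mlieBracketWithin_univ,
    VectorField.mlieBracketWithin_apply]
  have h1 : mfderiv (𝓡 n) 𝓘(ℝ, EuclideanSpace ℝ (Fin n)) (extChartAt (𝓡 n) (1 : G)) (1 : G) =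
    ContinuousLinearMap.id ℝ (EuclideanSpace ℝ (Fin n)) := hasMFDerivAt_chart_one.mfderiv
  have h2 : ∀ X : GroupLieAlgebra (𝓡 n) G, HasFDerivAt
      (VectorField.mpullbackWithin 𝓘(ℝ, EuclideanSpace ℝ (Fin n)) (𝓡 n) (chart n G).symm
      (mulInvariantVectorField X) (range (𝓡 n)) : EuclideanSpace ℝ (Fin n) →
        EuclideanSpace ℝ (Fin n))
      ((dPartial n G).flip X) (chart n G 1) := by
    intro X
    have h := (hasFDerivAt_partialSnd (n := n) (G := G)).clm_apply
      (hasFDerivAt_const (X : EuclideanSpace ℝ (Fin n)) (chart n G 1))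
    refine (h.congr_of_eventuallyEq (eventually_mpullback_eq X)).congr_fderiv ?_
    ext1 u
    simp only [add_apply, add_eq_right]
    exact map_zero (partialSnd n G (chart n G 1))
  have h3 : ∀ X : GroupLieAlgebra (𝓡 n) G,
      (VectorField.mpullbackWithin 𝓘(ℝ, EuclideanSpace ℝ (Fin n)) (𝓡 n) (chart n G).symm
      (mulInvariantVectorField X) (range (𝓡 n)) (chart n G 1)) = X := by
    intro X
    rw [(eventually_mpullback_eq X).self_of_nhds, partialSnd_one]
    rfl
  rw [h1]
  have h4 : ∀ Z, (ContinuousLinearMap.id ℝ (EuclideanSpace ℝ (Fin n))).inverse Z = Z := by simp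
  have h5 : (range (𝓡 n)) = univ := by simp
  refine Eq.trans (h4 _) ?_
  have h6 : (extChartAt (𝓡 n) (1 : G)).symm ⁻¹' univ ∩ range (𝓡 n) = univ := by
    rw [h5, preimage_univ, univ_inter]
  have key : ∀ (V W : EuclideanSpace ℝ (Fin n) → EuclideanSpace ℝ (Fin n))
      (s : Set (EuclideanSpace ℝ (Fin n)))
      (V' W' : EuclideanSpace ℝ (Fin n) →L[ℝ] EuclideanSpace ℝ (Fin n))
      (x v w : EuclideanSpace ℝ (Fin n)), s = univ → HasFDerivAt V V' x → HasFDerivAt W W' x →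
      V x = v → W x = w → VectorField.lieBracketWithin ℝ V W s x = W' v - V' w := by
    rintro V W s V' W' x v w rfl hV hW rfl rfl
    rw [VectorField.lieBracketWithin_univ, VectorField.lieBracket_eq]
    simp only [hV.fderiv, hW.fderiv]
  exact key _ _ _ ((dPartial n G).flip X) ((dPartial n G).flip Y) _ _ _ h6 (h2 X) (h2 Y) (h3 X) (h3 Y)

/-- Differentiability in the chart gives continuity at `1`, and multiplicativity carries it to every
point. -/
theorem continuous_adOp : Continuous (adOp (n := n) (G := G)) := by
  have : IsTopologicalGroup G := isTopologicalGroup n G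
  have h1 : ContinuousAt (adOp (n := n) (G := G)) 1 := by
    have h2 := (hasFDerivAt_Ad (n := n) (G := G)).continuousAt.comp (x := (1 : G))
      (hasMFDerivAt_chart_one (n := n)).continuousAt
    refine h2.congr ?_
    filter_upwards [chart_source_mem (n := n)] with g hg
    simp only [Function.comp]
    rw [(chart n G).left_inv hg]
  have h3 : ∀ g h : G, adOp (n := n) (g * h) = adOp (n := n) g * adOp (n := n) h := Ad_mul
  rw [continuous_iff_continuousAt]
  intro g
  have h4 : adOp (n := n) (G := G) = fun h => adOp (n := n) g * adOp (n := n) (g⁻¹ * h) := by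
    ext1 h
    rw [← h3, mul_inv_cancel_left]
  rw [h4]
  refine continuousAt_const.mul ?_
  refine ContinuousAt.comp (f := fun h => g⁻¹ * h) (g := adOp (n := n)) ?_ (by fun_prop)
  rw [inv_mul_cancel]
  exact h1

theorem hasDerivAt_Ad_oneParam_zero (X : GroupLieAlgebra (𝓡 n) G)
    (Y : EuclideanSpace ℝ (Fin n)) :
    HasDerivAt (fun t : ℝ => adOp (n := n) (exp (t • X) : G) Y)
      ((dPartial n G - (dPartial n G).flip) X Y) 0 := by
  have h1 := (isOneParam_exp X).2
  have h0 := (isOneParam_exp X).zero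
  have h2 : HasDerivAt (fun t : ℝ => chart n G (exp (t • X) : G))
      (X : EuclideanSpace ℝ (Fin n)) 0 := by
    have h3 : ∀ g g' : G, g = g' → HasMFDerivAt (𝓡 n) 𝓘(ℝ, EuclideanSpace ℝ (Fin n))
        (chart n G) g (ContinuousLinearMap.id ℝ (EuclideanSpace ℝ (Fin n))) →
        HasMFDerivAt (𝓡 n) 𝓘(ℝ, EuclideanSpace ℝ (Fin n)) (chart n G) g'
        (ContinuousLinearMap.id ℝ (EuclideanSpace ℝ (Fin n))) := by
      rintro g g' rfl h
      exact h
    have h4 := h3 _ _ h0.symm hasMFDerivAt_chart_one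
    have h5 : HasFDerivAt (fun t : ℝ => chart n G (exp (t • X) : G))
      (ContinuousLinearMap.toSpanSingleton ℝ (X : EuclideanSpace ℝ (Fin n))) 0 :=
      (HasMFDerivAt.comp (f := fun t : ℝ => (exp (t • X) : G)) 0 h4 h1).hasFDerivAt
    refine h5.hasDerivAt.congr_deriv ?_
    change (1 : ℝ) • (X : EuclideanSpace ℝ (Fin n)) = X
    rw [one_smul]
  have h6 : HasFDerivAt (fun x => adOp (n := n) ((chart n G).symm x) Y)
      ((dPartial n G - (dPartial n G).flip).flip Y) (chart n G 1) := by
    refine ((hasFDerivAt_Ad (n := n) (G := G)).clm_apply (hasFDerivAt_const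
      (Y : EuclideanSpace ℝ (Fin n)) (chart n G 1))).congr_fderiv ?_
    ext1 u
    simp only [add_apply, add_eq_right]
    exact map_zero (adOp (n := n) ((chart n G).symm (chart n G 1)))
  have h00 : (exp ((0 : ℝ) • X) : G) = 1 := h0
  have h7 := HasFDerivAt.comp_hasDerivAt_of_eq (0 : ℝ) h6 h2 (by rw [h00])
  refine (h7.congr_of_eventuallyEq ?_).congr_deriv ?_
  · have hc := continuous_exp_smul X
    have h8 : ∀ᶠ t : ℝ in 𝓝 0, (exp (t • X) : G) ∈ (chart n G).source := by
      refine hc.continuousAt.eventually ?_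
      beta_reduce
      rw [h00]
      exact chart_source_mem
    filter_upwards [h8] with t ht
    simp only [Function.comp]
    rw [(chart n G).left_inv ht]
  · rfl

theorem contMDiff_conj (g : G) : ContMDiff (𝓡 n) (𝓡 n) ∞ (fun x : G => g * x * g⁻¹) :=
  (contMDiff_mul_right (a := g⁻¹)).comp (contMDiff_mul_left (a := g))

theorem mfderiv_conj_comp (g g' h : G) (hg : g' * g = 1) :
    (mfderiv (𝓡 n) (𝓡 n) (fun x : G => g' * x * g'⁻¹) (g * h * g⁻¹)).comp
      (mfderiv (𝓡 n) (𝓡 n) (fun x : G => g * x * g⁻¹) h) =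
    ContinuousLinearMap.id ℝ (EuclideanSpace ℝ (Fin n)) := by
  have h1 := ((contMDiff_conj g').mdifferentiable (by simp) (g * h * g⁻¹)).hasMFDerivAt.comp h
    ((contMDiff_conj (n := n) g).mdifferentiable (by simp) h).hasMFDerivAt
  have e : (fun x : G => g' * x * g'⁻¹) ∘ (fun x : G => g * x * g⁻¹) = id := by
    ext x
    obtain rfl : g' = g⁻¹ := eq_inv_of_mul_eq_one_left hg
    simp [mul_assoc]
  rw [e] at h1
  exact h1.mfderiv.symm.trans mfderiv_id

theorem mfderiv_conj_comp_dLeft (g h : G) :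
    (mfderiv (𝓡 n) (𝓡 n) (fun x : G => g * x * g⁻¹) h).comp
      (dLeft (n := n) h) = (dLeft (n := n) (g * h * g⁻¹)).comp (Ad (n := n) g) := by
  have e : (fun x : G => g * x * g⁻¹) ∘ (fun x : G => h * x) =
      (fun x : G => g * h * g⁻¹ * x) ∘ (fun x : G => g * x * g⁻¹) := by
    ext x
    simp only [Function.comp]
    group
  have h1 := (((contMDiff_conj g).mdifferentiable (by simp) (h * 1)).hasMFDerivAt).comp (1 : G)
    (hasMFDerivAt_mul_left (n := n) h 1)
  have h2 := (hasMFDerivAt_mul_left (n := n) (g * h * g⁻¹) (g * 1 * g⁻¹)).comp (1 : G)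
    ((contMDiff_conj g).mdifferentiable (by simp) 1).hasMFDerivAt
  rw [e] at h1
  have h3 := h1.mfderiv.symm.trans h2.mfderiv
  rw [mul_one, mul_one, mul_inv_cancel] at h3
  exact h3

theorem inverse_mfderiv_conj (g h : G) :
    (mfderiv (𝓡 n) (𝓡 n) (fun x : G => g⁻¹ * x * g⁻¹⁻¹) h).inverse =
      mfderiv (𝓡 n) (𝓡 n) (fun x : G => g * x * g⁻¹) (g⁻¹ * h * g⁻¹⁻¹) := by
  refine ContinuousLinearMap.inverse_eq ?_ ?_
  · have h1 := mfderiv_conj_comp (n := n) g g⁻¹ (g⁻¹ * h * g⁻¹⁻¹) (by simp)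
    have e : g * (g⁻¹ * h * g⁻¹⁻¹) * g⁻¹ = h := by group
    rw [e] at h1
    exact h1
  · exact mfderiv_conj_comp (n := n) g⁻¹ g h (by simp)

theorem mpullback_conj (g : G) (X : GroupLieAlgebra (𝓡 n) G) :
    VectorField.mpullback (𝓡 n) (𝓡 n) (fun x : G => g⁻¹ * x * g⁻¹⁻¹)
      (mulInvariantVectorField X) = mulInvariantVectorField (Ad g X) := by
  ext1 h
  rw [VectorField.mpullback_apply, inverse_mfderiv_conj]
  have h1 := congrArg (fun φ => φ X) (mfderiv_conj_comp_dLeft (n := n) g (g⁻¹ * h * g⁻¹⁻¹))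
  have e : g * (g⁻¹ * h * g⁻¹⁻¹) * g⁻¹ = h := by group
  rw [e] at h1
  exact h1

/-- Conjugation pulls left-invariant fields back to left-invariant fields (`mpullback_conj`), and
pullbacks by diffeomorphisms commute with brackets. -/
theorem Ad_lie (g : G) (X Y : GroupLieAlgebra (𝓡 n) G) : Ad g ⁅X, Y⁆ = ⁅Ad g X, Ad g Y⁆ := by
  have h1 := VectorField.mpullback_mlieBracket (n := minSmoothness ℝ 3)
    (f := fun x : G => g⁻¹ * x * g⁻¹⁻¹) (x₀ := (1 : G))
    (mdifferentiableAt_mulInvariantVectorField X) (mdifferentiableAt_mulInvariantVectorField Y)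
    ((contMDiff_conj (n := n) g⁻¹).contMDiffAt.of_le (by
      rw [minSmoothness_of_isRCLikeNormedField]
      exact WithTop.coe_le_coe.2 (le_top : (3 : ℕ∞) ≤ ⊤)))
    (minSmoothness_monotone (by norm_cast))
  rw [mpullback_conj, mpullback_conj, VectorField.mpullback_apply, inverse_mfderiv_conj] at h1
  have e : g⁻¹ * 1 * g⁻¹⁻¹ = 1 := by group
  rw [e] at h1
  exact h1

end Chart

end LieGrp

/-! ### Linear flows on nilpotent vectors -/

section Nilpotent

variable {E : Type*} [NormedAddCommGroup E] [NormedSpace ℝ E] {A : ℝ → E →L[ℝ] E} {B : E →L[ℝ] E}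

/-- For a solution of `A' = A B` with `A 0 = 1`, the orbit of a vector killed by a power of `B` is
the truncated exponential series. In this lemma and the next two, subtracting the higher terms
leaves a curve with zero derivative, by the case of the previous order applied to `B Y`. -/
theorem flow_eq_of_nilpotent_one (hA : ∀ Y t, HasDerivAt (fun t => A t Y) (A t (B Y)) t)
    (h0 : A 0 = 1) {Y : E} (h : B Y = 0) (t : ℝ) : A t Y = Y := by
  have h1 : ∀ t : ℝ, HasDerivAt (fun t : ℝ => A t Y) 0 t := by
    intro t
    refine (hA Y t).congr_deriv ?_
    rw [h, map_zero]
  have h2 := is_const_of_deriv_eq_zero (fun t => (h1 t).differentiableAt)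
    (fun t => (h1 t).deriv) t 0
  simpa [h0] using h2

theorem flow_eq_of_nilpotent_two (hA : ∀ Y t, HasDerivAt (fun t => A t Y) (A t (B Y)) t)
    (h0 : A 0 = 1) {Y : E} (h : B (B Y) = 0) (t : ℝ) : A t Y = Y + t • B Y := by
  have h1 : ∀ t : ℝ, HasDerivAt (fun t : ℝ => A t Y - t • B Y) 0 t := by
    intro t
    refine ((hA Y t).sub ((hasDerivAt_id t).smul_const (B Y))).congr_deriv ?_
    rw [flow_eq_of_nilpotent_one hA h0 h, one_smul, sub_self]
  have h2 := is_const_of_deriv_eq_zero (fun t => (h1 t).differentiableAt)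
    (fun t => (h1 t).deriv) t 0
  simp only [zero_smul, h0, sub_zero] at h2
  rw [sub_eq_iff_eq_add] at h2
  exact h2

theorem flow_eq_of_nilpotent_three (hA : ∀ Y t, HasDerivAt (fun t => A t Y) (A t (B Y)) t)
    (h0 : A 0 = 1) {Y : E} (h : B (B (B Y)) = 0) (t : ℝ) :
    A t Y = Y + t • B Y + (t ^ 2 / 2) • B (B Y) := by
  have h1 : ∀ t : ℝ, HasDerivAt (fun t : ℝ => A t Y - t • B Y - (t ^ 2 / 2) • B (B Y)) 0 t := by
    intro t
    refine (((hA Y t).sub ((hasDerivAt_id t).smul_const (B Y))).sub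
      (((hasDerivAt_pow 2 t).div_const 2).smul_const (B (B Y)))).congr_deriv ?_
    rw [flow_eq_of_nilpotent_two hA h0 h]
    simp only [one_smul, Nat.cast_ofNat, Nat.add_one_sub_one, pow_one]
    have : (2 * t / 2 : ℝ) = t := by ring
    rw [this, add_sub_cancel_left, sub_self]
  have h2 := is_const_of_deriv_eq_zero (fun t => (h1 t).differentiableAt)
    (fun t => (h1 t).deriv) t 0
  rw [sub_eq_iff_eq_add, sub_eq_iff_eq_add] at h2
  rw [h2, h0]
  simp
  abel

end Nilpotent

/-! ### Exponentials of nilpotent and of commuting elements -/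

namespace LieGrp

section Adjoint

variable {n : ℕ} {G : Type*} [TopologicalSpace G] [ChartedSpace (EuclideanSpace ℝ (Fin n)) G]
  [Group G] [LieGroup (𝓡 n) ∞ G]

theorem Ad_mul_apply (g h : G) (X : GroupLieAlgebra (𝓡 n) G) : Ad (g * h) X = Ad g (Ad h X) := by
  rw [Ad_mul]
  rfl

theorem Ad_one_apply (X : GroupLieAlgebra (𝓡 n) G) : Ad (1 : G) X = X := by
  rw [Ad_one]
  rfl

theorem Ad_inv_apply_Ad (g : G) (X : GroupLieAlgebra (𝓡 n) G) : Ad g⁻¹ (Ad g X) = X := by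
  rw [← Ad_mul_apply, inv_mul_cancel, Ad_one_apply]

theorem Ad_apply_Ad_inv (g : G) (X : GroupLieAlgebra (𝓡 n) G) : Ad g (Ad g⁻¹ X) = X := by
  rw [← Ad_mul_apply, mul_inv_cancel, Ad_one_apply]

/-- The adjoint action, as an automorphism of the Lie algebra. -/
def adEquiv (g : G) : GroupLieAlgebra (𝓡 n) G ≃ₗ⁅ℝ⁆ GroupLieAlgebra (𝓡 n) G where
  toFun X := Ad g X
  map_add' X Y := map_add (Ad g) X Y
  map_smul' c X := map_smul (Ad g) c X
  map_lie' := Ad_lie g _ _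
  invFun X := Ad g⁻¹ X
  left_inv X := Ad_inv_apply_Ad g X
  right_inv X := Ad_apply_Ad_inv g X

@[simp] theorem adEquiv_apply (g : G) (X : GroupLieAlgebra (𝓡 n) G) : adEquiv g X = Ad g X := rfl

instance : FiniteDimensional ℝ (GroupLieAlgebra (𝓡 n) G) :=
  inferInstanceAs (FiniteDimensional ℝ (EuclideanSpace ℝ (Fin n)))

instance : T2Space (GroupLieAlgebra (𝓡 n) G) :=
  inferInstanceAs (T2Space (EuclideanSpace ℝ (Fin n)))

/-- The bracket, as a bilinear map on the model space. -/
def bracketOp (n : ℕ) (G : Type*) [TopologicalSpace G]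
    [ChartedSpace (EuclideanSpace ℝ (Fin n)) G] [Group G] : EuclideanSpace ℝ (Fin n) →L[ℝ]
    EuclideanSpace ℝ (Fin n) →L[ℝ] EuclideanSpace ℝ (Fin n) :=
  dPartial n G - (dPartial n G).flip

theorem bracketOp_apply (X Y : GroupLieAlgebra (𝓡 n) G) : bracketOp n G X Y = ⁅X, Y⁆ :=
  (bracket_eq X Y).symm

theorem adOp_mul (g h : G) : adOp (n := n) (g * h) = adOp (n := n) g * adOp (n := n) h := Ad_mul g h

theorem adOp_one : adOp (n := n) (1 : G) = 1 := Ad_one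

theorem hasDerivAt_adOp_exp (X : GroupLieAlgebra (𝓡 n) G) (Y : EuclideanSpace ℝ (Fin n)) (t : ℝ) :
    HasDerivAt (fun t : ℝ => adOp (n := n) (exp (t • X) : G) Y)
      (adOp (n := n) (exp (t • X) : G) (bracketOp n G X Y)) t := by
  have h1 : HasDerivAt (fun t : ℝ => adOp (n := n) (exp (t • X) : G) Y) (bracketOp n G X Y) 0 :=
    hasDerivAt_Ad_oneParam_zero (G := G) X Y
  have h2 : HasDerivAt (fun s : ℝ => s - t) 1 t := (hasDerivAt_id t).sub_const t
  have h3 := HasDerivAt.scomp_of_eq t h1 h2 (sub_self t).symm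
  have h4 := (adOp (n := n) (exp (t • X) : G)).hasFDerivAt.comp_hasDerivAt t h3
  refine (h4.congr_of_eventuallyEq (Filter.Eventually.of_forall fun s => ?_)).congr_deriv ?_
  · simp only [Function.comp]
    rw [← mul_apply_eq_comp, ← adOp_mul, ← exp_add_smul, add_sub_cancel]
  · rw [one_smul]

theorem Ad_exp_smul_of_lie_lie_lie_eq_zero {X Y : GroupLieAlgebra (𝓡 n) G}
    (h : ⁅X, ⁅X, ⁅X, Y⁆⁆⁆ = 0) (t : ℝ) :
    Ad (exp (t • X) : G) Y = Y + t • ⁅X, Y⁆ + (t ^ 2 / 2) • ⁅X, ⁅X, Y⁆⁆ := by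
  let Y' : EuclideanSpace ℝ (Fin n) := Y
  have e1 := bracketOp_apply X Y
  have e2 := (congrArg (bracketOp n G X) e1).trans (bracketOp_apply X ⁅X, Y⁆)
  have e3 := (congrArg (bracketOp n G X) e2).trans (bracketOp_apply X ⁅X, ⁅X, Y⁆⁆)
  have key := flow_eq_of_nilpotent_three (A := fun t => adOp (n := n) (exp (t • X) : G))
    (B := bracketOp n G X) (hasDerivAt_adOp_exp X) (by rw [zero_smul, exp_zero, adOp_one])
    (Y := Y) (e3.trans h) t
  exact key.trans (congrArg₂ (fun Z W : EuclideanSpace ℝ (Fin n) =>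
    Y' + t • Z + (t ^ 2 / 2) • W) e1 e2)

theorem Ad_exp_of_lie_eq_zero {X Y : GroupLieAlgebra (𝓡 n) G} (h : ⁅X, Y⁆ = 0) :
    Ad (exp X : G) Y = Y := by
  have := Ad_exp_smul_of_lie_lie_lie_eq_zero (G := G) (X := X) (Y := Y) (by simp [h]) 1
  simpa [h] using this

theorem Ad_exp_of_lie_lie_lie_eq_zero {X Y : GroupLieAlgebra (𝓡 n) G}
    (h : ⁅X, ⁅X, ⁅X, Y⁆⁆⁆ = 0) :
    Ad (exp X : G) Y = Y + ⁅X, Y⁆ + (1 / 2 : ℝ) • ⁅X, ⁅X, Y⁆⁆ := by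
  have := Ad_exp_smul_of_lie_lie_lie_eq_zero h 1
  simpa using this

theorem exp_mul_exp_comm {X Y : GroupLieAlgebra (𝓡 n) G} (h : ⁅X, Y⁆ = 0) :
    (exp X : G) * exp Y = exp Y * exp X := by
  have h1 := Ad_exp_of_lie_eq_zero (G := G) h
  have h2 := exp_conj (exp X : G) Y
  rw [h1] at h2
  rw [eq_mul_inv_iff_mul_eq] at h2
  exact h2.symm

/-- The product of two commuting one-parameter subgroups is a one-parameter subgroup, and the
differential of the multiplication at `(1, 1)` is the sum, so its velocity is `X + Y`. -/
theorem exp_add_of_lie_eq_zero {X Y : GroupLieAlgebra (𝓡 n) G} (h : ⁅X, Y⁆ = 0) :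
    (exp (X + Y) : G) = exp X * exp Y := by
  have h1 : IsOneParam (fun t : ℝ => (exp (t • X) : G) * exp (t • Y)) (X + Y) := by
    refine ⟨fun s t => ?_, ?_⟩
    · simp only [exp_add_smul]
      have h2 : (exp (t • X) : G) * exp (s • Y) = exp (s • Y) * exp (t • X) := by
        refine exp_mul_exp_comm ?_
        rw [lie_smul, smul_lie, h, smul_zero, smul_zero]
      rw [mul_assoc, mul_assoc, ← mul_assoc (exp (t • X) : G), h2]
      simp only [mul_assoc]
    · have hX := (isOneParam_exp X : IsOneParam (fun t : ℝ => (exp (t • X) : G)) X)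
      have hY := (isOneParam_exp Y : IsOneParam (fun t : ℝ => (exp (t • Y) : G)) Y)
      have hm : MDifferentiableAt ((𝓡 n).prod (𝓡 n)) (𝓡 n) (fun p : G × G => p.1 * p.2)
          ((fun t : ℝ => (exp (t • X) : G)) 0, (fun t : ℝ => (exp (t • Y) : G)) 0) :=
        (contMDiff_mul (𝓡 n) ∞).mdifferentiable (by simp) _
      have h3 := HasMFDerivAt.comp (f := fun t : ℝ => ((exp (t • X) : G), (exp (t • Y) : G))) 0
        hm.hasMFDerivAt (hX.2.prodMk hY.2)
      refine hasMFDerivAt_curve_congr h3 rfl ?_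
      let X' : EuclideanSpace ℝ (Fin n) := X
      let Y' : EuclideanSpace ℝ (Fin n) := Y
      have h4 := mfderiv_prod_eq_add_apply hm (v := (X', Y'))
      have hX0 : (exp ((0 : ℝ) • X) : G) = 1 := hX.zero
      have hY0 : (exp ((0 : ℝ) • Y) : G) = 1 := hY.zero
      change (1 : ℝ) • (X + Y : EuclideanSpace ℝ (Fin n)) =
        (mfderiv ((𝓡 n).prod (𝓡 n)) (𝓡 n) (fun p : G × G => p.1 * p.2)
          ((exp ((0 : ℝ) • X) : G), (exp ((0 : ℝ) • Y) : G)))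
          ((1 : ℝ) • (X : EuclideanSpace ℝ (Fin n)), (1 : ℝ) • (Y : EuclideanSpace ℝ (Fin n)))
      rw [one_smul, one_smul, one_smul]
      refine Eq.trans ?_ h4.symm
      have e1 : (fun x : G => x * exp ((0 : ℝ) • Y)) = id := by ext x; rw [hY0, mul_one, id]
      have e2 : (fun x : G => exp ((0 : ℝ) • X) * x) = id := by ext x; rw [hX0, one_mul, id]
      change (X + Y : EuclideanSpace ℝ (Fin n)) =
        mfderiv (𝓡 n) (𝓡 n) (fun x : G => x * exp ((0 : ℝ) • Y)) (exp ((0 : ℝ) • X) : G) X +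
        mfderiv (𝓡 n) (𝓡 n) (fun x : G => exp ((0 : ℝ) • X) * x) (exp ((0 : ℝ) • Y) : G) Y
      rw [e1, e2, mfderiv_id, mfderiv_id]
      rfl
  have h2 := h1.exp_eq
  simp only [one_smul] at h2
  exact h2

/-- The exponential map is continuous on abelian subspaces. -/
theorem continuous_exp_of_abelian (V : Submodule ℝ (GroupLieAlgebra (𝓡 n) G))
    (hV : ∀ X ∈ V, ∀ Y ∈ V, ⁅X, Y⁆ = 0) :
    Continuous (fun X : V => (exp (X : GroupLieAlgebra (𝓡 n) G) : G)) := by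
  have : IsTopologicalGroup G := isTopologicalGroup n G
  let b := Module.finBasis ℝ V
  -- In coordinates of a basis, the exponential of an abelian subspace is a finite product of
  -- one-parameter subgroups, and each factor is continuous.
  have key : ∀ (l : List (Fin (Module.finrank ℝ V))) (X : V),
      (exp (((l.map fun i => b.repr X i • b i).sum : V) : GroupLieAlgebra (𝓡 n) G) : G) =
      (l.map fun i => (exp (b.repr X i • (b i : GroupLieAlgebra (𝓡 n) G)) : G)).prod := by
    intro l X
    induction l with
    | nil => simp [exp_zero]
    | cons i l ih =>
      rw [List.map_cons, List.sum_cons, List.map_cons, List.prod_cons, Submodule.coe_add,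
        exp_add_of_lie_eq_zero, ih]
      · rfl
      · exact hV _ (Submodule.coe_mem _) _ (Submodule.coe_mem _)
  have h1 : (fun X : V => (exp (X : GroupLieAlgebra (𝓡 n) G) : G)) = fun X =>
      ((List.finRange _).map fun i =>
        (exp (b.repr X i • (b i : GroupLieAlgebra (𝓡 n) G)) : G)).prod := by
    ext1 X
    rw [← key]
    congr 2
    conv_lhs => rw [← b.sum_repr X]
    rw [Fin.sum_univ_def]
  rw [h1]
  refine continuous_list_prod _ fun i _ => ?_
  refine (continuous_exp_smul (b i : GroupLieAlgebra (𝓡 n) G)).comp ?_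
  exact LinearMap.continuous_of_finiteDimensional ((b.coord i))

end Adjoint

end LieGrp

/-! ### Lie algebras graded in degrees -1, 0, 1 -/

section ThreeGrading

variable {𝔤 : Type*} [LieRing 𝔤] [LieAlgebra ℝ 𝔤]

/-- The element `h` defines a grading of `𝔤` in degrees `-1`, `0`, `1`. -/
def IsThreeGrading (h : 𝔤) : Prop := ∀ X : 𝔤, ⁅h, ⁅h, ⁅h, X⁆⁆⁆ = ⁅h, X⁆

/-- The elements of degree `k` for `h`. -/
def degSpace (h : 𝔤) (k : ℝ) : Submodule ℝ 𝔤 where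
  carrier := {X | ⁅h, X⁆ = k • X}
  add_mem' := by
    intro X Y hX hY
    rw [mem_ofPred_eq] at *
    rw [lie_add, hX, hY, smul_add]
  zero_mem' := by simp
  smul_mem' := by
    intro c X hX
    rw [mem_ofPred_eq] at *
    rw [lie_smul, hX, smul_comm]

/-- The sum of the spaces of degrees `0` and `1`. -/
def nonnegSpace (h : 𝔤) : Submodule ℝ 𝔤 where
  carrier := {X | ⁅h, ⁅h, X⁆⁆ = ⁅h, X⁆}
  add_mem' := by
    intro X Y hX hY
    rw [mem_ofPred_eq] at *
    rw [lie_add, lie_add, hX, hY]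
  zero_mem' := by simp
  smul_mem' := by
    intro c X hX
    rw [mem_ofPred_eq] at *
    rw [lie_smul, lie_smul, hX]

theorem mem_degSpace {h X : 𝔤} {k : ℝ} : X ∈ degSpace h k ↔ ⁅h, X⁆ = k • X := Iff.rfl

theorem mem_nonnegSpace {h X : 𝔤} : X ∈ nonnegSpace h ↔ ⁅h, ⁅h, X⁆⁆ = ⁅h, X⁆ := Iff.rfl

theorem mem_degSpace_one {h X : 𝔤} : X ∈ degSpace h 1 ↔ ⁅h, X⁆ = X := by
  rw [mem_degSpace, one_smul]

theorem mem_degSpace_zero {h X : 𝔤} : X ∈ degSpace h 0 ↔ ⁅h, X⁆ = 0 := by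
  rw [mem_degSpace, zero_smul]

theorem mem_degSpace_neg_one {h X : 𝔤} : X ∈ degSpace h (-1) ↔ ⁅h, X⁆ = -X := by
  rw [mem_degSpace, neg_one_smul]

theorem degSpace_neg (h : 𝔤) (k : ℝ) : degSpace (-h) k = degSpace h (-k) := by
  ext X
  rw [mem_degSpace, mem_degSpace, neg_lie, neg_eq_iff_eq_neg, neg_smul]

theorem lie_mem_degSpace {h X Y : 𝔤} {j k : ℝ} (hX : X ∈ degSpace h j) (hY : Y ∈ degSpace h k) :
    ⁅X, Y⁆ ∈ degSpace h (j + k) := by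
  rw [mem_degSpace] at *
  rw [leibniz_lie, hX, hY, smul_lie, lie_smul, add_smul]

theorem lie_mem_degSpace_of_eq {h X Y : 𝔤} {j k l : ℝ} (hX : X ∈ degSpace h j)
    (hY : Y ∈ degSpace h k) (hl : j + k = l) : ⁅X, Y⁆ ∈ degSpace h l :=
  hl ▸ lie_mem_degSpace hX hY

theorem map_lieEquiv (φ : 𝔤 ≃ₗ⁅ℝ⁆ 𝔤) (X Y : 𝔤) : φ ⁅X, Y⁆ = ⁅φ X, φ Y⁆ := LieHom.map_lie φ.toLieHom X Y

theorem map_mem_degSpace (φ : 𝔤 ≃ₗ⁅ℝ⁆ 𝔤) {h X : 𝔤} {k : ℝ} :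
    φ X ∈ degSpace (φ h) k ↔ X ∈ degSpace h k := by
  rw [mem_degSpace, mem_degSpace, ← map_lieEquiv, ← map_smul]
  exact φ.injective.eq_iff

theorem map_mem_nonnegSpace (φ : 𝔤 ≃ₗ⁅ℝ⁆ 𝔤) {h X : 𝔤} :
    φ X ∈ nonnegSpace (φ h) ↔ X ∈ nonnegSpace h := by
  rw [mem_nonnegSpace, mem_nonnegSpace, ← map_lieEquiv, ← map_lieEquiv]
  exact φ.injective.eq_iff

theorem degSpace_zero_le_nonnegSpace (h : 𝔤) : degSpace h 0 ≤ nonnegSpace h := by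
  intro X hX
  rw [mem_degSpace_zero] at hX
  rw [mem_nonnegSpace, hX, lie_zero]

theorem degSpace_one_le_nonnegSpace (h : 𝔤) : degSpace h 1 ≤ nonnegSpace h := by
  intro X hX
  rw [mem_degSpace_one] at hX
  rw [mem_nonnegSpace, hX, hX]

/-- The projection to the part of degree `1`. -/
def projPos (h : 𝔤) : 𝔤 →ₗ[ℝ] 𝔤 :=
  (1 / 2 : ℝ) • (LieAlgebra.ad ℝ 𝔤 h ∘ₗ LieAlgebra.ad ℝ 𝔤 h + LieAlgebra.ad ℝ 𝔤 h)

/-- The projection to the part of degree `-1`. -/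
def projNeg (h : 𝔤) : 𝔤 →ₗ[ℝ] 𝔤 :=
  (1 / 2 : ℝ) • (LieAlgebra.ad ℝ 𝔤 h ∘ₗ LieAlgebra.ad ℝ 𝔤 h - LieAlgebra.ad ℝ 𝔤 h)

/-- The projection to the part of degree `0`. -/
def projZero (h : 𝔤) : 𝔤 →ₗ[ℝ] 𝔤 :=
  LinearMap.id - LieAlgebra.ad ℝ 𝔤 h ∘ₗ LieAlgebra.ad ℝ 𝔤 h

theorem projPos_apply (h X : 𝔤) : projPos h X = (1 / 2 : ℝ) • (⁅h, ⁅h, X⁆⁆ + ⁅h, X⁆) := rfl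

theorem projNeg_apply (h X : 𝔤) : projNeg h X = (1 / 2 : ℝ) • (⁅h, ⁅h, X⁆⁆ - ⁅h, X⁆) := rfl

theorem projZero_apply (h X : 𝔤) : projZero h X = X - ⁅h, ⁅h, X⁆⁆ := rfl

theorem proj_add (h X : 𝔤) : projPos h X + projZero h X + projNeg h X = X := by
  rw [projPos_apply, projNeg_apply, projZero_apply]
  module

theorem projPos_of_mem {h X : 𝔤} {k : ℝ} (hX : X ∈ degSpace h k) :
    projPos h X = ((k ^ 2 + k) / 2) • X := by
  rw [mem_degSpace] at hX
  rw [projPos_apply, hX, lie_smul, hX]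
  module

theorem projNeg_of_mem {h X : 𝔤} {k : ℝ} (hX : X ∈ degSpace h k) :
    projNeg h X = ((k ^ 2 - k) / 2) • X := by
  rw [mem_degSpace] at hX
  rw [projNeg_apply, hX, lie_smul, hX]
  module

theorem projZero_of_mem {h X : 𝔤} {k : ℝ} (hX : X ∈ degSpace h k) :
    projZero h X = (1 - k ^ 2) • X := by
  rw [mem_degSpace] at hX
  rw [projZero_apply, hX, lie_smul, hX]
  module

theorem projPos_eq_zero_of_mem_zero {h X : 𝔤} (hX : X ∈ degSpace h 0) : projPos h X = 0 := by
  rw [projPos_of_mem hX]; norm_num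

theorem projPos_eq_zero_of_mem_neg {h X : 𝔤} (hX : X ∈ degSpace h (-1)) : projPos h X = 0 := by
  rw [projPos_of_mem hX]; norm_num

theorem projPos_eq_self {h X : 𝔤} (hX : X ∈ degSpace h 1) : projPos h X = X := by
  rw [projPos_of_mem hX]; norm_num

theorem projNeg_eq_zero_of_mem_zero {h X : 𝔤} (hX : X ∈ degSpace h 0) : projNeg h X = 0 := by
  rw [projNeg_of_mem hX]; norm_num

theorem projNeg_eq_zero_of_mem_pos {h X : 𝔤} (hX : X ∈ degSpace h 1) : projNeg h X = 0 := by
  rw [projNeg_of_mem hX]; norm_num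

theorem projNeg_eq_self {h X : 𝔤} (hX : X ∈ degSpace h (-1)) : projNeg h X = X := by
  rw [projNeg_of_mem hX]; norm_num

theorem projZero_eq_self {h X : 𝔤} (hX : X ∈ degSpace h 0) : projZero h X = X := by
  rw [projZero_of_mem hX]; norm_num

theorem projZero_eq_zero_of_mem_pos {h X : 𝔤} (hX : X ∈ degSpace h 1) : projZero h X = 0 := by
  rw [projZero_of_mem hX]; norm_num

theorem projZero_eq_zero_of_mem_neg {h X : 𝔤} (hX : X ∈ degSpace h (-1)) : projZero h X = 0 := by
  rw [projZero_of_mem hX]; norm_num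

theorem eq_zero_of_mem_degSpace {h X : 𝔤} {j k : ℝ} (hjk : j ≠ k) (hX : X ∈ degSpace h j)
    (hX' : X ∈ degSpace h k) : X = 0 := by
  rw [mem_degSpace] at *
  rw [hX, ← sub_eq_zero, ← sub_smul] at hX'
  exact (smul_eq_zero.1 hX').resolve_left (sub_ne_zero.2 hjk)

theorem projNeg_eq_zero_of_mem_nonneg {h X : 𝔤} (hX : X ∈ nonnegSpace h) : projNeg h X = 0 := by
  rw [mem_nonnegSpace] at hX
  rw [projNeg_apply, hX, sub_self, smul_zero]

theorem mem_nonnegSpace_iff {h X : 𝔤} : X ∈ nonnegSpace h ↔ projNeg h X = 0 := by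
  refine ⟨projNeg_eq_zero_of_mem_nonneg, fun hX => ?_⟩
  rw [projNeg_apply, smul_eq_zero, sub_eq_zero] at hX
  exact hX.resolve_left (by norm_num)

theorem mem_nonnegSpace_neg_iff {h X : 𝔤} : X ∈ nonnegSpace (-h) ↔ projPos h X = 0 := by
  rw [mem_nonnegSpace, projPos_apply, smul_eq_zero, neg_lie, neg_lie, lie_neg, neg_neg,
    ← add_eq_zero_iff_eq_neg]
  simp

namespace IsThreeGrading

variable {h k : 𝔤} (hh : IsThreeGrading h)

include hh

theorem neg : IsThreeGrading (-h) := by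
  intro X
  rw [neg_lie, neg_lie, neg_lie, lie_neg, lie_neg, lie_neg, neg_neg, hh X]

theorem map (φ : 𝔤 ≃ₗ⁅ℝ⁆ 𝔤) : IsThreeGrading (φ h) := by
  intro X
  obtain ⟨Y, rfl⟩ := φ.surjective X
  change ⁅φ h, ⁅φ h, ⁅φ h, φ Y⁆⁆⁆ = ⁅φ h, φ Y⁆
  rw [← map_lieEquiv, ← map_lieEquiv, ← map_lieEquiv, hh Y]

theorem projPos_mem (X : 𝔤) : projPos h X ∈ degSpace h 1 := by
  rw [mem_degSpace_one, projPos_apply, lie_smul, lie_add, hh X, add_comm]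

theorem projNeg_mem (X : 𝔤) : projNeg h X ∈ degSpace h (-1) := by
  rw [mem_degSpace_neg_one, projNeg_apply, lie_smul, lie_sub, hh X, ← smul_neg, neg_sub]

theorem projZero_mem (X : 𝔤) : projZero h X ∈ degSpace h 0 := by
  rw [mem_degSpace_zero, projZero_apply, lie_sub, hh X, sub_self]

/-- An eigenvalue of `ad h` satisfies `j ^ 3 = j`; this is how brackets landing in degree `±2` or
beyond are seen to vanish. -/
theorem eq_zero_of_mem {X : 𝔤} {j : ℝ} (hj : j ^ 3 ≠ j) (hX : X ∈ degSpace h j) : X = 0 := by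
  have h1 := hh X
  rw [mem_degSpace] at hX
  rw [hX, lie_smul, lie_smul, hX, lie_smul, hX, ← sub_eq_zero, smul_smul, smul_smul, ← sub_smul] at h1
  refine (smul_eq_zero.1 h1).resolve_left (fun h2 => hj ?_)
  linear_combination h2

theorem lie_eq_zero_of_pos {X Y : 𝔤} (hX : X ∈ degSpace h 1) (hY : Y ∈ degSpace h 1) :
    ⁅X, Y⁆ = 0 :=
  hh.eq_zero_of_mem (by norm_num) (lie_mem_degSpace hX hY)

theorem lie_eq_zero_of_neg {X Y : 𝔤} (hX : X ∈ degSpace h (-1)) (hY : Y ∈ degSpace h (-1)) :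
    ⁅X, Y⁆ = 0 :=
  hh.eq_zero_of_mem (by norm_num) (lie_mem_degSpace hX hY)

/-- The elements of degree `1` act nilpotently. -/
theorem lie_lie_lie_of_pos {X : 𝔤} (hX : X ∈ degSpace h 1) (Y : 𝔤) : ⁅X, ⁅X, ⁅X, Y⁆⁆⁆ = 0 := by
  have h1 := lie_mem_degSpace hX (lie_mem_degSpace hX (lie_mem_degSpace hX (hh.projPos_mem Y)))
  have h2 := lie_mem_degSpace hX (lie_mem_degSpace hX (lie_mem_degSpace hX (hh.projZero_mem Y)))
  have h3 := lie_mem_degSpace hX (lie_mem_degSpace hX (lie_mem_degSpace hX (hh.projNeg_mem Y)))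
  rw [← proj_add h Y]
  simp only [lie_add]
  rw [hh.eq_zero_of_mem (by norm_num) h1, hh.eq_zero_of_mem (by norm_num) h2,
    hh.eq_zero_of_mem (by norm_num) h3]
  simp

theorem lie_lie_lie_of_neg {X : 𝔤} (hX : X ∈ degSpace h (-1)) (Y : 𝔤) :
    ⁅X, ⁅X, ⁅X, Y⁆⁆⁆ = 0 :=
  hh.neg.lie_lie_lie_of_pos (by rwa [degSpace_neg]) Y

theorem lie_mem_nonneg {X : 𝔤} (hX : X ∈ degSpace h 1) (Y : 𝔤) : ⁅X, Y⁆ ∈ nonnegSpace h := by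
  rw [← proj_add h Y, lie_add, lie_add, hh.lie_eq_zero_of_pos hX (hh.projPos_mem Y), zero_add]
  refine add_mem (degSpace_one_le_nonnegSpace h (lie_mem_degSpace_of_eq hX (hh.projZero_mem Y) ?_))
    (degSpace_zero_le_nonnegSpace h (lie_mem_degSpace_of_eq hX (hh.projNeg_mem Y) ?_)) <;> norm_num

theorem eq_of_mem_nonneg {X : 𝔤} (hX : X ∈ nonnegSpace h) : X = projPos h X + projZero h X := by
  conv_lhs => rw [← proj_add h X, projNeg_eq_zero_of_mem_nonneg hX, add_zero]

theorem lie_mem_pos_of_nonneg {X Y : 𝔤} (hX : X ∈ degSpace h 1) (hY : Y ∈ nonnegSpace h) :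
    ⁅X, Y⁆ ∈ degSpace h 1 := by
  rw [hh.eq_of_mem_nonneg hY, lie_add, hh.lie_eq_zero_of_pos hX (hh.projPos_mem Y), zero_add]
  exact lie_mem_degSpace_of_eq hX (hh.projZero_mem Y) (by norm_num)

theorem lie_mem_nonneg_of_nonneg {X Y : 𝔤} (hX : X ∈ nonnegSpace h) (hY : Y ∈ nonnegSpace h) :
    ⁅X, Y⁆ ∈ nonnegSpace h := by
  rw [hh.eq_of_mem_nonneg hX, add_lie]
  refine add_mem (hh.lie_mem_nonneg (hh.projPos_mem X) Y) ?_
  rw [hh.eq_of_mem_nonneg hY, lie_add]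
  exact add_mem (degSpace_one_le_nonnegSpace h
      (lie_mem_degSpace_of_eq (hh.projZero_mem X) (hh.projPos_mem Y) (by norm_num)))
    (degSpace_zero_le_nonnegSpace h
      (lie_mem_degSpace_of_eq (hh.projZero_mem X) (hh.projZero_mem Y) (by norm_num)))

theorem lie_mem_degSpace_one_of_nonneg {X : 𝔤} (hX : X ∈ nonnegSpace h) : ⁅h, X⁆ ∈ degSpace h 1 := by
  rw [mem_degSpace_one]
  exact hX

theorem lie_add_self_mem_nonneg (X : 𝔤) : ⁅h, X⁆ + X ∈ nonnegSpace h := by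
  rw [mem_nonnegSpace]
  simp only [lie_add, hh X]
  abel

section Killing

variable [LieAlgebra.IsKilling ℝ 𝔤] [FiniteDimensional ℝ 𝔤]

omit hh in
theorem eq_zero_of_killingForm {X : 𝔤} (hX : ∀ Y, killingForm ℝ 𝔤 X Y = 0) : X = 0 := by
  have h1 : X ∈ LieIdeal.killingCompl ℝ 𝔤 ⊤ := by
    rw [LieIdeal.mem_killingCompl]
    intro Y _
    rw [LieModule.traceForm_comm]
    exact hX Y
  rw [LieAlgebra.IsKilling.killingCompl_top_eq_bot] at h1
  exact h1

omit hh in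
theorem eq_zero_of_lie_eq_zero {X : 𝔤} (hX : ∀ Y : 𝔤, ⁅X, Y⁆ = 0) : X = 0 := by
  refine eq_zero_of_killingForm fun Y => ?_
  rw [killingForm_apply_apply]
  have : LieAlgebra.ad ℝ 𝔤 X = 0 := by
    ext Y
    exact hX Y
  rw [this, LinearMap.zero_comp, map_zero]

omit hh [LieAlgebra.IsKilling ℝ 𝔤] [FiniteDimensional ℝ 𝔤] in
theorem killingForm_eq_zero_of_degSpace {X Y : 𝔤} {i j : ℝ} (hij : i + j ≠ 0)
    (hX : X ∈ degSpace h i) (hY : Y ∈ degSpace h j) : killingForm ℝ 𝔤 X Y = 0 := by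
  have h1 : killingForm ℝ 𝔤 ⁅X, h⁆ Y = killingForm ℝ 𝔤 X ⁅h, Y⁆ :=
    LieModule.traceForm_apply_lie_apply ℝ 𝔤 𝔤 X h Y
  rw [mem_degSpace] at hX hY
  rw [← lie_skew, hX, hY, map_neg, map_smul, map_smul, LinearMap.neg_apply, LinearMap.smul_apply,
    smul_eq_mul, smul_eq_mul] at h1
  have : (i + j) * killingForm ℝ 𝔤 X Y = 0 := by linear_combination -h1
  exact (mul_eq_zero.1 this).resolve_left hij

/-- The nonnegative part is the orthogonal of the positive part. -/
theorem mem_nonnegSpace_iff_killingForm {Y : 𝔤} :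
    Y ∈ nonnegSpace h ↔ ∀ X ∈ degSpace h 1, killingForm ℝ 𝔤 X Y = 0 := by
  constructor
  · intro hY X hX
    rw [hh.eq_of_mem_nonneg hY, map_add,
      killingForm_eq_zero_of_degSpace (by norm_num) hX (hh.projPos_mem Y),
      killingForm_eq_zero_of_degSpace (by norm_num) hX (hh.projZero_mem Y), add_zero]
  · intro hY
    rw [mem_nonnegSpace_iff]
    refine eq_zero_of_killingForm fun Z => ?_
    have hN := hh.projNeg_mem Y
    have h1 := hY _ (hh.projPos_mem Z)
    rw [← proj_add h Y, map_add, map_add,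
      killingForm_eq_zero_of_degSpace (by norm_num) (hh.projPos_mem Z) (hh.projPos_mem Y),
      killingForm_eq_zero_of_degSpace (by norm_num) (hh.projPos_mem Z) (hh.projZero_mem Y),
      zero_add, zero_add] at h1
    rw [← proj_add h Z, map_add, map_add,
      killingForm_eq_zero_of_degSpace (by norm_num) hN (hh.projZero_mem Z),
      killingForm_eq_zero_of_degSpace (by norm_num) hN (hh.projNeg_mem Z), add_zero, add_zero,
      LieModule.traceForm_comm]
    exact h1

/-- An element that shifts the filtration `0 ⊂ 𝔤₁ ⊂ 𝔤₀ + 𝔤₁ ⊂ 𝔤` is of degree `1`. -/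
theorem mem_of_shift {N : 𝔤} (h1 : ∀ X ∈ degSpace h 1, ⁅N, X⁆ = 0)
    (h0 : ∀ X ∈ nonnegSpace h, ⁅N, X⁆ ∈ degSpace h 1) (hm : ∀ X, ⁅N, X⁆ ∈ nonnegSpace h) :
    N ∈ degSpace h 1 := by
  set a := projPos h N with ha
  set b := projZero h N with hb
  set c := projNeg h N with hc
  have hN : a + b + c = N := proj_add h N
  have ha' : a ∈ degSpace h 1 := hh.projPos_mem N
  have hb' : b ∈ degSpace h 0 := hh.projZero_mem N
  have hc' : c ∈ degSpace h (-1) := hh.projNeg_mem N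
  -- Test the shift on `h` itself: `⁅N, h⁆ = -a + c` has degree `1`, hence so does `c`, which also
  -- has degree `-1`.
  have hc0 : c = 0 := by
    have h2 := h0 h (by simp [mem_nonnegSpace])
    have h3 : ⁅N, h⁆ = -a + c := by
      rw [← lie_skew, ← hN, lie_add, lie_add, mem_degSpace_one.1 ha', mem_degSpace_zero.1 hb',
        mem_degSpace_neg_one.1 hc']
      abel
    have h4 : c ∈ degSpace h 1 := by
      have := add_mem h2 ha'
      rwa [h3, neg_add_eq_sub, sub_add_cancel] at this
    exact eq_zero_of_mem_degSpace (by norm_num) h4 hc'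
  rw [hc0, add_zero] at hN
  -- `b` preserves each degree while the conditions on `N = a + b`, in which `a` already shifts,
  -- require a shift. So `b` kills all three graded pieces and is central, and the centre is zero.
  have hb0 : b = 0 := by
    refine eq_zero_of_lie_eq_zero fun Y => ?_
    have e1 : ⁅b, projPos h Y⁆ = 0 := by
      have := h1 _ (hh.projPos_mem Y)
      rwa [← hN, add_lie, hh.lie_eq_zero_of_pos ha' (hh.projPos_mem Y), zero_add] at this
    have e2 : ⁅b, projZero h Y⁆ = 0 := by
      have h2 := h0 _ (degSpace_zero_le_nonnegSpace h (hh.projZero_mem Y))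
      have h3 : ⁅a, projZero h Y⁆ ∈ degSpace h 1 :=
        lie_mem_degSpace_of_eq ha' (hh.projZero_mem Y) (by norm_num)
      have h4 : ⁅b, projZero h Y⁆ ∈ degSpace h 0 :=
        lie_mem_degSpace_of_eq hb' (hh.projZero_mem Y) (by norm_num)
      have h5 := sub_mem h2 h3
      rw [← hN, add_lie, add_sub_cancel_left] at h5
      exact eq_zero_of_mem_degSpace (by norm_num) h4 h5
    have e3 : ⁅b, projNeg h Y⁆ = 0 := by
      have h2 := hm (projNeg h Y)
      have h3 : ⁅a, projNeg h Y⁆ ∈ nonnegSpace h := hh.lie_mem_nonneg ha' _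
      have h4 : ⁅b, projNeg h Y⁆ ∈ degSpace h (-1) :=
        lie_mem_degSpace_of_eq hb' (hh.projNeg_mem Y) (by norm_num)
      have h5 := sub_mem h2 h3
      rw [← hN, add_lie, add_sub_cancel_left, mem_nonnegSpace_iff, projNeg_eq_self h4] at h5
      exact h5
    rw [← proj_add h Y, lie_add, lie_add, e1, e2, e3]
    simp
  rw [← hN, hb0, add_zero]
  exact ha'

/-- Two gradings with the same positive part differ by an element of this positive part. -/
theorem sub_mem_of_degSpace_eq (hk : IsThreeGrading k) (e : degSpace k 1 = degSpace h 1) :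
    k - h ∈ degSpace h 1 := by
  have e0 : nonnegSpace k = nonnegSpace h := by
    ext X
    rw [hh.mem_nonnegSpace_iff_killingForm, hk.mem_nonnegSpace_iff_killingForm, e]
  refine hh.mem_of_shift (fun X hX => ?_) (fun X hX => ?_) (fun X => ?_)
  · have hX' := hX
    rw [← e] at hX'
    rw [sub_lie, mem_degSpace_one.1 hX, mem_degSpace_one.1 hX', sub_self]
  · rw [sub_lie]
    refine sub_mem ?_ (hh.lie_mem_degSpace_one_of_nonneg hX)
    rw [← e]
    rw [← e0] at hX
    exact hk.lie_mem_degSpace_one_of_nonneg hX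
  · have h1 := hh.lie_add_self_mem_nonneg X
    have h2 := hk.lie_add_self_mem_nonneg X
    rw [e0] at h2
    have := sub_mem h2 h1
    rwa [add_sub_add_right_eq_sub, ← sub_lie] at this

/-- Two transverse filtrations are defined by a common grading. -/
theorem exists_common_grading (hk : IsThreeGrading k)
    (c1 : IsCompl (degSpace k 1) (nonnegSpace h)) (c2 : IsCompl (nonnegSpace k) (degSpace h 1)) :
    ∃ E, E - k ∈ degSpace k 1 ∧ -E - h ∈ degSpace h 1 := by
  -- The two complementarity assumptions split `𝔤` into the positive part of `k`, the intersection
  -- of the two nonnegative parts, and the positive part of `h`.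
  have dec : ∀ X, ∃ a ∈ degSpace k 1, ∃ b ∈ nonnegSpace k ⊓ nonnegSpace h, ∃ c ∈ degSpace h 1,
      X = a + b + c := by
    intro X
    obtain ⟨u, hu, c, hc, rfl⟩ := Submodule.mem_sup.1 (c2.sup_eq_top ▸ Submodule.mem_top (x := X))
    obtain ⟨a, ha, b, hb, rfl⟩ := Submodule.mem_sup.1 (c1.sup_eq_top ▸ Submodule.mem_top (x := u))
    refine ⟨a, ha, b, ⟨?_, hb⟩, c, hc, rfl⟩
    have := sub_mem hu (degSpace_one_le_nonnegSpace k ha)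
    rwa [add_sub_cancel_left] at this
  -- `T` is `1`, `0`, `-1` on these three pieces. Brackets respect the pieces as degrees, so `T` is
  -- a derivation; as derivations are inner, `T = ad E`, and `E` is the common grading element.
  let T : 𝔤 →ₗ[ℝ] 𝔤 := (degSpace k 1).subtype ∘ₗ Submodule.projectionOnto _ _ c1 -
    (degSpace h 1).subtype ∘ₗ Submodule.projectionOnto _ _ c2.symm
  have T1 : ∀ X ∈ degSpace k 1, T X = X := by
    intro X hX
    have e1 := Submodule.projectionOnto_apply_left c1 ⟨X, hX⟩
    have e2 := (Submodule.projectionOnto_apply_eq_zero_iff c2.symm).2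
      (degSpace_one_le_nonnegSpace k hX)
    simp only at e1
    simp [T, e1, e2]
  have T2 : ∀ X ∈ degSpace h 1, T X = -X := by
    intro X hX
    have e1 := Submodule.projectionOnto_apply_left c2.symm ⟨X, hX⟩
    have e2 := (Submodule.projectionOnto_apply_eq_zero_iff c1).2
      (degSpace_one_le_nonnegSpace h hX)
    simp only at e1
    simp [T, e1, e2]
  have T0 : ∀ X ∈ nonnegSpace k ⊓ nonnegSpace h, T X = 0 := by
    intro X hX
    have e1 := (Submodule.projectionOnto_apply_eq_zero_iff c2.symm).2 hX.1
    have e2 := (Submodule.projectionOnto_apply_eq_zero_iff c1).2 hX.2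
    simp [T, e1, e2]
  have key1 : ∀ a ∈ degSpace k 1, ∀ Y, T ⁅a, Y⁆ = ⁅a, T Y⁆ - ⁅Y, T a⁆ := by
    intro a ha Y
    obtain ⟨x, hx, y, hy, z, hz, rfl⟩ := dec Y
    have e1 : ⁅a, y⁆ ∈ degSpace k 1 := hk.lie_mem_pos_of_nonneg ha hy.1
    have e2 : ⁅a, z⁆ ∈ nonnegSpace k ⊓ nonnegSpace h := by
      refine ⟨hk.lie_mem_nonneg ha z, ?_⟩
      rw [← lie_skew]
      exact neg_mem (hh.lie_mem_nonneg hz a)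
    have e3 := hk.lie_eq_zero_of_pos ha hx
    have e4 := hk.lie_eq_zero_of_pos hx ha
    simp only [lie_add, map_add, e3, map_zero, T1 _ e1, T0 _ e2, T1 _ ha, T1 _ hx, T0 _ hy,
      T2 _ hz, add_lie, lie_zero, lie_neg, e4]
    rw [← lie_skew y a, ← lie_skew z a]
    abel
  have key2 : ∀ a ∈ degSpace h 1, ∀ Y, T ⁅a, Y⁆ = ⁅a, T Y⁆ - ⁅Y, T a⁆ := by
    intro a ha Y
    obtain ⟨x, hx, y, hy, z, hz, rfl⟩ := dec Y
    have e1 : ⁅a, y⁆ ∈ degSpace h 1 := hh.lie_mem_pos_of_nonneg ha hy.2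
    have e2 : ⁅a, x⁆ ∈ nonnegSpace k ⊓ nonnegSpace h := by
      refine ⟨?_, hh.lie_mem_nonneg ha x⟩
      rw [← lie_skew]
      exact neg_mem (hk.lie_mem_nonneg hx a)
    have e3 := hh.lie_eq_zero_of_pos ha hz
    have e4 := hh.lie_eq_zero_of_pos hz ha
    simp only [lie_add, map_add, e3, map_zero, T2 _ e1, T0 _ e2, T2 _ ha, T1 _ hx, T0 _ hy,
      T2 _ hz, add_lie, lie_zero, lie_neg, e4]
    rw [← lie_skew y a, ← lie_skew x a]
    abel
  have key0 : ∀ a ∈ nonnegSpace k ⊓ nonnegSpace h, ∀ Y, T ⁅a, Y⁆ = ⁅a, T Y⁆ - ⁅Y, T a⁆ := by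
    intro a ha Y
    obtain ⟨x, hx, y, hy, z, hz, rfl⟩ := dec Y
    have e1 : ⁅a, x⁆ ∈ degSpace k 1 := by
      rw [← lie_skew]
      exact neg_mem (hk.lie_mem_pos_of_nonneg hx ha.1)
    have e2 : ⁅a, z⁆ ∈ degSpace h 1 := by
      rw [← lie_skew]
      exact neg_mem (hh.lie_mem_pos_of_nonneg hz ha.2)
    have e3 : ⁅a, y⁆ ∈ nonnegSpace k ⊓ nonnegSpace h :=
      ⟨hk.lie_mem_nonneg_of_nonneg ha.1 hy.1, hh.lie_mem_nonneg_of_nonneg ha.2 hy.2⟩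
    simp only [lie_add, map_add, T1 _ e1, T0 _ e3, T2 _ e2, T0 _ ha, T1 _ hx, T0 _ hy,
      T2 _ hz, lie_zero, lie_neg]
    abel
  let Dr : LieDerivation ℝ 𝔤 𝔤 := { T with
    leibniz' := by
      intro X Y
      change T ⁅X, Y⁆ = ⁅X, T Y⁆ - ⁅Y, T X⁆
      obtain ⟨x, hx, y, hy, z, hz, rfl⟩ := dec X
      simp only [add_lie, map_add, key1 x hx Y, key0 y hy Y, key2 z hz Y, lie_add]
      abel }
  obtain ⟨E, hE⟩ := LieDerivation.IsKilling.exists_eq_ad Dr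
  have hE' : ∀ X, ⁅E, X⁆ = T X := by
    intro X
    have := congrArg (fun d : LieDerivation ℝ 𝔤 𝔤 => d X) hE
    exact (LinearMap.congr_fun (LieDerivation.coe_ad_apply_eq_ad_apply (R := ℝ) E) X).symm.trans this
  refine ⟨E, hk.mem_of_shift (fun X hX => ?_) (fun X hX => ?_) (fun X => ?_),
    hh.mem_of_shift (fun X hX => ?_) (fun X hX => ?_) (fun X => ?_)⟩
  · rw [sub_lie, hE', T1 _ hX, mem_degSpace_one.1 hX, sub_self]
  · rw [sub_lie, hE']
    refine sub_mem ?_ (hk.lie_mem_degSpace_one_of_nonneg hX)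
    obtain ⟨x, hx, y, hy, z, hz, rfl⟩ := dec X
    have hz0 : z ∈ nonnegSpace k := by
      have := sub_mem (sub_mem hX (degSpace_one_le_nonnegSpace k hx)) hy.1
      rwa [add_assoc, add_sub_cancel_left, add_sub_cancel_left] at this
    rw [c2.disjoint.le_bot ⟨hz0, hz⟩]
    simp only [map_add, T1 _ hx, T0 _ hy, add_zero]
    exact hx
  · have h1 := hk.lie_add_self_mem_nonneg X
    have h2 : T X + X ∈ nonnegSpace k := by
      obtain ⟨x, hx, y, hy, z, hz, rfl⟩ := dec X
      have : T (x + y + z) + (x + y + z) = x + x + y := by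
        simp only [map_add, T1 _ hx, T0 _ hy, T2 _ hz]
        abel
      rw [this]
      exact add_mem (add_mem (degSpace_one_le_nonnegSpace k hx)
        (degSpace_one_le_nonnegSpace k hx)) hy.1
    have := sub_mem h2 h1
    rwa [add_sub_add_right_eq_sub, ← hE', ← sub_lie] at this
  · rw [sub_lie, neg_lie, hE', T2 _ hX, mem_degSpace_one.1 hX, neg_neg, sub_self]
  · rw [sub_lie, neg_lie, hE']
    refine sub_mem (neg_mem ?_) (hh.lie_mem_degSpace_one_of_nonneg hX)
    obtain ⟨x, hx, y, hy, z, hz, rfl⟩ := dec X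
    have hx0 : x ∈ nonnegSpace h := by
      have := sub_mem (sub_mem hX (degSpace_one_le_nonnegSpace h hz)) hy.2
      rwa [add_sub_cancel_right, add_sub_cancel_right] at this
    rw [c1.disjoint.le_bot ⟨hx, hx0⟩]
    simp only [map_add, T2 _ hz, T0 _ hy, zero_add]
    exact neg_mem hz
  · have h1 := hh.lie_add_self_mem_nonneg X
    have h2 : -T X + X ∈ nonnegSpace h := by
      obtain ⟨x, hx, y, hy, z, hz, rfl⟩ := dec X
      have : -T (x + y + z) + (x + y + z) = z + z + y := by
        simp only [map_add, T1 _ hx, T0 _ hy, T2 _ hz]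
        abel
      rw [this]
      exact add_mem (add_mem (degSpace_one_le_nonnegSpace h hz)
        (degSpace_one_le_nonnegSpace h hz)) hy.2
    have := sub_mem h2 h1
    rwa [add_sub_add_right_eq_sub, ← hE', ← neg_lie, ← sub_lie] at this

end Killing

end IsThreeGrading

end ThreeGrading

/-! ### Commuting exponentials of opposite degrees, and consequences of simplicity -/

section ThreeGrading

variable {𝔤 : Type*} [LieRing 𝔤] [LieAlgebra ℝ 𝔤]

/-- The action of the exponential of `X`, when `(ad X)³ = 0`. -/
def expAct (X W : 𝔤) : 𝔤 := W + ⁅X, W⁆ + (1 / 2 : ℝ) • ⁅X, ⁅X, W⁆⁆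

namespace IsThreeGrading

variable {h : 𝔤} (hh : IsThreeGrading h)

include hh

/-- Since `Y` and `U` commute, `⁅Y, ⁅v, U⁆⁆ = ⁅U, ⁅v, Y⁆⁆`. Expanding `⁅v, ·⁆` of both sides by the
Leibniz rule and adding cancels the term `⁅⁅v, Y⁆, ⁅v, U⁆⁆`. -/
theorem lie_lie_comm_of_rank_one {v Y U : 𝔤} {μ ν : ℝ} (hY : Y ∈ degSpace h 1)
    (hU : U ∈ degSpace h 1) (hμ : ⁅v, ⁅v, Y⁆⁆ = (-2 * μ) • v) (hν : ⁅v, ⁅v, U⁆⁆ = (-2 * ν) • v) :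
    ⁅v, ⁅Y, ⁅v, U⁆⁆⁆ = μ • ⁅v, U⁆ + ν • ⁅v, Y⁆ := by
  have e0 : ⁅U, Y⁆ = 0 := hh.lie_eq_zero_of_pos hU hY
  have e1 : ⁅Y, ⁅v, U⁆⁆ = ⁅U, ⁅v, Y⁆⁆ := by
    have h1 := leibniz_lie v U Y
    have h2 := leibniz_lie v Y U
    rw [e0, lie_zero] at h1
    rw [← lie_skew Y ⁅v, U⁆, eq_comm, ← sub_eq_zero]
    rw [h1, ← lie_skew, ← sub_eq_zero]
    abel
  have e2 : ⁅v, ⁅Y, ⁅v, U⁆⁆⁆ = ⁅⁅v, Y⁆, ⁅v, U⁆⁆ + (2 * ν) • ⁅v, Y⁆ := by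
    rw [leibniz_lie v Y, hν, lie_smul, ← lie_skew v Y]
    module
  have e3 : ⁅v, ⁅U, ⁅v, Y⁆⁆⁆ = ⁅⁅v, U⁆, ⁅v, Y⁆⁆ + (2 * μ) • ⁅v, U⁆ := by
    rw [leibniz_lie v U, hμ, lie_smul, ← lie_skew v U]
    module
  have e4 : (2 : ℝ) • ⁅v, ⁅Y, ⁅v, U⁆⁆⁆ = (2 : ℝ) • (μ • ⁅v, U⁆ + ν • ⁅v, Y⁆) := by
    rw [← lie_skew ⁅v, U⁆, neg_add_eq_sub] at e3
    rw [e1] at e2 ⊢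
    rw [two_smul]
    nth_rewrite 1 [e2]
    rw [e3]
    module
  exact smul_right_injective _ (by norm_num : (2 : ℝ) ≠ 0) e4

/-- The commutation relation between the exponentials of `Y` in degree `1` and of a multiple of a
vector `v` of rank one in degree `-1`. -/
theorem exists_expAct_expAct {v Y U : 𝔤} {μ ν s s' : ℝ} (hv : v ∈ degSpace h (-1))
    (hY : Y ∈ degSpace h 1) (hU : U ∈ degSpace h 1) (hμ : ⁅v, ⁅v, Y⁆⁆ = (-2 * μ) • v)
    (hν : ⁅v, ⁅v, U⁆⁆ = (-2 * ν) • v) (hs : s' * (1 + s * μ) = s) :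
    ∃ U' ∈ degSpace h 1, expAct (-Y) (expAct (s' • v) U) = expAct (s • v) U' := by
  have r1 := hh.lie_lie_comm_of_rank_one hY hU hμ hν
  have r2 := hh.lie_lie_comm_of_rank_one hY hY hμ hμ
  have r0 : ⁅Y, U⁆ = 0 := hh.lie_eq_zero_of_pos hY hU
  have da : ⁅v, U⁆ ∈ degSpace h 0 := lie_mem_degSpace_of_eq hv hU (by norm_num)
  have dD : ⁅v, Y⁆ ∈ degSpace h 0 := lie_mem_degSpace_of_eq hv hY (by norm_num)
  have dYa : ⁅Y, ⁅v, U⁆⁆ ∈ degSpace h 1 := lie_mem_degSpace_of_eq hY da (by norm_num)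
  have dYD : ⁅Y, ⁅v, Y⁆⁆ ∈ degSpace h 1 := lie_mem_degSpace_of_eq hY dD (by norm_num)
  have r3 : ⁅Y, ⁅Y, ⁅v, U⁆⁆⁆ = 0 := hh.lie_eq_zero_of_pos hY dYa
  have r4 : ⁅Y, v⁆ = -⁅v, Y⁆ := (lie_skew Y v).symm
  -- `U'` is forced: it is the degree `1` part of the left-hand side, because the right-hand side
  -- has degree `1` part `U'`. The equalities in degrees `0` and `-1` then reduce to `s' (1 + s μ) =
  -- s`.
  refine ⟨U - s' • ⁅Y, ⁅v, U⁆⁆ + (s' ^ 2 * ν / 2) • ⁅Y, ⁅v, Y⁆⁆,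
    add_mem (sub_mem hU (Submodule.smul_mem _ _ dYa)) (Submodule.smul_mem _ _ dYD), ?_⟩
  set a := ⁅v, U⁆ with ha
  set b := ⁅v, Y⁆ with hb
  simp only [expAct, lie_add, lie_sub, smul_lie, lie_smul, neg_lie, lie_neg, r0, r1, r2, r3, r4,
    hμ, hν, smul_zero, lie_zero, ← ha, smul_add, smul_sub, smul_neg, neg_neg, neg_zero]
  have hs1 : s' = s * (1 - s' * μ) := by linear_combination hs
  have hs2 : s' ^ 2 = s ^ 2 * (1 - s' * μ) ^ 2 := by rw [← mul_pow, ← hs1]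
  match_scalars
  · ring
  · linear_combination hs
  · linear_combination (-ν) * hs2
  · ring
  · linear_combination (-s' * ν) * hs
  · ring

/-- A nonzero subspace of degree `-1` stable under degree `0` is everything, in a simple Lie
algebra. -/
theorem eq_degSpace_neg_one [LieAlgebra.IsSimple ℝ 𝔤] {W : Submodule ℝ 𝔤}
    (hW : W ≤ degSpace h (-1)) (hW0 : W ≠ ⊥)
    (hst : ∀ z ∈ degSpace h 0, ∀ w ∈ W, ⁅z, w⁆ ∈ W) : W = degSpace h (-1) := by
  have hst' : ∀ z ∈ degSpace h 0, ∀ w ∈ W, ⁅w, z⁆ ∈ W := fun z hz w hw => by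
    rw [← lie_skew]
    exact neg_mem (hst z hz w hw)
  have hone : ∀ z ∈ degSpace h 1, ∀ w ∈ W, ∀ y ∈ degSpace h (-1), ⁅⁅z, w⁆, y⁆ ∈ W := by
    intro z hz w hw y hy
    rw [lie_lie, hh.lie_eq_zero_of_neg (hW hw) hy, lie_zero, zero_sub]
    exact neg_mem (hst' _ (lie_mem_degSpace_of_eq hz hy (by norm_num)) _ hw)
  -- The elements whose graded pieces are sent into `W` when lowered to degree `-1` by brackets with
  -- elements of degree `-1`. This is an ideal containing `W`, and its elements of degree `-1` are
  -- those of `W`.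
  let I : LieIdeal ℝ 𝔤 :=
    { carrier := {X | projNeg h X ∈ W ∧ (∀ y ∈ degSpace h (-1), ⁅projZero h X, y⁆ ∈ W) ∧
        ∀ y ∈ degSpace h (-1), ∀ y' ∈ degSpace h (-1), ⁅⁅projPos h X, y⁆, y'⁆ ∈ W}
      add_mem' := by
        rintro X Y ⟨h1, h2, h3⟩ ⟨k1, k2, k3⟩
        refine ⟨?_, fun y hy => ?_, fun y hy y' hy' => ?_⟩
        · rw [map_add]
          exact add_mem h1 k1
        · rw [map_add, add_lie]
          exact add_mem (h2 y hy) (k2 y hy)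
        · rw [map_add, add_lie, add_lie]
          exact add_mem (h3 y hy y' hy') (k3 y hy y' hy')
      zero_mem' := by simp
      smul_mem' := by
        rintro c X ⟨h1, h2, h3⟩
        refine ⟨?_, fun y hy => ?_, fun y hy y' hy' => ?_⟩
        · rw [map_smul]
          exact W.smul_mem _ h1
        · rw [map_smul, smul_lie]
          exact W.smul_mem _ (h2 y hy)
        · rw [map_smul, smul_lie, smul_lie]
          exact W.smul_mem _ (h3 y hy y' hy')
      lie_mem := by
        rintro Z X ⟨h1, h2, h3⟩
        have pX := hh.projPos_mem X
        have zX := hh.projZero_mem X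
        have nX := hh.projNeg_mem X
        have pZ := hh.projPos_mem Z
        have zZ := hh.projZero_mem Z
        have nZ := hh.projNeg_mem Z
        have hX := proj_add h X
        have hZ := proj_add h Z
        set x1 := projPos h X
        set x0 := projZero h X
        set xm := projNeg h X
        set z1 := projPos h Z
        set z0 := projZero h Z
        set zm := projNeg h Z
        have d10 : ⁅z1, x0⁆ ∈ degSpace h 1 := lie_mem_degSpace_of_eq pZ zX (by norm_num)
        have d1m : ⁅z1, xm⁆ ∈ degSpace h 0 := lie_mem_degSpace_of_eq pZ nX (by norm_num)
        have d01 : ⁅z0, x1⁆ ∈ degSpace h 1 := lie_mem_degSpace_of_eq zZ pX (by norm_num)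
        have d00 : ⁅z0, x0⁆ ∈ degSpace h 0 := lie_mem_degSpace_of_eq zZ zX (by norm_num)
        have d0m : ⁅z0, xm⁆ ∈ degSpace h (-1) := lie_mem_degSpace_of_eq zZ nX (by norm_num)
        have dm1 : ⁅zm, x1⁆ ∈ degSpace h 0 := lie_mem_degSpace_of_eq nZ pX (by norm_num)
        have dm0 : ⁅zm, x0⁆ ∈ degSpace h (-1) := lie_mem_degSpace_of_eq nZ zX (by norm_num)
        have e : ⁅Z, X⁆ = (⁅z1, x0⁆ + ⁅z0, x1⁆) + (⁅z1, xm⁆ + ⁅z0, x0⁆ + ⁅zm, x1⁆) +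
            (⁅z0, xm⁆ + ⁅zm, x0⁆) := by
          rw [← hX, ← hZ]
          simp only [add_lie, lie_add, hh.lie_eq_zero_of_pos pZ pX, hh.lie_eq_zero_of_neg nZ nX]
          abel
        have eN : projNeg h ⁅Z, X⁆ = ⁅z0, xm⁆ + ⁅zm, x0⁆ := by
          rw [e]
          simp only [map_add, projNeg_eq_zero_of_mem_pos d10, projNeg_eq_zero_of_mem_pos d01,
            projNeg_eq_zero_of_mem_zero d1m, projNeg_eq_zero_of_mem_zero d00,
            projNeg_eq_zero_of_mem_zero dm1, projNeg_eq_self d0m, projNeg_eq_self dm0, add_zero,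
            zero_add]
        have e0 : projZero h ⁅Z, X⁆ = ⁅z1, xm⁆ + ⁅z0, x0⁆ + ⁅zm, x1⁆ := by
          rw [e]
          simp only [map_add, projZero_eq_zero_of_mem_pos d10, projZero_eq_zero_of_mem_pos d01,
            projZero_eq_self d1m, projZero_eq_self d00,
            projZero_eq_self dm1, projZero_eq_zero_of_mem_neg d0m, projZero_eq_zero_of_mem_neg dm0,
            add_zero, zero_add]
        have e1 : projPos h ⁅Z, X⁆ = ⁅z1, x0⁆ + ⁅z0, x1⁆ := by
          rw [e]
          simp only [map_add, projPos_eq_self d10, projPos_eq_self d01,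
            projPos_eq_zero_of_mem_zero d1m, projPos_eq_zero_of_mem_zero d00,
            projPos_eq_zero_of_mem_zero dm1, projPos_eq_zero_of_mem_neg d0m,
            projPos_eq_zero_of_mem_neg dm0, add_zero]
        have d0y : ∀ z ∈ degSpace h 0, ∀ y ∈ degSpace h (-1), ⁅z, y⁆ ∈ degSpace h (-1) :=
          fun z hz y hy => lie_mem_degSpace_of_eq hz hy (by norm_num)
        have d1y : ∀ z ∈ degSpace h 1, ∀ y ∈ degSpace h (-1), ⁅z, y⁆ ∈ degSpace h 0 :=
          fun z hz y hy => lie_mem_degSpace_of_eq hz hy (by norm_num)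
        refine ⟨?_, fun y hy => ?_, fun y hy y' hy' => ?_⟩
        · rw [eN]
          refine add_mem (hst _ zZ _ h1) ?_
          rw [← lie_skew]
          exact neg_mem (h2 _ nZ)
        · rw [e0, add_lie, add_lie]
          refine add_mem (add_mem (hone _ pZ _ h1 _ hy) ?_) ?_
          · rw [lie_lie]
            exact sub_mem (hst _ zZ _ (h2 y hy)) (h2 _ (d0y _ zZ _ hy))
          · rw [← lie_skew zm, neg_lie]
            exact neg_mem (h3 _ nZ _ hy)
        · rw [e1, add_lie, add_lie]
          refine add_mem ?_ ?_
          · rw [lie_lie z1, sub_lie, lie_lie x0]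
            exact sub_mem (hone _ pZ _ (h2 y hy) _ hy')
              (sub_mem (h2 _ (d0y _ (d1y _ pZ _ hy) _ hy')) (hst _ (d1y _ pZ _ hy) _ (h2 _ hy')))
          · rw [lie_lie z0, sub_lie, lie_lie z0]
            exact sub_mem (sub_mem (hst _ zZ _ (h3 _ hy _ hy')) (h3 _ hy _ (d0y _ zZ _ hy')))
              (h3 _ (d0y _ zZ _ hy) _ hy') }
  have hWI : ∀ w ∈ W, w ∈ I := by
    intro w hw
    have hw' := hW hw
    refine ⟨?_, fun y _ => ?_, fun y _ y' _ => ?_⟩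
    · rw [projNeg_eq_self hw']
      exact hw
    · rw [projZero_eq_zero_of_mem_neg hw', zero_lie]
      exact W.zero_mem
    · rw [projPos_eq_zero_of_mem_neg hw', zero_lie, zero_lie]
      exact W.zero_mem
  rcases LieAlgebra.IsSimple.eq_bot_or_eq_top (R := ℝ) I with hI | hI
  · refine absurd ?_ hW0
    rw [eq_bot_iff]
    intro w hw
    have := hWI w hw
    rw [hI] at this
    exact this
  · refine le_antisymm hW fun X hX => ?_
    have : X ∈ I := by
      rw [hI]
      trivial
    have h1 := this.1
    rwa [projNeg_eq_self hX] at h1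

end IsThreeGrading

end ThreeGrading

/-! ### Restricted root decomposition and the grading element -/

namespace HTTData

section RootSpaces

variable {𝔤 : Type*} [LieRing 𝔤] [LieAlgebra ℝ 𝔤] (D : HTTData 𝔤)

theorem isKilling (D : HTTData 𝔤) : LieAlgebra.IsKilling ℝ 𝔤 where
  killingCompl_top_eq_bot := by
    rw [eq_bot_iff]
    intro X hX
    by_contra h0
    have h1 := D.cartan.pos X h0
    rw [LieIdeal.mem_killingCompl] at hX
    rw [LieModule.traceForm_comm] at h1
    have h2 := hX (D.σ X) trivial
    rw [h2] at h1
    simp at h1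

theorem σ_σ (X : 𝔤) : D.σ (D.σ X) = X := D.cartan.involutive X

theorem σ_lie (X Y : 𝔤) : D.σ ⁅X, Y⁆ = ⁅D.σ X, D.σ Y⁆ := map_lieEquiv D.σ X Y

theorem killingForm_σ (X Y : 𝔤) : killingForm ℝ 𝔤 (D.σ X) Y = killingForm ℝ 𝔤 X (D.σ Y) := by
  conv_lhs => rw [← D.σ_σ Y]
  exact LieAlgebra.killingForm_of_equiv_apply D.σ X (D.σ Y)

theorem killingForm_lie (X Y Z : 𝔤) : killingForm ℝ 𝔤 ⁅X, Y⁆ Z = killingForm ℝ 𝔤 X ⁅Y, Z⁆ :=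
  LieModule.traceForm_apply_lie_apply ℝ 𝔤 𝔤 X Y Z

theorem killingForm_self_pos {H : 𝔤} (hH : D.σ H = -H) (h0 : H ≠ 0) : 0 < killingForm ℝ 𝔤 H H := by
  have := D.cartan.pos H h0
  rwa [hH, map_neg, neg_neg] at this

/-- The scalar product `-B(X, σ Y)`. -/
@[reducible] def innerCore : InnerProductSpace.Core ℝ 𝔤 where
  inner X Y := -killingForm ℝ 𝔤 X (D.σ Y)
  conj_inner_symm X Y := by
    change -killingForm ℝ 𝔤 Y (D.σ X) = -killingForm ℝ 𝔤 X (D.σ Y)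
    rw [← D.killingForm_σ, LieModule.traceForm_comm]
  re_inner_nonneg X := by
    change 0 ≤ -killingForm ℝ 𝔤 X (D.σ X)
    rcases eq_or_ne X 0 with rfl | h
    · simp
    · exact (D.cartan.pos X h).le
  add_left X Y Z := by
    simp only [map_add, LinearMap.add_apply]
    ring
  smul_left X Y c := by
    simp
  definite X hX := by
    by_contra h
    exact (D.cartan.pos X h).ne' hX

/-- For the scalar product `-B(X, σ Y)` the operators `ad H`, `H ∈ 𝔞`, are symmetric, and they
commute, so they are simultaneously diagonalizable. -/
theorem iSup_restrictedRootSpace [FiniteDimensional ℝ 𝔤] :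
    ⨆ α : Module.Dual ℝ D.𝔞, restrictedRootSpace D.𝔞 α = ⊤ := by
  have hC : Pairwise (Function.onFun Commute fun H : D.𝔞 => LieAlgebra.ad ℝ 𝔤 (H : 𝔤)) := by
    intro H H' _
    refine LinearMap.ext fun Y => ?_
    change ⁅(H : 𝔤), ⁅(H' : 𝔤), Y⁆⁆ = ⁅(H' : 𝔤), ⁅(H : 𝔤), Y⁆⁆
    rw [leibniz_lie, D.maximalAbelian.abelian _ H.2 _ H'.2, zero_lie, zero_add]
  let _ : NormedAddCommGroup 𝔤 := D.innerCore.toNormedAddCommGroup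
  let _ : InnerProductSpace ℝ 𝔤 := InnerProductSpace.ofCore D.innerCore.toCore
  have hT : ∀ H : D.𝔞, (LieAlgebra.ad ℝ 𝔤 (H : 𝔤)).IsSymmetric := by
    intro H X Y
    change -killingForm ℝ 𝔤 ⁅(H : 𝔤), X⁆ (D.σ Y) = -killingForm ℝ 𝔤 X (D.σ ⁅(H : 𝔤), Y⁆)
    rw [← lie_skew, map_neg, LinearMap.neg_apply, killingForm_lie, D.σ_lie,
      D.maximalAbelian.sub_p _ H.2, neg_lie, map_neg]
  have key := LinearMap.IsSymmetric.iSup_iInf_eq_top_of_commute hT hC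
  rw [eq_top_iff, ← key, iSup_le_iff]
  intro χ X hX
  rw [Submodule.mem_iInf] at hX
  have hX' : ∀ H : D.𝔞, ⁅(H : 𝔤), X⁆ = χ H • X := fun H =>
    Module.End.mem_eigenspace_iff.1 (hX H)
  rcases eq_or_ne X 0 with rfl | h0
  · exact Submodule.zero_mem _
  -- A joint eigenvalue is a priori only a function on `𝔞`; a nonzero eigenvector makes it linear.
  · let α : Module.Dual ℝ D.𝔞 :=
      { toFun := χ
        map_add' := by
          intro H H'
          refine smul_left_injective ℝ h0 ?_
          simp only
          rw [add_smul, ← hX', ← hX', ← hX', Submodule.coe_add, add_lie]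
        map_smul' := by
          intro c H
          refine smul_left_injective ℝ h0 ?_
          simp only
          rw [← hX', smul_eq_mul, RingHom.id_apply, mul_smul, ← hX', Submodule.coe_smul, smul_lie] }
    exact Submodule.mem_iSup_of_mem α hX'

/-- It suffices to check linear conditions on root spaces. -/
theorem forall_mem_of_rootSpaces [FiniteDimensional ℝ 𝔤] {V : Submodule ℝ 𝔤} {T : 𝔤 →ₗ[ℝ] 𝔤}
    (hV : ∀ α, ∀ X ∈ restrictedRootSpace D.𝔞 α, X ≠ 0 → T X ∈ V) (X : 𝔤) : T X ∈ V := by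
  have h1 : (⊤ : Submodule ℝ 𝔤) ≤ V.comap T := by
    rw [← D.iSup_restrictedRootSpace, iSup_le_iff]
    intro α Y hY
    rcases eq_or_ne Y 0 with rfl | h0
    · exact Submodule.zero_mem _
    · exact hV α Y hY h0
  exact h1 trivial

theorem lie_mem_rootSpace {X Y : 𝔤} {α γ : Module.Dual ℝ D.𝔞} (hX : X ∈ restrictedRootSpace D.𝔞 α)
    (hY : Y ∈ restrictedRootSpace D.𝔞 γ) : ⁅X, Y⁆ ∈ restrictedRootSpace D.𝔞 (α + γ) := by
  intro H
  rw [leibniz_lie, hX H, hY H, smul_lie, lie_smul, LinearMap.add_apply, add_smul]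

theorem σ_mem_rootSpace {X : 𝔤} {α : Module.Dual ℝ D.𝔞} (hX : X ∈ restrictedRootSpace D.𝔞 α) :
    D.σ X ∈ restrictedRootSpace D.𝔞 (-α) := by
  intro H
  have h1 : (H : 𝔤) = D.σ (-(H : 𝔤)) := by
    rw [map_neg, D.maximalAbelian.sub_p _ H.2, neg_neg]
  rw [h1, ← D.σ_lie, neg_lie, hX H, map_neg, map_smul, LinearMap.neg_apply, neg_smul]

theorem mem_𝔞_of_rootSpace_zero {X : 𝔤} (hX : X ∈ restrictedRootSpace D.𝔞 0) (hσ : D.σ X = -X) :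
    X ∈ D.𝔞 :=
  D.maximalAbelian.maximal X hσ fun H hH => by
    have := hX ⟨H, hH⟩
    simpa using this

/-- The last coordinate of a linear form. -/
def lastCoord : Module.Dual ℝ D.𝔞 →ₗ[ℝ] ℝ := D.ε.coord (Fin.last D.rk)

/-- The long root `2ε_r`. -/
def longRoot : Module.Dual ℝ D.𝔞 := (2 : ℝ) • D.ε (Fin.last D.rk)

theorem lastCoord_ε (i : Fin (D.rk + 1)) :
    D.lastCoord (D.ε i) = if i = Fin.last D.rk then 1 else 0 := by
  rw [lastCoord, Module.Basis.coord_apply, Module.Basis.repr_self, Finsupp.single_apply]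

theorem lastCoord_longRoot : D.lastCoord D.longRoot = 2 := by
  rw [longRoot, map_smul, lastCoord_ε]
  simp

theorem longRoot_ne_zero : D.longRoot ≠ 0 := by
  intro h
  have := D.lastCoord_longRoot
  rw [h, map_zero] at this
  norm_num at this

theorem root_cases {X : 𝔤} {α : Module.Dual ℝ D.𝔞} (hX : X ∈ restrictedRootSpace D.𝔞 α)
    (h0 : X ≠ 0) : α = 0 ∨ ∃ i j, α = D.ε i + D.ε j ∨ α = D.ε i - D.ε j ∨ α = -D.ε i - D.ε j := by
  by_cases hα : α = 0
  · exact Or.inl hα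
  · have : α ∈ restrictedRoots D.𝔞 :=
      ⟨hα, fun hb => h0 ((Submodule.eq_bot_iff _).1 hb X hX)⟩
    rw [D.roots_eq] at this
    exact Or.inr this.2

/-- The coordinate along `ε_r` lies between `-2` and `2` on type `C_r` and takes the values `±2`
only at `±2ε_r`. Most vanishing statements about brackets with the long root spaces come from this.
-/
theorem lastCoord_cases {X : 𝔤} {α : Module.Dual ℝ D.𝔞} (hX : X ∈ restrictedRootSpace D.𝔞 α)
    (h0 : X ≠ 0) : α = D.longRoot ∨ α = -D.longRoot ∨ D.lastCoord α = 0 ∨ D.lastCoord α = 1 ∨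
      D.lastCoord α = -1 := by
  rcases D.root_cases hX h0 with h | ⟨i, j, h | h | h⟩
  · simp [h]
  · by_cases hi : i = Fin.last D.rk <;> by_cases hj : j = Fin.last D.rk
    · left
      rw [h, hi, hj, longRoot, two_smul]
    all_goals simp [h, lastCoord_ε, hi, hj]
  · by_cases hi : i = Fin.last D.rk <;> by_cases hj : j = Fin.last D.rk
    all_goals simp [h, lastCoord_ε, hi, hj]
  · by_cases hi : i = Fin.last D.rk <;> by_cases hj : j = Fin.last D.rk
    · right; left
      rw [h, hi, hj, longRoot, two_smul]
      abel
    all_goals simp [h, lastCoord_ε, hi, hj]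

theorem eq_zero_of_lastCoord {X : 𝔤} {α : Module.Dual ℝ D.𝔞} (hX : X ∈ restrictedRootSpace D.𝔞 α)
    (h : 2 < |D.lastCoord α|) : X = 0 := by
  by_contra h0
  rcases D.lastCoord_cases hX h0 with e | e | e | e | e <;> rw [e] at h
  · rw [D.lastCoord_longRoot] at h
    norm_num at h
  · rw [map_neg, D.lastCoord_longRoot] at h
    norm_num at h
  all_goals norm_num at h

theorem eq_zero_of_lastCoord_eq_two {X : 𝔤} {α : Module.Dual ℝ D.𝔞}
    (hX : X ∈ restrictedRootSpace D.𝔞 α) (h : D.lastCoord α = 2) (hα : α ≠ D.longRoot) : X = 0 := by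
  by_contra h0
  rcases D.lastCoord_cases hX h0 with e | e | e | e | e
  · exact hα e
  · rw [e, map_neg, D.lastCoord_longRoot] at h
    norm_num at h
  all_goals
    rw [e] at h
    norm_num at h

theorem eq_zero_of_lastCoord_eq_neg_two {X : 𝔤} {α : Module.Dual ℝ D.𝔞}
    (hX : X ∈ restrictedRootSpace D.𝔞 α) (h : D.lastCoord α = -2) (hα : α ≠ -D.longRoot) :
    X = 0 := by
  have h1 := D.eq_zero_of_lastCoord_eq_two (D.σ_mem_rootSpace hX)
    (by rw [map_neg, h, neg_neg]) (fun e => hα (by rw [← e, neg_neg]))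
  rw [← D.σ_σ X, h1, map_zero]

/-- The grading element: `ε_i(h₀) = 1/2` for all `i`. -/
theorem exists_gradingElt [FiniteDimensional ℝ 𝔤] : ∃ H : D.𝔞, ∀ i, D.ε i H = 1 / 2 := by
  obtain ⟨H, hH⟩ := (Module.evalEquiv ℝ D.𝔞).surjective (D.ε.constr ℝ fun _ => (1 / 2 : ℝ))
  refine ⟨H, fun i => ?_⟩
  have := LinearMap.congr_fun hH (D.ε i)
  rwa [Module.Basis.constr_basis] at this

variable [FiniteDimensional ℝ 𝔤]

/-- The grading element, as an element of `𝔞`. -/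
def gradingElt' : D.𝔞 := D.exists_gradingElt.choose

/-- The grading element of `𝔤`. -/
def gradingElt : 𝔤 := D.gradingElt'

theorem ε_gradingElt' (i : Fin (D.rk + 1)) : D.ε i D.gradingElt' = 1 / 2 :=
  D.exists_gradingElt.choose_spec i

theorem σ_gradingElt : D.σ D.gradingElt = -D.gradingElt :=
  D.maximalAbelian.sub_p _ D.gradingElt'.2

theorem rootSpace_le_degSpace (α : Module.Dual ℝ D.𝔞) :
    restrictedRootSpace D.𝔞 α ≤ degSpace D.gradingElt (α D.gradingElt') :=
  fun _ hX => hX D.gradingElt'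

/-- With `ε_i(h₀) = 1/2`, every root `±ε_i ± ε_j` takes a value in `{-1, 0, 1}`. -/
theorem isThreeGrading : IsThreeGrading D.gradingElt := by
  intro X
  have h1 := D.forall_mem_of_rootSpaces (V := ⊥)
    (T := LieAlgebra.ad ℝ 𝔤 D.gradingElt ∘ₗ LieAlgebra.ad ℝ 𝔤 D.gradingElt ∘ₗ
      LieAlgebra.ad ℝ 𝔤 D.gradingElt - LieAlgebra.ad ℝ 𝔤 D.gradingElt) ?_ X
  · rw [Submodule.mem_bot] at h1
    exact sub_eq_zero.1 h1
  · intro α Y hY h0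
    have h1 := D.rootSpace_le_degSpace α hY
    rw [mem_degSpace] at h1
    rw [Submodule.mem_bot, LinearMap.sub_apply, LinearMap.comp_apply, LinearMap.comp_apply,
      LieAlgebra.ad_apply, LieAlgebra.ad_apply, LieAlgebra.ad_apply, h1, lie_smul, h1, lie_smul,
      lie_smul, h1]
    rcases D.root_cases hY h0 with h | ⟨i, j, h | h | h⟩ <;>
      simp only [h, LinearMap.add_apply, LinearMap.sub_apply, LinearMap.neg_apply,
        LinearMap.zero_apply, D.ε_gradingElt'] <;> module

theorem simpleRoot_gradingElt' (i : Fin (D.rk + 1)) :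
    D.simpleRoot i D.gradingElt' = if i = Fin.last D.rk then 1 else 0 := by
  unfold simpleRoot
  split_ifs with h1 h2 h2
  · rw [h2] at h1
    simp at h1
  · rw [LinearMap.sub_apply, D.ε_gradingElt', D.ε_gradingElt', sub_self]
  · rw [LinearMap.smul_apply, D.ε_gradingElt']
    norm_num
  · exact absurd (Fin.ext (by rw [Fin.val_last]; have := i.2; omega)) h2

/-- Among the simple roots only `α_r` is nonzero at `h₀`, with value `1`, so the value of a positive
root at `h₀` is its coefficient along `α_r`. Being outside the span of the others makes it at least
`1`, and a root never exceeds `1`. -/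
theorem thetaRoots_gradingElt' {α : Module.Dual ℝ D.𝔞} (hα : α ∈ D.thetaRoots) :
    α D.gradingElt' = 1 := by
  obtain ⟨⟨hr, c, hc⟩, hs⟩ := hα
  have h1 : α D.gradingElt' = c (Fin.last D.rk) := by
    rw [hc, LinearMap.sum_apply, Finset.sum_eq_single (Fin.last D.rk)]
    · rw [LinearMap.smul_apply, D.simpleRoot_gradingElt', if_pos rfl]
      simp
    · intro i _ hi
      rw [LinearMap.smul_apply, D.simpleRoot_gradingElt', if_neg hi, smul_zero]
    · simp
  have h2 : c (Fin.last D.rk) ≠ 0 := by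
    intro h0
    refine hs ?_
    rw [hc]
    refine Submodule.sum_mem _ fun i _ => ?_
    by_cases hi : i = Fin.last D.rk
    · rw [hi, h0, zero_smul]
      exact Submodule.zero_mem _
    · exact Submodule.smul_of_tower_mem _ _ (Submodule.subset_span ⟨i, hi, rfl⟩)
  have h3 : (1 : ℝ) ≤ α D.gradingElt' := by
    rw [h1]
    exact_mod_cast Nat.one_le_iff_ne_zero.2 h2
  rw [D.roots_eq] at hr
  obtain ⟨-, i, j, h | h | h⟩ := hr <;>
    simp only [h, LinearMap.add_apply, LinearMap.sub_apply, LinearMap.neg_apply,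
      D.ε_gradingElt'] at h3 ⊢ <;> first | (norm_num at h3; done) | norm_num

theorem ε_sub_mem (i : Fin (D.rk + 1)) :
    D.ε i - D.ε (Fin.last D.rk) ∈ Submodule.span ℕ (range D.simpleRoot) := by
  induction i using Fin.reverseInduction with
  | last => simp
  | cast i ih =>
    have h1 : D.simpleRoot i.castSucc = D.ε i.castSucc - D.ε i.succ := by
      unfold simpleRoot
      rw [dif_pos (by simp)]
      rfl
    have h2 : D.ε i.castSucc - D.ε (Fin.last D.rk) =
        D.simpleRoot i.castSucc + (D.ε i.succ - D.ε (Fin.last D.rk)) := by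
      rw [h1]
      abel
    rw [h2]
    exact add_mem (Submodule.subset_span ⟨_, rfl⟩) ih

/-- Value `1` forces `α = ε_i + ε_j = (ε_i - ε_r) + (ε_j - ε_r) + 2ε_r`, a sum of simple roots by
telescoping; the span of the other simple roots vanishes at `h₀`. -/
theorem mem_thetaRoots {X : 𝔤} {α : Module.Dual ℝ D.𝔞} (hX : X ∈ restrictedRootSpace D.𝔞 α)
    (h0 : X ≠ 0) (hα : α D.gradingElt' = 1) : α ∈ D.thetaRoots := by
  have hα0 : α ≠ 0 := by
    rintro rfl
    simp at hα
  refine ⟨⟨⟨hα0, fun hb => h0 ((Submodule.eq_bot_iff _).1 hb X hX)⟩, ?_⟩, ?_⟩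
  · obtain ⟨i, j, rfl⟩ : ∃ i j, α = D.ε i + D.ε j := by
      rcases D.root_cases hX h0 with h | ⟨i, j, h | h | h⟩
      · exact absurd h hα0
      · exact ⟨i, j, h⟩
      all_goals
        simp only [h, LinearMap.sub_apply, LinearMap.neg_apply, D.ε_gradingElt'] at hα
        norm_num at hα
    have h1 : D.ε i + D.ε j = (D.ε i - D.ε (Fin.last D.rk)) + (D.ε j - D.ε (Fin.last D.rk)) +
        D.simpleRoot (Fin.last D.rk) := by
      unfold simpleRoot
      rw [dif_neg (by simp), two_smul]
      abel
    have h2 : D.ε i + D.ε j ∈ Submodule.span ℕ (range D.simpleRoot) := by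
      rw [h1]
      exact add_mem (add_mem (D.ε_sub_mem i) (D.ε_sub_mem j)) (Submodule.subset_span ⟨_, rfl⟩)
    obtain ⟨c, hc⟩ := (Submodule.mem_span_range_iff_exists_fun ℕ).1 h2
    exact ⟨c, hc.symm⟩
  · intro hs
    have h1 : Submodule.span ℝ (D.simpleRoot '' {i | i ≠ Fin.last D.rk}) ≤
        LinearMap.ker (Module.Dual.eval ℝ D.𝔞 D.gradingElt') := by
      rw [Submodule.span_le]
      rintro _ ⟨i, hi, rfl⟩
      change D.simpleRoot i D.gradingElt' = 0
      rw [D.simpleRoot_gradingElt', if_neg hi]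
    have h2 : α D.gradingElt' = 0 := h1 hs
    rw [hα] at h2
    norm_num at h2

theorem uPlus_eq : D.uPlus = degSpace D.gradingElt 1 := by
  refine le_antisymm ?_ ?_
  · refine iSup₂_le fun α hα => ?_
    rw [← D.thetaRoots_gradingElt' hα]
    exact D.rootSpace_le_degSpace α
  · intro X hX
    rw [← projPos_eq_self hX]
    refine D.forall_mem_of_rootSpaces (fun α Y hY h0 => ?_) X
    rw [projPos_of_mem (D.rootSpace_le_degSpace α hY)]
    by_cases h1 : α D.gradingElt' = 1
    · exact Submodule.smul_mem _ _ (Submodule.mem_iSup_of_mem α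
        (Submodule.mem_iSup_of_mem (D.mem_thetaRoots hY h0 h1) hY))
    · have h2 : ((α D.gradingElt' ^ 2 + α D.gradingElt') / 2) = 0 := by
        rcases D.root_cases hY h0 with h | ⟨i, j, h | h | h⟩ <;>
        simp only [h, LinearMap.add_apply, LinearMap.sub_apply, LinearMap.neg_apply,
          LinearMap.zero_apply, D.ε_gradingElt'] at h1 ⊢ <;> first | (norm_num at h1; done) | norm_num
      rw [h2, zero_smul]
      exact Submodule.zero_mem _

theorem uMinus_eq : D.uMinus = degSpace D.gradingElt (-1) := by
  refine le_antisymm ?_ ?_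
  · refine iSup₂_le fun α hα => ?_
    rw [← D.thetaRoots_gradingElt' hα, ← LinearMap.neg_apply]
    exact D.rootSpace_le_degSpace (-α)
  · intro X hX
    rw [← projNeg_eq_self hX]
    refine D.forall_mem_of_rootSpaces (fun α Y hY h0 => ?_) X
    rw [projNeg_of_mem (D.rootSpace_le_degSpace α hY)]
    by_cases h1 : α D.gradingElt' = -1
    · have h2 : -α ∈ D.thetaRoots := by
        refine D.mem_thetaRoots (D.σ_mem_rootSpace hY) (fun h => h0 ?_) ?_
        · rw [← D.σ_σ Y, h, map_zero]
        · rw [LinearMap.neg_apply, h1, neg_neg]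
      refine Submodule.smul_mem _ _ (Submodule.mem_iSup_of_mem (-α)
        (Submodule.mem_iSup_of_mem h2 ?_))
      rwa [neg_neg]
    · have h2 : ((α D.gradingElt' ^ 2 - α D.gradingElt') / 2) = 0 := by
        rcases D.root_cases hY h0 with h | ⟨i, j, h | h | h⟩ <;>
        simp only [h, LinearMap.add_apply, LinearMap.sub_apply, LinearMap.neg_apply,
          LinearMap.zero_apply, D.ε_gradingElt'] at h1 ⊢ <;> first | (norm_num at h1; done) | norm_num
      rw [h2, zero_smul]
      exact Submodule.zero_mem _

theorem longRoot_gradingElt' : D.longRoot D.gradingElt' = 1 := by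
  rw [longRoot, LinearMap.smul_apply, ε_gradingElt']
  norm_num

theorem vPlus_mem_degSpace : D.vPlus ∈ degSpace D.gradingElt 1 := by
  have h1 := D.rootSpace_le_degSpace D.longRoot D.vPlus_mem
  rwa [D.longRoot_gradingElt'] at h1

theorem vMinus_mem_degSpace : D.vMinus ∈ degSpace D.gradingElt (-1) := by
  have h1 := D.rootSpace_le_degSpace (-D.longRoot) D.vMinus_mem
  rwa [LinearMap.neg_apply, D.longRoot_gradingElt'] at h1

end RootSpaces

end HTTData

/-! ### The long root space is a line, and `v⁻` has rank one -/

namespace HTTData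

section RankOne

variable {𝔤 : Type*} [LieRing 𝔤] [LieAlgebra ℝ 𝔤] (D : HTTData 𝔤)

/-- The vector `X` of the long root space is normalized: `[X, -σ X]` is the coroot. -/
structure IsNormalized (X : 𝔤) (h : D.𝔞) : Prop where
  mem : X ∈ restrictedRootSpace D.𝔞 D.longRoot
  lie_eq : ⁅X, D.σ X⁆ = -(h : 𝔤)
  root_eq : D.longRoot h = 2

theorem killingForm_lie_σ {X : 𝔤} (hX : X ∈ restrictedRootSpace D.𝔞 D.longRoot) (H : D.𝔞) :
    killingForm ℝ 𝔤 ⁅X, D.σ X⁆ H = D.longRoot H * killingForm ℝ 𝔤 X (D.σ X) := by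
  rw [killingForm_lie, ← lie_skew, D.σ_mem_rootSpace hX H, LinearMap.neg_apply, neg_smul, neg_neg,
    map_smul, smul_eq_mul]

theorem exists_isNormalized {X : 𝔤} (hX : X ∈ restrictedRootSpace D.𝔞 D.longRoot) (h0 : X ≠ 0) :
    ∃ c : ℝ, c ≠ 0 ∧ ∃ h, D.IsNormalized (c • X) h := by
  have hσ : D.σ ⁅X, D.σ X⁆ = -⁅X, D.σ X⁆ := by
    rw [D.σ_lie, D.σ_σ, lie_skew]
  have hm : ⁅X, D.σ X⁆ ∈ D.𝔞 := by
    refine D.mem_𝔞_of_rootSpace_zero ?_ hσ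
    have := D.lie_mem_rootSpace hX (D.σ_mem_rootSpace hX)
    rwa [add_neg_cancel] at this
  have hk := D.cartan.pos X h0
  have hne : ⁅X, D.σ X⁆ ≠ 0 := by
    intro he
    refine D.longRoot_ne_zero (LinearMap.ext fun H => ?_)
    have := D.killingForm_lie_σ hX H
    rw [he, map_zero, LinearMap.zero_apply, eq_comm, mul_eq_zero] at this
    exact this.resolve_right (by linarith [hk])
  have h1 := D.killingForm_self_pos hσ hne
  have h2 := D.killingForm_lie_σ hX ⟨_, hm⟩
  simp only at h2
  have h3 : D.longRoot ⟨_, hm⟩ < 0 := by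
    rw [h2] at h1
    nlinarith
  set l := D.longRoot ⟨_, hm⟩ with hl
  have hpos : 0 < -2 / l := div_pos_of_neg_of_neg (by norm_num) h3
  -- Scaling `X` by `c` multiplies `⁅X, σ X⁆` by `c²`. The coroot `h = (2 / l) ⁅X, σ X⁆` takes the
  -- value `2`, and `⁅cX, σ(cX)⁆ = -h` means `c² = -2 / l`.
  refine ⟨√(-2 / l), (Real.sqrt_pos.2 hpos).ne', (2 / l) • ⟨_, hm⟩,
    Submodule.smul_mem _ _ hX, ?_, ?_⟩
  · rw [map_smul, smul_lie, lie_smul, smul_smul, Real.mul_self_sqrt hpos.le, Submodule.coe_smul]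
    module
  · rw [map_smul, ← hl, smul_eq_mul, div_mul_cancel₀ _ h3.ne]

/-- Both `h` and `h'` are multiples of the vector of `𝔞` dual to the long root for the Killing form,
which is definite on `𝔞`; the value `2` fixes the multiple. -/
theorem IsNormalized.unique {X X' : 𝔤} {h h' : D.𝔞} (hX : D.IsNormalized X h)
    (hX' : D.IsNormalized X' h') : h = h' := by
  have e1 : ∀ H : D.𝔞, killingForm ℝ 𝔤 h H = -(D.longRoot H * killingForm ℝ 𝔤 X (D.σ X)) := by
    intro H
    rw [← D.killingForm_lie_σ hX.mem, hX.lie_eq, map_neg, LinearMap.neg_apply, neg_neg]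
  have e2 : ∀ H : D.𝔞, killingForm ℝ 𝔤 h' H = -(D.longRoot H * killingForm ℝ 𝔤 X' (D.σ X')) := by
    intro H
    rw [← D.killingForm_lie_σ hX'.mem, hX'.lie_eq, map_neg, LinearMap.neg_apply, neg_neg]
  have hX0 : X ≠ 0 := by
    rintro rfl
    have h1 := hX.lie_eq
    rw [zero_lie, eq_comm, neg_eq_zero, Submodule.coe_eq_zero] at h1
    have := hX.root_eq
    rw [h1, map_zero] at this
    norm_num at this
  have hk := D.cartan.pos X hX0
  set b := killingForm ℝ 𝔤 X (D.σ X)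
  set b' := killingForm ℝ 𝔤 X' (D.σ X')
  have hd : b' • h - b • h' = 0 := by
    by_contra hne
    have h1 := D.killingForm_self_pos (D.maximalAbelian.sub_p _ (b' • h - b • h').2)
      (fun h => hne (Submodule.coe_eq_zero.1 h))
    have h2 : killingForm ℝ 𝔤 (b' • h - b • h' : D.𝔞) (b' • h - b • h' : D.𝔞) = 0 := by
      simp only [Submodule.coe_sub, Submodule.coe_smul, map_sub, map_smul, LinearMap.sub_apply,
        LinearMap.smul_apply, e1, e2, smul_eq_mul, hX.root_eq, hX'.root_eq]
      ring
    exact h1.ne' h2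
  have hbb : b' = b := by
    have := congrArg D.longRoot hd
    rw [map_sub, map_smul, map_smul, hX.root_eq, hX'.root_eq, map_zero, smul_eq_mul,
      smul_eq_mul] at this
    linarith
  rw [hbb, ← smul_sub, smul_eq_zero, sub_eq_zero] at hd
  exact hd.resolve_left (by linarith)

/-- The three summands are eigenvectors of `ad h` for the distinct eigenvalues `2`, `0`, `-2`. -/
theorem eq_zero_of_add_eq_zero {h : D.𝔞} (hh : D.longRoot h = 2) {a b c : 𝔤}
    (ha : a ∈ restrictedRootSpace D.𝔞 D.longRoot) (hb : b ∈ restrictedRootSpace D.𝔞 0)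
    (hc : c ∈ restrictedRootSpace D.𝔞 (-D.longRoot)) (he : a + b + c = 0) :
    a = 0 ∧ b = 0 ∧ c = 0 := by
  have e1 : ⁅(h : 𝔤), a + b + c⁆ = (2 : ℝ) • a - (2 : ℝ) • c := by
    rw [lie_add, lie_add, ha h, hb h, hc h, LinearMap.neg_apply, hh, LinearMap.zero_apply]
    module
  have e2 : ⁅(h : 𝔤), (2 : ℝ) • a - (2 : ℝ) • c⁆ = (4 : ℝ) • a + (4 : ℝ) • c := by
    rw [lie_sub, lie_smul, lie_smul, ha h, hc h, LinearMap.neg_apply, hh]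
    module
  rw [he, lie_zero] at e1
  rw [← e1, lie_zero] at e2
  have ha0 : a = 0 := by
    have : a = (1 / 4 : ℝ) • ((2 : ℝ) • a - (2 : ℝ) • c) +
        (1 / 8 : ℝ) • ((4 : ℝ) • a + (4 : ℝ) • c) := by module
    rw [this, ← e1, ← e2]
    simp
  have hc0 : c = 0 := by
    have : c = -(1 / 4 : ℝ) • ((2 : ℝ) • a - (2 : ℝ) • c) +
        (1 / 8 : ℝ) • ((4 : ℝ) • a + (4 : ℝ) • c) := by module
    rw [this, ← e1, ← e2]
    simp
  rw [ha0, hc0, zero_add, add_zero] at he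
  exact ⟨ha0, he, hc0⟩

variable [FiniteDimensional ℝ 𝔤]

section

variable {D} {X : 𝔤} {h : D.𝔞} (hX : D.IsNormalized X h)

include hX

/-- Here `t = α(h)`. The string of `α` along the long root has at most two terms, since `⁅X, a⁆ = 0`
and `⁅σX, ⁅σX, a⁆⁆ = 0`, which leaves only `α(h) ∈ {0, 1}`. -/
theorem IsNormalized.lie_lie_of_lastCoord_one {a : 𝔤} {α : Module.Dual ℝ D.𝔞}
    (ha : a ∈ restrictedRootSpace D.𝔞 α) (h0 : a ≠ 0) (hα : D.lastCoord α = 1) :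
    ∃ t : ℝ, t * (1 - t) = 0 ∧ ⁅X + D.σ X, ⁅X + D.σ X, a⁆⁆ = -t • a := by
  have hZ := D.σ_mem_rootSpace hX.mem
  have hlie := hX.lie_eq
  set Z := D.σ X
  have e1 : ⁅X, a⁆ = 0 := D.eq_zero_of_lastCoord (D.lie_mem_rootSpace hX.mem ha) (by
    rw [map_add, hα, D.lastCoord_longRoot]
    norm_num)
  have hb := D.lie_mem_rootSpace hZ ha
  have e2 : ⁅Z, ⁅Z, a⁆⁆ = 0 := D.eq_zero_of_lastCoord (D.lie_mem_rootSpace hZ hb) (by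
    rw [map_add, map_add, map_neg, hα, D.lastCoord_longRoot]
    norm_num)
  have e3 : ⁅X, ⁅Z, a⁆⁆ = -α h • a := by
    rw [leibniz_lie, hlie, e1, lie_zero, add_zero, neg_lie, ha h, neg_smul]
  have e4 : ⁅(h : 𝔤), ⁅Z, a⁆⁆ = (α h - 2) • ⁅Z, a⁆ := by
    rw [hb h, LinearMap.add_apply, LinearMap.neg_apply, hX.root_eq]
    module
  have e5 : (2 * (1 - α h)) • ⁅Z, a⁆ = 0 := by
    have := leibniz_lie X Z ⁅Z, a⁆
    rw [e2, lie_zero, hlie, neg_lie, e4, e3, lie_smul] at this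
    rw [this]
    module
  refine ⟨α h, ?_, ?_⟩
  · rcases smul_eq_zero.1 e5 with e | e
    · rw [show 1 - α h = 0 by linarith, mul_zero]
    · rw [e, lie_zero, eq_comm, smul_eq_zero] at e3
      rw [neg_eq_zero.1 (e3.resolve_right h0), zero_mul]
  · rw [add_lie X Z a, e1, zero_add, add_lie, e2, e3, add_zero]

/-- On root spaces outside weights `0` and `±2ε_r`, the operator `T = (ad (X + σX))²` has
eigenvalues `0` and `-1` only, so `T (T + 1)` maps `𝔤` into the sum `M` of these three weight
spaces. As `T (T + 1) A = 12 A`, the vector `A` lies in `M`, where it is computed weight by weight.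
-/
theorem IsNormalized.exists_eq {A : 𝔤} (hA : D.σ A = -A)
    (hT : ⁅X + D.σ X, ⁅X + D.σ X, A⁆⁆ = -(4 : ℝ) • A) :
    ∃ s t : ℝ, A = s • X + t • (h : 𝔤) - s • D.σ X := by
  have hZ := D.σ_mem_rootSpace hX.mem
  have hXm := hX.mem
  have hlie := hX.lie_eq
  have hσE : D.σ (X + D.σ X) = X + D.σ X := by rw [map_add, D.σ_σ, add_comm]
  set E := X + D.σ X with hE
  set M : Submodule ℝ 𝔤 := restrictedRootSpace D.𝔞 D.longRoot ⊔ restrictedRootSpace D.𝔞 0 ⊔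
    restrictedRootSpace D.𝔞 (-D.longRoot) with hM
  have hMp : ∀ Y ∈ restrictedRootSpace D.𝔞 D.longRoot, Y ∈ M := fun Y hY =>
    Submodule.mem_sup_left (Submodule.mem_sup_left hY)
  have hM0 : ∀ Y ∈ restrictedRootSpace D.𝔞 0, Y ∈ M := fun Y hY =>
    Submodule.mem_sup_left (Submodule.mem_sup_right hY)
  have hMm : ∀ Y ∈ restrictedRootSpace D.𝔞 (-D.longRoot), Y ∈ M := fun Y hY =>
    Submodule.mem_sup_right hY
  have hXX : ∀ Y ∈ restrictedRootSpace D.𝔞 D.longRoot, ⁅X, Y⁆ = 0 := fun Y hY =>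
    D.eq_zero_of_lastCoord (D.lie_mem_rootSpace hXm hY) (by
      rw [map_add, D.lastCoord_longRoot]
      norm_num)
  have hZZ : ∀ Y ∈ restrictedRootSpace D.𝔞 (-D.longRoot), ⁅D.σ X, Y⁆ = 0 := fun Y hY =>
    D.eq_zero_of_lastCoord (D.lie_mem_rootSpace hZ hY) (by
      rw [map_add, map_neg, D.lastCoord_longRoot]
      norm_num)
  have hZp : ∀ Y ∈ restrictedRootSpace D.𝔞 D.longRoot, ⁅D.σ X, Y⁆ ∈ restrictedRootSpace D.𝔞 0 :=
    fun Y hY => by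
      have := D.lie_mem_rootSpace hZ hY
      rwa [neg_add_cancel] at this
  have hXm' : ∀ Y ∈ restrictedRootSpace D.𝔞 (-D.longRoot), ⁅X, Y⁆ ∈ restrictedRootSpace D.𝔞 0 :=
    fun Y hY => by
      have := D.lie_mem_rootSpace hXm hY
      rwa [add_neg_cancel] at this
  have hstab : ∀ Y ∈ M, ⁅E, Y⁆ ∈ M := by
    intro Y hY
    obtain ⟨u, hu, c, hc, rfl⟩ := Submodule.mem_sup.1 hY
    obtain ⟨a, ha, b, hb, rfl⟩ := Submodule.mem_sup.1 hu
    rw [hE, add_lie, lie_add, lie_add, lie_add, lie_add, hXX a ha, hZZ c hc, zero_add, add_zero]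
    refine add_mem (add_mem ?_ ?_) (add_mem ?_ ?_)
    · refine hMp _ ?_
      have := D.lie_mem_rootSpace hXm hb
      rwa [add_zero] at this
    · exact hM0 _ (hXm' c hc)
    · exact hM0 _ (hZp a ha)
    · refine hMm _ ?_
      have := D.lie_mem_rootSpace hZ hb
      rwa [add_zero] at this
  let T : 𝔤 →ₗ[ℝ] 𝔤 := LieAlgebra.ad ℝ 𝔤 E ∘ₗ LieAlgebra.ad ℝ 𝔤 E
  have hTa : ∀ Y, T Y = ⁅E, ⁅E, Y⁆⁆ := fun Y => rfl
  have hTM : ∀ Y ∈ M, (T ∘ₗ (T + LinearMap.id)) Y ∈ M := by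
    intro Y hY
    rw [LinearMap.comp_apply, LinearMap.add_apply, LinearMap.id_apply, hTa, hTa]
    exact hstab _ (hstab _ (add_mem (hstab _ (hstab _ hY)) hY))
  have hone : ∀ (α : Module.Dual ℝ D.𝔞), ∀ a ∈ restrictedRootSpace D.𝔞 α, a ≠ 0 →
      D.lastCoord α = 1 → (T ∘ₗ (T + LinearMap.id)) a = 0 := by
    intro α a ha h0 hα
    obtain ⟨t, ht, e⟩ := hX.lie_lie_of_lastCoord_one ha h0 hα
    rw [LinearMap.comp_apply, LinearMap.add_apply, LinearMap.id_apply, map_add, hTa a, e, map_smul,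
      hTa a, e, smul_smul, ← add_smul]
    have : -t * -t + -t = 0 := by linear_combination -ht
    rw [this, zero_smul]
  have hσT : ∀ Y, D.σ (T Y) = T (D.σ Y) := by
    intro Y
    rw [hTa, hTa, D.σ_lie, D.σ_lie, hσE]
  have hAM : A ∈ M := by
    have h1 : (T ∘ₗ (T + LinearMap.id)) A ∈ M := by
      refine D.forall_mem_of_rootSpaces (fun α a ha h0 => ?_) A
      rcases D.lastCoord_cases ha h0 with e | e | e | e | e
      · exact hTM a (hMp a (e ▸ ha))
      · exact hTM a (hMm a (e ▸ ha))
      · by_cases hα : α = 0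
        · exact hTM a (hM0 a (hα ▸ ha))
        · have e1 : ⁅X, a⁆ = 0 := D.eq_zero_of_lastCoord_eq_two (D.lie_mem_rootSpace hXm ha)
            (by rw [map_add, e, D.lastCoord_longRoot, add_zero])
            (fun h => hα (by simpa using h))
          have e2 : ⁅D.σ X, a⁆ = 0 := D.eq_zero_of_lastCoord_eq_neg_two (D.lie_mem_rootSpace hZ ha)
            (by rw [map_add, e, map_neg, D.lastCoord_longRoot, add_zero])
            (fun h => hα (by simpa using h))
          have e3 : ⁅E, a⁆ = 0 := by rw [hE, add_lie, e1, e2, add_zero]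
          rw [LinearMap.comp_apply, LinearMap.add_apply, LinearMap.id_apply, map_add, hTa a, e3,
            lie_zero, map_zero, zero_add]
          exact M.zero_mem
      · rw [hone α a ha h0 e]
        exact M.zero_mem
      · have h2 := hone (-α) (D.σ a) (D.σ_mem_rootSpace ha)
          (fun h => h0 (by rw [← D.σ_σ a, h, map_zero])) (by rw [map_neg, e, neg_neg])
        rw [LinearMap.comp_apply, LinearMap.add_apply, LinearMap.id_apply, ← hσT, ← map_add,
          ← hσT] at h2
        have h3 : T (T a + a) = 0 := by rw [← D.σ_σ (T (T a + a)), h2, map_zero]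
        rw [LinearMap.comp_apply, LinearMap.add_apply, LinearMap.id_apply, h3]
        exact M.zero_mem
    rw [LinearMap.comp_apply, LinearMap.add_apply, LinearMap.id_apply, map_add, hTa A, hT, map_smul,
      hTa A, hT, smul_smul, ← add_smul] at h1
    exact (M.smul_mem_iff (by norm_num)).1 h1
  obtain ⟨u, hu, c, hc, hAe⟩ := Submodule.mem_sup.1 hAM
  obtain ⟨a, ha, b, hb, rfl⟩ := Submodule.mem_sup.1 hu
  have hσ0 : ∀ Y ∈ restrictedRootSpace D.𝔞 0, D.σ Y ∈ restrictedRootSpace D.𝔞 0 := fun Y hY => by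
    have := D.σ_mem_rootSpace hY
    rwa [neg_zero] at this
  have hσm : ∀ Y ∈ restrictedRootSpace D.𝔞 (-D.longRoot),
      D.σ Y ∈ restrictedRootSpace D.𝔞 D.longRoot := fun Y hY => by
    have := D.σ_mem_rootSpace hY
    rwa [neg_neg] at this
  -- `σ` exchanges the weights `±2ε_r`, so `σ A = -A` gives `σ a = -c` and `σ b = -b`; the last puts
  -- `b` in `𝔞` by maximality.
  obtain ⟨s1, s2, s3⟩ := D.eq_zero_of_add_eq_zero hX.root_eq (add_mem ha (hσm c hc))
    (add_mem hb (hσ0 b hb)) (add_mem hc (D.σ_mem_rootSpace ha)) (by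
      rw [← hAe, map_add, map_add] at hA
      have : a + D.σ c + (b + D.σ b) + (c + D.σ a) = a + b + c + (D.σ a + D.σ b + D.σ c) := by abel
      rw [this, hA]
      abel)
  have hb𝔞 : b ∈ D.𝔞 := D.mem_𝔞_of_rootSpace_zero hb (by
    rw [eq_neg_iff_add_eq_zero, add_comm]
    exact s2)
  have hσa : D.σ a = -c := by rw [eq_neg_iff_add_eq_zero, add_comm, s3]
  have hσc : D.σ c = -a := by rw [eq_neg_iff_add_eq_zero, add_comm, s1]
  have hH : ⁅X, c⁆ + ⁅D.σ X, a⁆ ∈ D.𝔞 := by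
    refine D.mem_𝔞_of_rootSpace_zero (add_mem (hXm' c hc) (hZp a ha)) ?_
    rw [map_add, D.σ_lie, D.σ_lie, D.σ_σ, hσa, hσc, lie_neg, lie_neg]
    abel
  have hX𝔞 : ∀ H : D.𝔞, ⁅E, (H : 𝔤)⁆ = -(D.longRoot H) • X + D.longRoot H • D.σ X := by
    intro H
    rw [hE, ← lie_skew, lie_add, hXm H, hZ H, LinearMap.neg_apply]
    module
  have e1 : ⁅E, A⁆ = (-(D.longRoot ⟨b, hb𝔞⟩) • X + D.longRoot ⟨b, hb𝔞⟩ • D.σ X) +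
      (⁅X, c⁆ + ⁅D.σ X, a⁆) := by
    rw [← hAe, lie_add, lie_add, ← hX𝔞 ⟨b, hb𝔞⟩]
    simp only
    rw [hE, add_lie X _ a, add_lie X _ c, hXX a ha, hZZ c hc]
    abel
  have e2 : ⁅E, X⁆ = (h : 𝔤) := by
    rw [hE, add_lie, lie_self, zero_add, ← lie_skew, hlie, neg_neg]
  have e3 : ⁅E, D.σ X⁆ = -(h : 𝔤) := by
    rw [hE, add_lie, lie_self, add_zero, hlie]
  set l := D.longRoot ⟨b, hb𝔞⟩
  set m := D.longRoot ⟨_, hH⟩ with hm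
  have e4 : ⁅E, ⁅E, A⁆⁆ = -(m • X) + -((2 * l) • (h : 𝔤)) + m • D.σ X := by
    have := hX𝔞 ⟨_, hH⟩
    simp only at this
    rw [e1, lie_add, this, lie_add, lie_smul, lie_smul, e2, e3, ← hm]
    module
  have hh0 : (h : 𝔤) ∈ restrictedRootSpace D.𝔞 0 := by
    intro H
    rw [D.maximalAbelian.abelian _ H.2 _ h.2, LinearMap.zero_apply, zero_smul]
  -- Comparing weights in `(ad E)² A = -4 A` gives `4a = mX`, `4b = 2l h` and `4c = -m σX`.
  obtain ⟨r1, r2, r3⟩ := D.eq_zero_of_add_eq_zero hX.root_eq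
    (sub_mem ((restrictedRootSpace D.𝔞 D.longRoot).smul_mem 4 ha) (Submodule.smul_mem _ m hXm))
    (sub_mem ((restrictedRootSpace D.𝔞 0).smul_mem 4 hb) (Submodule.smul_mem _ (2 * l) hh0))
    (add_mem ((restrictedRootSpace D.𝔞 (-D.longRoot)).smul_mem 4 hc) (Submodule.smul_mem _ m hZ))
    (by
      rw [hT, ← hAe] at e4
      rw [← sub_eq_zero] at e4
      rw [← neg_eq_zero, ← e4]
      module)
  refine ⟨m / 4, l / 2, ?_⟩
  rw [← hAe]
  have f1 : a = (m / 4) • X := by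
    rw [sub_eq_zero] at r1
    rw [div_eq_inv_mul, mul_smul, ← r1, smul_smul]
    norm_num
  have f2 : b = (l / 2) • (h : 𝔤) := by
    rw [sub_eq_zero] at r2
    rw [show l / 2 = 4⁻¹ * (2 * l) by ring, mul_smul, ← r2, smul_smul]
    norm_num
  have f3 : c = -((m / 4) • D.σ X) := by
    rw [add_eq_zero_iff_eq_neg] at r3
    rw [div_eq_inv_mul, mul_smul, ← smul_neg, ← r3, smul_smul]
    norm_num
  rw [f1, f2, f3]
  abel

end

/-- The long root space is a line. -/
theorem exists_eq_smul_of_longRoot {X X' : 𝔤} (hX : X ∈ restrictedRootSpace D.𝔞 D.longRoot)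
    (hX' : X' ∈ restrictedRootSpace D.𝔞 D.longRoot) (h0 : X ≠ 0) : ∃ c : ℝ, X' = c • X := by
  rcases eq_or_ne X' 0 with rfl | h0'
  · exact ⟨0, by simp⟩
  obtain ⟨c, hc, h, hN⟩ := D.exists_isNormalized hX h0
  obtain ⟨c', hc', h', hN'⟩ := D.exists_isNormalized hX' h0'
  obtain rfl := hN.unique D hN'
  obtain ⟨J, J1, J2, J3, -⟩ := D.hermitian
  have hhσ := D.maximalAbelian.sub_p _ h.2
  -- `Y + σY` lies in `𝔨`, so `J` commutes with its adjoint action on `𝔭`. Since `(ad (Y + σY))² h =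
  -- -4 h`, the same holds for `J h`, which is thus a combination of `Y`, `h`, `σY`.
  have key : ∀ {Y : 𝔤}, D.IsNormalized Y h → ∃ s t : ℝ, s ≠ 0 ∧
      J h = s • Y + t • (h : 𝔤) - s • D.σ Y := by
    intro Y hY
    have hσE : D.σ (Y + D.σ Y) = Y + D.σ Y := by rw [map_add, D.σ_σ, add_comm]
    have e1 : ⁅Y + D.σ Y, (h : 𝔤)⁆ = -(2 : ℝ) • Y + (2 : ℝ) • D.σ Y := by
      rw [← lie_skew, lie_add, hY.mem h, D.σ_mem_rootSpace hY.mem h, LinearMap.neg_apply, hY.root_eq]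
      module
    have e2 : ⁅Y + D.σ Y, ⁅Y + D.σ Y, (h : 𝔤)⁆⁆ = -(4 : ℝ) • (h : 𝔤) := by
      rw [e1, lie_add, lie_smul, lie_smul, add_lie, add_lie, lie_self, lie_self,
        ← lie_skew (D.σ Y) Y, hY.lie_eq]
      module
    have e3 : D.σ ⁅Y + D.σ Y, (h : 𝔤)⁆ = -⁅Y + D.σ Y, (h : 𝔤)⁆ := by
      rw [D.σ_lie, hσE, hhσ, lie_neg]
    have e4 : ⁅Y + D.σ Y, ⁅Y + D.σ Y, J h⁆⁆ = -(4 : ℝ) • J h := by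
      rw [← J3 _ _ hσE hhσ, ← J3 _ _ hσE e3, e2, map_smul]
    obtain ⟨s, t, e⟩ := hY.exists_eq (J1 _ hhσ) e4
    refine ⟨s, t, ?_, e⟩
    -- If `s = 0` then `J h = t h`, and `J² = -1` gives `t² = -1`.
    rintro rfl
    rw [zero_smul, zero_smul, zero_add, sub_zero] at e
    have e5 := J2 _ hhσ
    rw [e, map_smul, e, smul_smul, eq_neg_iff_add_eq_zero] at e5
    have e6 : (t * t + 1) • (h : 𝔤) = 0 := by rw [add_smul, one_smul, e5]
    have e7 := (smul_eq_zero.1 e6).resolve_left (by nlinarith [mul_self_nonneg t])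
    have := hY.root_eq
    rw [Submodule.coe_eq_zero.1 e7, map_zero] at this
    norm_num at this
  obtain ⟨s, t, hs, e⟩ := key hN
  obtain ⟨s', t', hs', e'⟩ := key hN'
  have hh0 : (h : 𝔤) ∈ restrictedRootSpace D.𝔞 0 := by
    intro H
    rw [D.maximalAbelian.abelian _ H.2 _ h.2, LinearMap.zero_apply, zero_smul]
  -- `J h` is the same vector for both normalized generators, because they have the same coroot `h`;
  -- its component of weight `2ε_r` is a nonzero multiple of each.
  obtain ⟨r, -, -⟩ := D.eq_zero_of_add_eq_zero hN.root_eq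
    (sub_mem (Submodule.smul_mem _ s hN.mem) (Submodule.smul_mem _ s' hN'.mem))
    (Submodule.smul_mem _ (t - t') hh0)
    (sub_mem (Submodule.smul_mem _ s' (D.σ_mem_rootSpace hN'.mem))
      (Submodule.smul_mem _ s (D.σ_mem_rootSpace hN.mem))) (by
      rw [e, ← sub_eq_zero] at e'
      rw [← e']
      module)
  refine ⟨(s' * c')⁻¹ * (s * c), ?_⟩
  rw [sub_eq_zero, smul_smul, smul_smul] at r
  rw [mul_smul, r, smul_smul, inv_mul_cancel₀ (mul_ne_zero hs' hc'), one_smul]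

theorem vMinus_ne_zero : D.vMinus ≠ 0 := by
  intro h
  have := D.sl2.h_ne_zero
  rw [h, lie_zero] at this
  exact this rfl

theorem vMinus_lie_lie_vPlus : ⁅D.vMinus, ⁅D.vMinus, D.vPlus⁆⁆ = (-2 : ℝ) • D.vMinus := by
  rw [← lie_skew D.vMinus D.vPlus, lie_neg, lie_skew, D.sl2.lie_h_f_nsmul]
  module

theorem vPlus_lie_lie_vMinus : ⁅D.vPlus, ⁅D.vPlus, D.vMinus⁆⁆ = (-2 : ℝ) • D.vPlus := by
  rw [← lie_skew, D.sl2.lie_h_e_nsmul]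
  module

/-- `(ad v⁻)²` lowers the coordinate along `ε_r` by `4`, so only the root space of `2ε_r` survives,
and its image lies in the root space of `-2ε_r`, which is a line. -/
theorem vMinus_rank_one (Y : 𝔤) : ∃ c : ℝ, ⁅D.vMinus, ⁅D.vMinus, Y⁆⁆ = c • D.vMinus := by
  have h1 := D.forall_mem_of_rootSpaces (V := Submodule.span ℝ {D.vMinus})
    (T := LieAlgebra.ad ℝ 𝔤 D.vMinus ∘ₗ LieAlgebra.ad ℝ 𝔤 D.vMinus) ?_ Y
  · obtain ⟨c, hc⟩ := Submodule.mem_span_singleton.1 h1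
    exact ⟨c, hc.symm⟩
  · intro α X hX h0
    rw [LinearMap.comp_apply, LieAlgebra.ad_apply, LieAlgebra.ad_apply]
    have hv : D.vMinus ∈ restrictedRootSpace D.𝔞 (-D.longRoot) := D.vMinus_mem
    have h2 := D.lie_mem_rootSpace hv (D.lie_mem_rootSpace hv hX)
    by_cases hα : α = D.longRoot
    · rw [hα, neg_add_cancel, add_zero] at h2
      have h3 := D.σ_mem_rootSpace h2
      have h4 := D.σ_mem_rootSpace hv
      rw [neg_neg] at h3 h4
      obtain ⟨c, hc⟩ := D.exists_eq_smul_of_longRoot h4 h3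
        (fun h => D.vMinus_ne_zero (by rw [← D.σ_σ D.vMinus, h, map_zero]))
      refine Submodule.mem_span_singleton.2 ⟨c, ?_⟩
      rw [← D.σ_σ ⁅D.vMinus, _⁆, hc, map_smul, D.σ_σ]
    · have h3 : ⁅D.vMinus, ⁅D.vMinus, X⁆⁆ = 0 := by
        refine D.eq_zero_of_lastCoord h2 ?_
        rw [map_add, map_add, map_neg, D.lastCoord_longRoot]
        rcases D.lastCoord_cases hX h0 with e | e | e | e | e
        · exact absurd e hα
        · rw [e, map_neg, D.lastCoord_longRoot]
          norm_num
        all_goals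
          rw [e]
          norm_num
      rw [h3]
      exact Submodule.zero_mem _

/-- For `w ≠ 0` of degree `-1`, the vectors `w` and `σ w` do not commute, even twice. -/
theorem lie_lie_σ_ne_zero {w : 𝔤} (hw : w ∈ degSpace D.gradingElt (-1)) (h0 : w ≠ 0) :
    ⁅w, ⁅w, D.σ w⁆⁆ ≠ 0 := by
  intro h
  have hσ : D.σ ⁅w, D.σ w⁆ = -⁅w, D.σ w⁆ := by
    rw [D.σ_lie, D.σ_σ, lie_skew]
  have e1 : ⁅w, D.σ w⁆ = 0 := by
    -- `⁅w, σw⁆` is in `𝔭`, where the Killing form is positive, but invariance gives `B(⁅σw, w⁆, ⁅w,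
    -- σw⁆) = B(σw, ⁅w, ⁅w, σw⁆⁆) = 0`.
    by_contra hne
    have h1 := D.killingForm_self_pos hσ hne
    have h2 : killingForm ℝ 𝔤 ⁅D.σ w, w⁆ ⁅w, D.σ w⁆ = 0 := by
      rw [killingForm_lie, h, map_zero]
    rw [← lie_skew, map_neg, LinearMap.neg_apply] at h2
    linarith
  -- Pairing with the grading element, which acts on `σw` by `1`, turns `⁅w, σw⁆ = 0` into `B(w, σw)
  -- = 0`, against positivity.
  have e2 : killingForm ℝ 𝔤 ⁅w, D.σ w⁆ D.gradingElt = killingForm ℝ 𝔤 w ⁅D.σ w, D.gradingElt⁆ :=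
    killingForm_lie _ _ _
  have e3 : ⁅D.σ w, D.gradingElt⁆ = -D.σ w := by
    have e4 := congrArg D.σ (mem_degSpace_neg_one.1 hw)
    rw [D.σ_lie, D.σ_gradingElt, map_neg, neg_lie, lie_skew] at e4
    exact e4
  rw [e1, e3, map_zero, LinearMap.zero_apply, map_neg] at e2
  exact (D.cartan.pos w h0).ne e2

end RankOne

end HTTData

/-! ### Levi decompositions and rank one pairs -/

namespace HTTData

section Orbits

open LieGrp

variable {n : ℕ} {G : Type*} [TopologicalSpace G] [ChartedSpace (EuclideanSpace ℝ (Fin n)) G]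
  [Group G] [LieGroup (𝓡 n) ∞ G] (D : HTTData (GroupLieAlgebra (𝓡 n) G))

theorem mem_parabolic_iff {g : G} : g ∈ D.parabolic ↔
    ∀ X, Ad g X ∈ degSpace D.gradingElt 1 ↔ X ∈ degSpace D.gradingElt 1 := by
  rw [← D.uPlus_eq]
  rfl

theorem mem_oppParabolic_iff {g : G} : g ∈ D.oppParabolic ↔
    ∀ X, Ad g X ∈ degSpace D.gradingElt (-1) ↔ X ∈ degSpace D.gradingElt (-1) := by
  rw [← D.uMinus_eq]
  rfl

/-- `Ad g` is injective and the space is finite-dimensional, so mapping it into itself means mapping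
it onto itself. -/
theorem mem_parabolic_of_forall {g : G}
    (hg : ∀ X ∈ degSpace D.gradingElt 1, Ad g X ∈ degSpace D.gradingElt 1) : g ∈ D.parabolic := by
  rw [mem_parabolic_iff]
  have h1 : (degSpace D.gradingElt 1).map (adEquiv g).toLinearEquiv.toLinearMap =
      degSpace D.gradingElt 1 := by
    refine Submodule.eq_of_le_of_finrank_eq ?_ (LinearEquiv.finrank_map_eq _ _)
    rintro _ ⟨X, hX, rfl⟩
    exact hg X hX
  refine fun X => ⟨fun hX => ?_, hg X⟩
  rw [← h1] at hX
  obtain ⟨Y, hY, hYX⟩ := hX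
  have : Y = X := (adEquiv g).injective hYX
  rwa [← this]

/-- The centralizer of the grading element. -/
def levi : Subgroup G where
  carrier := {g | Ad g D.gradingElt = D.gradingElt}
  mul_mem' := by
    intro a b ha hb
    rw [mem_ofPred_eq] at *
    rw [Ad_mul_apply, hb, ha]
  one_mem' := Ad_one_apply _
  inv_mem' := by
    intro a ha
    rw [mem_ofPred_eq] at *
    conv_lhs => rw [← ha]
    exact Ad_inv_apply_Ad _ _

theorem mem_levi {g : G} : g ∈ D.levi ↔ Ad g D.gradingElt = D.gradingElt := Iff.rfl

theorem Ad_mem_degSpace {g : G} (hg : g ∈ D.levi) {k : ℝ} {X : GroupLieAlgebra (𝓡 n) G} :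
    Ad g X ∈ degSpace D.gradingElt k ↔ X ∈ degSpace D.gradingElt k := by
  have := map_mem_degSpace (adEquiv g) (h := D.gradingElt) (X := X) (k := k)
  rw [adEquiv_apply, adEquiv_apply, D.mem_levi.1 hg] at this
  exact this

theorem levi_le_parabolic : D.levi ≤ D.parabolic := fun _ hg =>
  D.mem_parabolic_iff.2 fun _ => D.Ad_mem_degSpace hg

theorem exp_mem_parabolic {X : GroupLieAlgebra (𝓡 n) G} (hX : X ∈ degSpace D.gradingElt 1) :
    exp X ∈ D.parabolic := by
  refine D.mem_parabolic_of_forall fun Y hY => ?_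
  rwa [Ad_exp_of_lie_eq_zero (D.isThreeGrading.lie_eq_zero_of_pos hX hY)]

theorem exp_mem_levi {X : GroupLieAlgebra (𝓡 n) G} (hX : X ∈ degSpace D.gradingElt 0) :
    exp X ∈ D.levi := by
  rw [mem_levi]
  refine Ad_exp_of_lie_eq_zero ?_
  rw [← lie_skew, mem_degSpace_zero.1 hX, neg_zero]

theorem Ad_exp_pos {X : GroupLieAlgebra (𝓡 n) G} (hX : X ∈ degSpace D.gradingElt 1)
    (Y : GroupLieAlgebra (𝓡 n) G) : Ad (exp X) Y = expAct X Y :=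
  Ad_exp_of_lie_lie_lie_eq_zero (D.isThreeGrading.lie_lie_lie_of_pos hX Y)

theorem Ad_exp_neg {X : GroupLieAlgebra (𝓡 n) G} (hX : X ∈ degSpace D.gradingElt (-1))
    (Y : GroupLieAlgebra (𝓡 n) G) : Ad (exp X) Y = expAct X Y :=
  Ad_exp_of_lie_lie_lie_eq_zero (D.isThreeGrading.lie_lie_lie_of_neg hX Y)

theorem Ad_exp_pos_gradingElt {X : GroupLieAlgebra (𝓡 n) G} (hX : X ∈ degSpace D.gradingElt 1) :
    Ad (exp X) D.gradingElt = D.gradingElt - X := by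
  have h1 : ⁅X, D.gradingElt⁆ = -X := by rw [← lie_skew, mem_degSpace_one.1 hX]
  rw [D.Ad_exp_pos hX, expAct, h1, lie_neg, lie_self, neg_zero, smul_zero, add_zero, sub_eq_add_neg]

theorem Ad_exp_neg_gradingElt {X : GroupLieAlgebra (𝓡 n) G}
    (hX : X ∈ degSpace D.gradingElt (-1)) : Ad (exp X) D.gradingElt = D.gradingElt + X := by
  have h1 : ⁅X, D.gradingElt⁆ = X := by rw [← lie_skew, mem_degSpace_neg_one.1 hX, neg_neg]
  rw [D.Ad_exp_neg hX, expAct, h1, lie_self, smul_zero, add_zero]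

theorem isSimple (D : HTTData (GroupLieAlgebra (𝓡 n) G)) :
    LieAlgebra.IsSimple ℝ (GroupLieAlgebra (𝓡 n) G) := D.simple

/-- `h₀` and `Ad g h₀` are gradings with the same positive part `𝔲⁺`. -/
theorem Ad_gradingElt_sub_mem {g : G} (hg : g ∈ D.parabolic) :
    Ad g D.gradingElt - D.gradingElt ∈ degSpace D.gradingElt 1 := by
  have := D.isKilling
  refine D.isThreeGrading.sub_mem_of_degSpace_eq (D.isThreeGrading.map (adEquiv g)) ?_
  ext X
  obtain ⟨Y, rfl⟩ := (adEquiv g).surjective X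
  change adEquiv g Y ∈ degSpace (adEquiv g D.gradingElt) 1 ↔ _
  rw [map_mem_degSpace]
  exact (D.mem_parabolic_iff.1 hg Y).symm

theorem Ad_gradingElt_sub_mem_neg {g : G} (hg : g ∈ D.oppParabolic) :
    Ad g D.gradingElt - D.gradingElt ∈ degSpace D.gradingElt (-1) := by
  have := D.isKilling
  have h1 := D.isThreeGrading.neg.sub_mem_of_degSpace_eq
    (D.isThreeGrading.neg.map (adEquiv g)) ?_
  · rw [map_neg, degSpace_neg, ← neg_mem_iff] at h1
    convert h1 using 1
    rw [adEquiv_apply]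
    abel
  · ext X
    obtain ⟨Y, rfl⟩ := (adEquiv g).surjective X
    change adEquiv g Y ∈ degSpace (adEquiv g (-D.gradingElt)) 1 ↔ _
    rw [map_mem_degSpace, degSpace_neg]
    exact (D.mem_oppParabolic_iff.1 hg Y).symm

/-- Levi decomposition of `P`. -/
theorem exists_levi_mul_exp {g : G} (hg : g ∈ D.parabolic) :
    ∃ l ∈ D.levi, ∃ Y ∈ degSpace D.gradingElt 1, g = l * exp Y := by
  have hZ := D.Ad_gradingElt_sub_mem hg
  set Z := Ad g D.gradingElt - D.gradingElt with hZe
  -- `Ad (exp Z)` subtracts `Z` from `h₀` and fixes `Z`, so it undoes the displacement of `h₀` by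
  -- `g`.
  have h1 : exp Z * g ∈ D.levi := by
    rw [mem_levi, Ad_mul_apply, show Ad g D.gradingElt = D.gradingElt + Z by rw [hZe]; abel,
      map_add, D.Ad_exp_pos_gradingElt hZ, Ad_exp_of_lie_eq_zero (lie_self Z), sub_add_cancel]
  refine ⟨_, h1, Ad (exp Z * g)⁻¹ (-Z), (D.Ad_mem_degSpace (inv_mem h1)).2 (neg_mem hZ), ?_⟩
  rw [exp_conj, exp_neg]
  group

/-- Levi decomposition of `P⁻`. -/
theorem exists_exp_mul_levi {g : G} (hg : g ∈ D.oppParabolic) :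
    ∃ Y ∈ degSpace D.gradingElt (-1), ∃ l ∈ D.levi, g = exp Y * l := by
  have hZ := D.Ad_gradingElt_sub_mem_neg hg
  set Z := Ad g D.gradingElt - D.gradingElt with hZe
  refine ⟨Z, hZ, exp (-Z) * g, ?_, ?_⟩
  · rw [mem_levi, Ad_mul_apply, show Ad g D.gradingElt = D.gradingElt + Z by rw [hZe]; abel,
      map_add, D.Ad_exp_neg_gradingElt (neg_mem hZ),
      Ad_exp_of_lie_eq_zero (by rw [neg_lie, lie_self, neg_zero]), neg_add_cancel_right]
  · rw [exp_neg]
    group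

/-- A vector `w` of rank one in degree `-1`, and a companion `w'` in degree `1`. -/
structure IsRankOnePair (w w' : GroupLieAlgebra (𝓡 n) G) : Prop where
  mem : w ∈ degSpace D.gradingElt (-1)
  mem' : w' ∈ degSpace D.gradingElt 1
  ne_zero : w ≠ 0
  lie_lie : ⁅w, ⁅w, w'⁆⁆ = (-2 : ℝ) • w
  lie_lie' : ⁅w', ⁅w', w⁆⁆ = (-2 : ℝ) • w'
  rank_one : ∀ Y, ∃ c : ℝ, ⁅w, ⁅w, Y⁆⁆ = c • w

theorem isRankOnePair : D.IsRankOnePair D.vMinus D.vPlus where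
  mem := D.vMinus_mem_degSpace
  mem' := D.vPlus_mem_degSpace
  ne_zero := D.vMinus_ne_zero
  lie_lie := D.vMinus_lie_lie_vPlus
  lie_lie' := D.vPlus_lie_lie_vMinus
  rank_one := D.vMinus_rank_one

variable {D}

theorem IsRankOnePair.map {w w' : GroupLieAlgebra (𝓡 n) G} (h : D.IsRankOnePair w w') {g : G}
    (hg : g ∈ D.levi) : D.IsRankOnePair (Ad g w) (Ad g w') where
  mem := (D.Ad_mem_degSpace hg).2 h.mem
  mem' := (D.Ad_mem_degSpace hg).2 h.mem'
  ne_zero := fun h0 => h.ne_zero (by rw [← Ad_inv_apply_Ad g w, h0, map_zero])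
  lie_lie := by rw [← Ad_lie, ← Ad_lie, h.lie_lie, map_smul]
  lie_lie' := by rw [← Ad_lie, ← Ad_lie, h.lie_lie', map_smul]
  rank_one := fun Y => by
    obtain ⟨c, hc⟩ := h.rank_one (Ad g⁻¹ Y)
    refine ⟨c, ?_⟩
    rw [← Ad_apply_Ad_inv g Y, ← Ad_lie, ← Ad_lie, hc, map_smul]

/-- `exp Y` acts on the line `s ↦ exp(s w) P` as the homography `s ↦ s / (1 + μ s)`; the hypothesis
on `s'` is this relation with the denominator cleared. By `exists_expAct_expAct`, the element
comparing the two representatives preserves `𝔲⁺`. -/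
theorem IsRankOnePair.exp_mul_exp {w w' : GroupLieAlgebra (𝓡 n) G} (h : D.IsRankOnePair w w')
    {Y : GroupLieAlgebra (𝓡 n) G} (hY : Y ∈ degSpace D.gradingElt 1) {μ s s' : ℝ}
    (hμ : ⁅w, ⁅w, Y⁆⁆ = (-2 * μ) • w) (hs : s' * (1 + s * μ) = s) :
    ((exp Y * exp (s • w) : G) : D.ShilovBoundary) = ((exp (s' • w) : G) : D.ShilovBoundary) := by
  have hm : ∀ c : ℝ, c • w ∈ degSpace D.gradingElt (-1) := fun c => Submodule.smul_mem _ _ h.mem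
  rw [QuotientGroup.eq]
  refine D.mem_parabolic_of_forall fun U hU => ?_
  obtain ⟨c, hc⟩ := h.rank_one U
  obtain ⟨U', hU', e⟩ := D.isThreeGrading.exists_expAct_expAct h.mem hY hU hμ (ν := -c / 2)
    (by rw [hc]; congr 1; ring) hs
  have : Ad ((exp Y * exp (s • w))⁻¹ * exp (s' • w)) U = U' := by
    rw [mul_inv_rev, ← exp_neg Y, Ad_mul_apply, Ad_mul_apply, D.Ad_exp_neg (hm s'),
      D.Ad_exp_pos (neg_mem hY), e, ← D.Ad_exp_neg (hm s), Ad_inv_apply_Ad]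
  rw [this]
  exact hU'

/-- The points of the photon in direction `w`, seen from its point at infinity. -/
theorem IsRankOnePair.exp_smul_eq {w w' : GroupLieAlgebra (𝓡 n) G} (h : D.IsRankOnePair w w')
    {τ : ℝ} (hτ : τ ≠ 0) : ((exp (τ • w) : G) : D.ShilovBoundary) =
      ((exp ((1 + τ⁻¹) • w') * exp (-w) : G) : D.ShilovBoundary) := by
  -- The homography with `μ = 1 + τ⁻¹` sends `-1` to `-1 / (1 - μ) = τ`.
  have := h.exp_mul_exp (Y := (1 + τ⁻¹) • w') (Submodule.smul_mem _ _ h.mem') (μ := 1 + τ⁻¹)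
    (s := -1) (s' := τ) (by rw [lie_smul, lie_smul, h.lie_lie, smul_smul]; congr 1; ring)
    (by field_simp; ring)
  rw [← this, neg_one_smul]

/-- The product represents a quarter turn in the `SL₂` of the pair, up to an element of the upper
triangular group; it exchanges the two nilpotent directions. -/
theorem IsRankOnePair.Ad_infty {w w' : GroupLieAlgebra (𝓡 n) G} (h : D.IsRankOnePair w w') :
    Ad (exp w' * exp (-w) : G) w' = -w := by
  rw [Ad_mul_apply, D.Ad_exp_neg (neg_mem h.mem), D.Ad_exp_pos h.mem']
  have e1 : ⁅w', w⁆ = -⁅w, w'⁆ := (lie_skew w' w).symm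
  have e2 := h.lie_lie'
  rw [e1, lie_neg] at e2
  have e2' : ⁅w', ⁅w, w'⁆⁆ = (2 : ℝ) • w' := by
    rw [← neg_eq_iff_eq_neg.2 (e2.trans (neg_smul _ _))]
    rw [neg_neg]
  simp only [expAct, neg_lie, lie_neg, lie_add, lie_smul, h.lie_lie, e1, e2', lie_self, neg_neg, lie_zero]
  module

/-- The point at infinity of a photon is not opposite. -/
theorem IsRankOnePair.infty_ne {w w' Z : GroupLieAlgebra (𝓡 n) G} (h : D.IsRankOnePair w w')
    (hZ : Z ∈ degSpace D.gradingElt (-1)) :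
    ((exp w' * exp (-w) : G) : D.ShilovBoundary) ≠ ((exp Z : G) : D.ShilovBoundary) := by
  intro he
  rw [eq_comm, QuotientGroup.eq, mem_parabolic_iff] at he
  -- Equality of the cosets would make `exp(-Z) exp(w') exp(-w)` preserve `𝔲⁺`. But it sends `w'` to
  -- `-w`, which `exp(-Z)` fixes and which has degree `-1`.
  have h1 := (he w').2 h.mem'
  rw [Ad_mul_apply, h.Ad_infty, ← exp_neg, Ad_exp_of_lie_eq_zero] at h1
  · exact h.ne_zero (neg_eq_zero.1 (eq_zero_of_mem_degSpace (by norm_num) h1 (neg_mem h.mem)))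
  · exact D.isThreeGrading.lie_eq_zero_of_neg (neg_mem hZ) (neg_mem h.mem)

variable (D)

/-- A vector of rank one in degree `-1` has a companion proportional to `σ w`. -/
theorem isRankOnePair_σ {w : GroupLieAlgebra (𝓡 n) G} {c : ℝ}
    (hw : w ∈ degSpace D.gradingElt (-1)) (h0 : w ≠ 0) (hr : ∀ Y, ∃ c : ℝ, ⁅w, ⁅w, Y⁆⁆ = c • w)
    (hc : ⁅w, ⁅w, D.σ w⁆⁆ = c • w) : D.IsRankOnePair w ((-2 / c) • D.σ w) := by
  have hc0 : c ≠ 0 := by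
    rintro rfl
    rw [zero_smul] at hc
    exact D.lie_lie_σ_ne_zero hw h0 hc
  have hc' : ⁅D.σ w, ⁅D.σ w, w⁆⁆ = c • D.σ w := by
    rw [← map_smul, ← hc, D.σ_lie, D.σ_lie, D.σ_σ]
  refine ⟨hw, Submodule.smul_mem _ _ ?_, h0, ?_, ?_, hr⟩
  · have := (map_mem_degSpace D.σ).2 hw
    rw [D.σ_gradingElt, degSpace_neg, neg_neg] at this
    exact this
  · rw [lie_smul, lie_smul, hc, smul_smul, div_mul_cancel₀ _ hc0]
  · rw [smul_lie, smul_lie, lie_smul, hc']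
    simp only [smul_smul]
    congr 1
    field_simp

end Orbits

end HTTData

/-! ### Transversality for automorphisms near the identity -/

section Transversality

variable {𝔤 : Type*} [LieRing 𝔤] [LieAlgebra ℝ 𝔤] {h : 𝔤} (hh : IsThreeGrading h)
  (φ : 𝔤 ≃ₗ⁅ℝ⁆ 𝔤)

include hh

/-- The operator is the identity in degrees `-1`, `0` and `φ` in degree `1`. It carries the
splitting of `𝔤` into degree `1` and degrees `≤ 0` to the two subspaces of the conclusion, so
bijectivity is complementarity. The hypothesis is open in `φ` and holds for the identity. -/
theorem IsThreeGrading.isCompl_pos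
    (hM : Function.Bijective fun X => X - projPos h X + φ (projPos h X)) :
    IsCompl (degSpace (φ h) 1) (nonnegSpace (-h)) := by
  rw [isCompl_iff, Submodule.disjoint_def, codisjoint_iff, eq_top_iff]
  constructor
  · intro Z hZ hZ'
    obtain ⟨X, rfl⟩ := φ.surjective Z
    have hX : X ∈ degSpace h 1 := (map_mem_degSpace φ).1 hZ
    have hZ' : projPos h (φ X) = 0 := mem_nonnegSpace_neg_iff.1 hZ'
    have e : X = φ X := hM.1 (by
      change X - projPos h X + φ (projPos h X) = φ X - projPos h (φ X) + φ (projPos h (φ X))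
      rw [projPos_eq_self hX, hZ', map_zero, sub_self, zero_add, sub_zero, add_zero])
    change φ X = 0
    rw [← e, projPos_eq_self hX] at hZ'
    rw [← e, hZ']
  · intro Z _
    obtain ⟨X, rfl⟩ := hM.2 Z
    refine Submodule.mem_sup.2 ⟨_, (map_mem_degSpace φ).2 (hh.projPos_mem X), _, ?_, add_comm _ _⟩
    rw [mem_nonnegSpace_neg_iff, map_sub, projPos_eq_self (hh.projPos_mem X), sub_self]

theorem IsThreeGrading.isCompl_neg
    (hM : Function.Bijective fun X => projNeg h X + φ (X - projNeg h X)) :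
    IsCompl (nonnegSpace (φ h)) (degSpace (-h) 1) := by
  rw [isCompl_iff, Submodule.disjoint_def, codisjoint_iff, eq_top_iff, degSpace_neg]
  constructor
  · intro Z hZ hZ'
    obtain ⟨X, rfl⟩ := φ.surjective Z
    have hX : X ∈ nonnegSpace h := (map_mem_nonnegSpace φ).1 hZ
    rw [mem_nonnegSpace_iff] at hX
    have e : X = φ X := hM.1 (by
      change projNeg h X + φ (X - projNeg h X) = projNeg h (φ X) + φ (φ X - projNeg h (φ X))
      have hZ2 : projNeg h (φ X) = φ X := projNeg_eq_self hZ'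
      rw [hX, hZ2, sub_self, map_zero, sub_zero, zero_add, add_zero])
    have hZ2 : projNeg h (φ X) = φ X := projNeg_eq_self hZ'
    rw [← e, hX] at hZ2
    change φ X = 0
    rw [← e, hZ2]
  · intro Z _
    obtain ⟨X, rfl⟩ := hM.2 Z
    refine Submodule.mem_sup.2 ⟨_, (map_mem_nonnegSpace φ).2 ?_, _, hh.projNeg_mem X, add_comm _ _⟩
    rw [mem_nonnegSpace_iff, map_sub, projNeg_eq_self (hh.projNeg_mem X), sub_self]

/-- The common grading element is both `h + y` and `φ (h + Y)`. The last two identities recover `y`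
by solving a linear equation with unknown `Y - y`, which will show that `y` depends continuously on
`φ`. -/
theorem IsThreeGrading.exists_add_eq_map_add [LieAlgebra.IsKilling ℝ 𝔤] [FiniteDimensional ℝ 𝔤]
    (hM : Function.Bijective fun X => X - projPos h X + φ (projPos h X))
    (hM' : Function.Bijective fun X => projNeg h X + φ (X - projNeg h X)) :
    ∃ y ∈ degSpace h (-1), ∃ Y ∈ degSpace h 1, h + y = φ (h + Y) ∧
      (Y - y) - projPos h (Y - y) + φ (projPos h (Y - y)) = h - φ h ∧ y = -projNeg h (Y - y) := by
  obtain ⟨E, h1, h2⟩ := hh.neg.exists_common_grading (hh.map φ) (hh.isCompl_pos φ hM)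
    (hh.isCompl_neg φ hM')
  obtain ⟨Y, hY⟩ := φ.surjective (E - φ h)
  have hY' : φ Y = E - φ h := hY
  rw [← hY', map_mem_degSpace] at h1
  have hy : E - h ∈ degSpace h (-1) := by
    rw [degSpace_neg, ← neg_mem_iff] at h2
    convert h2 using 1
    abel
  refine ⟨E - h, hy, Y, h1, ?_, ?_, ?_⟩
  · rw [map_add, hY']
    abel
  · rw [map_sub, projPos_eq_self h1, projPos_eq_zero_of_mem_neg hy, sub_zero, hY']
    abel
  · rw [map_sub, projNeg_eq_self hy, projNeg_eq_zero_of_mem_pos h1]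
    abel

end Transversality

/-! ### The affine chart of the Shilov boundary -/

namespace HTTData

section Chart

open LieGrp

variable {n : ℕ} {G : Type*} [TopologicalSpace G] [ChartedSpace (EuclideanSpace ℝ (Fin n)) G]
  [Group G] [LieGroup (𝓡 n) ∞ G] (D : HTTData (GroupLieAlgebra (𝓡 n) G))

/-- The abelian subalgebra `𝔲⁻`, as a subspace of a normed space. -/
def negSpace : Submodule ℝ (EuclideanSpace ℝ (Fin n)) :=
  (degSpace D.gradingElt (-1) : Submodule ℝ (GroupLieAlgebra (𝓡 n) G))

/-- The underlying element of the Lie algebra. -/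
def toLie (X : D.negSpace) : GroupLieAlgebra (𝓡 n) G := (X : EuclideanSpace ℝ (Fin n))

theorem toLie_mem (X : D.negSpace) : D.toLie X ∈ degSpace D.gradingElt (-1) := X.2

theorem toLie_add (X Y : D.negSpace) : D.toLie (X + Y) = D.toLie X + D.toLie Y := rfl

theorem toLie_neg (X : D.negSpace) : D.toLie (-X) = -D.toLie X := rfl

theorem toLie_zero : D.toLie 0 = 0 := rfl

theorem toLie_injective : Function.Injective D.toLie := fun _ _ h => Subtype.ext h

/-- The exponential chart of the Shilov boundary. -/
def expChart (X : D.negSpace) : D.ShilovBoundary := ((exp (D.toLie X) : G) : D.ShilovBoundary)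

theorem exp_toLie_add (X Y : D.negSpace) :
    (exp (D.toLie (X + Y)) : G) = exp (D.toLie X) * exp (D.toLie Y) := by
  rw [toLie_add]
  exact exp_add_of_lie_eq_zero (D.isThreeGrading.lie_eq_zero_of_neg (D.toLie_mem X) (D.toLie_mem Y))

theorem expChart_add (X Y : D.negSpace) :
    D.expChart (X + Y) = (exp (D.toLie X) : G) • D.expChart Y := by
  rw [expChart, exp_toLie_add]
  rfl

theorem continuous_exp_toLie : Continuous fun X : D.negSpace => (exp (D.toLie X) : G) :=
  continuous_exp_of_abelian (degSpace D.gradingElt (-1))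
    (fun _ hX _ hY => D.isThreeGrading.lie_eq_zero_of_neg hX hY)

theorem continuous_expChart : Continuous D.expChart :=
  continuous_quotient_mk'.comp D.continuous_exp_toLie

/-- An element of `P` moves `h₀` by an element of degree `1`, whereas `exp Z` with `Z` of degree
`-1` moves it by `Z`; so `exp 𝔲⁻` meets `P` only trivially. -/
theorem expChart_injective : Function.Injective D.expChart := by
  intro X Y h
  rw [expChart, expChart, QuotientGroup.eq, ← exp_neg, ← toLie_neg, ← exp_toLie_add] at h
  have h1 := D.Ad_gradingElt_sub_mem h
  rw [D.Ad_exp_neg_gradingElt (D.toLie_mem _), add_sub_cancel_left] at h1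
  have h2 : D.toLie (-X + Y) = D.toLie 0 :=
    eq_zero_of_mem_degSpace (by norm_num) h1 (D.toLie_mem _)
  have h3 := D.toLie_injective h2
  rwa [neg_add_eq_zero] at h3

theorem exists_expChart_eq {g : G}
    (hM : Function.Bijective fun X => X - projPos D.gradingElt X + Ad g (projPos D.gradingElt X))
    (hM' : Function.Bijective fun X => projNeg D.gradingElt X + Ad g (X - projNeg D.gradingElt X)) :
    ∃ (y : D.negSpace) (Z : GroupLieAlgebra (𝓡 n) G), (g : D.ShilovBoundary) = D.expChart y ∧
      Z - projPos D.gradingElt Z + Ad g (projPos D.gradingElt Z) =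
        D.gradingElt - Ad g D.gradingElt ∧ D.toLie y = -projNeg D.gradingElt Z := by
  have := D.isKilling
  obtain ⟨y, hy, Y, hY, e1, e2, e3⟩ :=
    D.isThreeGrading.exists_add_eq_map_add (adEquiv g) hM hM'
  refine ⟨⟨y, hy⟩, Y - y, ?_, e2, e3⟩
  -- `h₀ + y = Ad (exp y) h₀` and `h₀ + Y = Ad (exp (-Y)) h₀`, so the common grading says that this
  -- product fixes `h₀`.
  have hl : (exp y)⁻¹ * g * exp (-Y) ∈ D.levi := by
    rw [mem_levi, Ad_mul_apply, Ad_mul_apply, D.Ad_exp_pos_gradingElt (neg_mem hY), sub_neg_eq_add]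
    have e1' : Ad g (D.gradingElt + Y) = D.gradingElt + y := e1.symm
    rw [e1', ← D.Ad_exp_neg_gradingElt hy, Ad_inv_apply_Ad]
  have hp := mul_mem (D.levi_le_parabolic hl) (D.exp_mem_parabolic hY)
  have : (exp y)⁻¹ * g * exp (-Y) * exp Y = (exp y)⁻¹ * g := by
    rw [exp_neg]
    group
  rw [this] at hp
  exact (QuotientGroup.eq.2 hp).symm

/-- The grading element, as a vector of the model space. -/
def gradingVec : EuclideanSpace ℝ (Fin n) := D.gradingElt

/-- The projections of the grading, as continuous operators. -/
def posOp : EuclideanSpace ℝ (Fin n) →L[ℝ] EuclideanSpace ℝ (Fin n) :=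
  LinearMap.toContinuousLinearMap (E := EuclideanSpace ℝ (Fin n)) (F' := EuclideanSpace ℝ (Fin n))
    (projPos (D.gradingElt))

/-- The projection to degree `-1`, as a continuous operator. -/
def negOp : EuclideanSpace ℝ (Fin n) →L[ℝ] EuclideanSpace ℝ (Fin n) :=
  LinearMap.toContinuousLinearMap (E := EuclideanSpace ℝ (Fin n)) (F' := EuclideanSpace ℝ (Fin n))
    (projNeg (D.gradingElt))

/-- The operator `X₋₁ + X₀ + X₁ ↦ X₋₁ + X₀ + Ad g X₁`. -/
def chartOp (g : G) : EuclideanSpace ℝ (Fin n) →L[ℝ] EuclideanSpace ℝ (Fin n) :=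
  1 - D.posOp + adOp (n := n) g * D.posOp

/-- The operator `X₋₁ + X₀ + X₁ ↦ X₋₁ + Ad g (X₀ + X₁)`. -/
def chartOp' (g : G) : EuclideanSpace ℝ (Fin n) →L[ℝ] EuclideanSpace ℝ (Fin n) :=
  D.negOp + adOp (n := n) g * (1 - D.negOp)

theorem continuous_chartOp : Continuous D.chartOp := by
  have := continuous_adOp (n := n) (G := G)
  unfold chartOp
  fun_prop

theorem continuous_chartOp' : Continuous D.chartOp' := by
  have := continuous_adOp (n := n) (G := G)
  unfold chartOp'
  fun_prop

theorem chartOp_one : D.chartOp 1 = 1 := by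
  rw [chartOp, adOp_one, one_mul, sub_add_cancel]

theorem chartOp'_one : D.chartOp' 1 = 1 := by
  rw [chartOp', adOp_one, one_mul, add_sub_cancel]

theorem eventually_isUnit {A : Type*} [NormedRing A] [HasSummableGeomSeries A] {T : G → A}
    (hT : Continuous T) (h1 : T 1 = 1) : ∀ᶠ g in 𝓝 (1 : G), IsUnit (T g) := by
  have h2 : {a : A | IsUnit a} ∈ 𝓝 (T 1) := by
    rw [h1]
    exact Units.isOpen.mem_nhds isUnit_one
  exact hT.continuousAt h2

theorem bijective_of_isUnit {T : EuclideanSpace ℝ (Fin n) →L[ℝ] EuclideanSpace ℝ (Fin n)}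
    (hT : IsUnit T) : Function.Bijective T := by
  obtain ⟨u, rfl⟩ := hT
  exact (ContinuousLinearEquiv.unitsEquiv ℝ _ u).bijective

/-- Near the identity, `gP` is in the chart, with coordinates close to `0`. -/
theorem eventually_mem_expChart {S : Set D.negSpace} (hS : S ∈ 𝓝 0) :
    ∀ᶠ g : G in 𝓝 (1 : G), (g : D.ShilovBoundary) ∈ D.expChart '' S := by
  -- The coordinate of `gP` obtained from the linear equation of `exists_expChart_eq`. Writing it
  -- with `Ring.inverse` makes its continuity at `1` visible.
  let y : G → EuclideanSpace ℝ (Fin n) := fun g =>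
    -D.negOp (Ring.inverse (D.chartOp g)
      (D.gradingVec - adOp (n := n) g D.gradingVec))
  have hy0 : y 1 = 0 := by
    simp only [y]
    rw [adOp_one]
    change -D.negOp (Ring.inverse (D.chartOp 1)
      (D.gradingVec - D.gradingVec)) = 0
    rw [sub_self, map_zero, map_zero, neg_zero]
  have hy : ContinuousAt y 1 := by
    have h1 : ContinuousAt (fun g => Ring.inverse (D.chartOp g)) 1 := by
      have h2 : ContinuousAt Ring.inverse (D.chartOp 1) := by
        rw [D.chartOp_one]
        exact NormedRing.inverse_continuousAt 1
      exact h2.comp (f := D.chartOp) D.continuous_chartOp.continuousAt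
    have h3 := (continuous_adOp (n := n) (G := G)).continuousAt (x := (1 : G))
    have h4 : ContinuousAt (fun g : G => D.gradingVec -
        adOp (n := n) g D.gradingVec) 1 :=
      continuousAt_const.sub (h3.clm_apply continuousAt_const)
    exact (D.negOp.continuous.continuousAt.comp (h1.clm_apply h4)).neg
  obtain ⟨U, hU, hUS⟩ := mem_nhds_subtype _ _ _ |>.1 hS
  have h5 : ∀ᶠ g in 𝓝 (1 : G), y g ∈ U := by
    refine hy ?_
    rw [hy0]
    exact hU
  filter_upwards [h5, eventually_isUnit D.continuous_chartOp D.chartOp_one,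
    eventually_isUnit D.continuous_chartOp' D.chartOp'_one] with g hg h6 h7
  obtain ⟨Y, Z, e1, e2, e3⟩ := D.exists_expChart_eq (g := g) (bijective_of_isUnit h6)
    (bijective_of_isUnit h7)
  refine ⟨Y, hUS ?_, e1.symm⟩
  have e4 : D.chartOp g Z = D.gradingVec -
    adOp (n := n) g D.gradingVec := e2
  have e5 : Ring.inverse (D.chartOp g) (D.chartOp g Z) = Z := by
    change (Ring.inverse (D.chartOp g) * D.chartOp g) Z = Z
    rw [Ring.inverse_mul_cancel _ h6]
    rfl
  have e6 : (Y : EuclideanSpace ℝ (Fin n)) = y g := by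
    simp only [y]
    rw [← e4, e5]
    exact e3
  change (Y : EuclideanSpace ℝ (Fin n)) ∈ U
  rw [e6]
  exact hg

/-- Openness at `0` is the previous statement pushed to the quotient, whose projection is open. The
chart intertwines addition of `X` with the action of `exp X`, which moves `0` to any point. -/
theorem isOpenEmbedding_expChart : IsOpenEmbedding D.expChart := by
  have := isTopologicalGroup n G
  refine IsOpenEmbedding.of_continuous_injective_isOpenMap D.continuous_expChart
    D.expChart_injective ?_
  rw [isOpenMap_iff_nhds_le]
  intro X
  have h0 : 𝓝 (D.expChart 0) ≤ Filter.map D.expChart (𝓝 0) := by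
    intro S hS
    have h1 := D.eventually_mem_expChart hS
    have h2 : D.expChart 0 = ((1 : G) : D.ShilovBoundary) := by
      rw [expChart, toLie_zero, exp_zero]
    rw [h2]
    have h3 := (QuotientGroup.isOpenMap_coe (N := D.parabolic)).image_mem_nhds h1
    refine Filter.mem_of_superset h3 ?_
    rintro _ ⟨g, ⟨Y, hY, hg⟩, rfl⟩
    rw [← hg]
    exact hY
  have h1 : D.expChart ∘ (fun Y => X + Y) = (fun x => (exp (D.toLie X) : G) • x) ∘ D.expChart :=
    funext fun Y => D.expChart_add X Y
  have h2 : Filter.map (fun Y => X + Y) (𝓝 0) = 𝓝 X := by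
    simp
  have h3 : D.expChart X = (exp (D.toLie X) : G) • D.expChart 0 := by
    rw [← D.expChart_add, add_zero]
  rw [← h2, Filter.map_map, h1, ← Filter.map_map, h3]
  have h4 := (Homeomorph.smul (α := D.ShilovBoundary) (exp (D.toLie X) : G)).map_nhds_eq (D.expChart 0)
  exact h4.symm.le.trans (Filter.map_mono h0)

/-- The chart translated by `g`. -/
def chartAt (g : G) (X : D.negSpace) : D.ShilovBoundary := g • D.expChart X

theorem isOpenEmbedding_chartAt (g : G) : IsOpenEmbedding (D.chartAt g) := by
  have := isTopologicalGroup n G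
  exact (Homeomorph.smul g).isOpenEmbedding.comp D.isOpenEmbedding_expChart

/-- Because `P⁻ = exp(𝔲⁻) L` and `L ⊆ P`, the points transverse to `g P⁻` are the points of the
chart translated by `g`. -/
theorem exists_of_transverse {g : G} {x : D.ShilovBoundary}
    (hx : D.Transverse x (g : D.OppShilovBoundary)) : x ∈ range (D.chartAt g) := by
  obtain ⟨k, rfl, hk⟩ := hx
  obtain ⟨Y, hY, l, hl, e⟩ := D.exists_exp_mul_levi (QuotientGroup.eq.1 hk)
  refine ⟨⟨Y, hY⟩, ?_⟩
  change ((g * exp Y : G) : D.ShilovBoundary) = k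
  rw [QuotientGroup.eq]
  have : (g * exp Y)⁻¹ * k = l := by
    rw [mul_inv_rev, mul_assoc, e]
    group
  rw [this]
  exact D.levi_le_parabolic hl

/-- The closure of a proper set is contained in a chart. -/
theorem IsProperSet.exists_closure_subset {D : HTTData (GroupLieAlgebra (𝓡 n) G)}
    {Ω : Set D.ShilovBoundary} (hΩ : D.IsProperSet Ω) :
    ∃ g, closure Ω ⊆ range (D.chartAt g) := by
  obtain ⟨ξ, hξ⟩ := hΩ
  obtain ⟨g, rfl⟩ := QuotientGroup.mk_surjective ξ
  refine ⟨g, fun x hx => D.exists_of_transverse ?_⟩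
  by_contra h
  have : x ∈ closure Ω ∩ D.nonTransverse (g : D.OppShilovBoundary) := ⟨hx, h⟩
  rw [hξ] at this
  exact this

end Chart

end HTTData

/-! ### Homographies of the projective line -/

namespace ProjLine

/-- The translation `t ↦ t + c` of the projective line. -/
def translation (c : ℝ) : OnePoint ℝ ≃ₜ OnePoint ℝ := (Homeomorph.addRight c).onePointCongr

theorem translation_coe (c t : ℝ) : translation c (t : OnePoint ℝ) = ((t + c : ℝ) : OnePoint ℝ) := rfl

theorem translation_infty (c : ℝ) : translation c OnePoint.infty = OnePoint.infty := rfl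

/-- The map `t ↦ 1 / t` of the projective line. -/
def invFun : OnePoint ℝ → OnePoint ℝ
  | OnePoint.infty => ((0 : ℝ) : OnePoint ℝ)
  | OnePoint.some t => if t = 0 then OnePoint.infty else ((t⁻¹ : ℝ) : OnePoint ℝ)

theorem invFun_infty : invFun OnePoint.infty = ((0 : ℝ) : OnePoint ℝ) := rfl

theorem invFun_zero : invFun ((0 : ℝ) : OnePoint ℝ) = OnePoint.infty := if_pos rfl

theorem invFun_coe {t : ℝ} (ht : t ≠ 0) : invFun (t : OnePoint ℝ) = ((t⁻¹ : ℝ) : OnePoint ℝ) :=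
  if_neg ht

theorem invFun_invFun (s : OnePoint ℝ) : invFun (invFun s) = s := by
  induction s using OnePoint.rec with
  | infty => rw [invFun_infty, invFun_zero]
  | coe t =>
    rcases eq_or_ne t 0 with rfl | ht
    · rw [invFun_zero, invFun_infty]
    · rw [invFun_coe ht, invFun_coe (inv_ne_zero ht), inv_inv]

theorem continuous_invFun : Continuous invFun := by
  have hc : Filter.coclosedCompact ℝ = Bornology.cobounded ℝ := by
    rw [Filter.coclosedCompact_eq_cocompact, Metric.cobounded_eq_cocompact]
  refine continuous_iff_continuousAt.2 fun s => ?_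
  induction s using OnePoint.rec with
  | infty =>
    rw [OnePoint.continuousAt_infty', hc]
    have h1 : Filter.Tendsto (fun t : ℝ => ((t⁻¹ : ℝ) : OnePoint ℝ)) (Bornology.cobounded ℝ)
        (𝓝 ((0 : ℝ) : OnePoint ℝ)) :=
      (OnePoint.continuous_coe.tendsto 0).comp Filter.tendsto_inv₀_cobounded
    refine h1.congr' ?_
    filter_upwards [Bornology.isBounded_def.1 (Bornology.isBounded_singleton (x := (0 : ℝ)))] with t ht
    exact (invFun_coe ht).symm
  | coe t =>
    rw [OnePoint.continuousAt_coe]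
    rcases eq_or_ne t 0 with rfl | ht
    · rw [continuousAt_iff_punctured_nhds]
      change Filter.Tendsto _ _ (𝓝 (invFun ((0 : ℝ) : OnePoint ℝ)))
      rw [invFun_zero]
      have h1 : Filter.Tendsto (fun t : ℝ => ((t⁻¹ : ℝ) : OnePoint ℝ)) (𝓝[≠] 0)
          (𝓝 OnePoint.infty) := by
        refine OnePoint.tendsto_coe_infty.comp ?_
        rw [hc]
        exact Filter.tendsto_inv₀_nhdsNE_zero
      refine h1.congr' ?_
      filter_upwards [self_mem_nhdsWithin] with t ht
      exact (invFun_coe ht).symm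
    · have h1 : ContinuousAt (fun t : ℝ => ((t⁻¹ : ℝ) : OnePoint ℝ)) t :=
        OnePoint.continuous_coe.continuousAt.comp (continuousAt_inv₀ ht)
      refine h1.congr ?_
      filter_upwards [isOpen_ne.mem_nhds ht] with u hu
      exact (invFun_coe hu).symm

/-- The involution `t ↦ 1 / t` of the projective line. -/
def inversion : OnePoint ℝ ≃ₜ OnePoint ℝ where
  toFun := invFun
  invFun := invFun
  left_inv := invFun_invFun
  right_inv := invFun_invFun
  continuous_toFun := continuous_invFun
  continuous_invFun := continuous_invFun

/-- The map `t ↦ t / (1 + μ t)` of the projective line. -/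
def shear (μ : ℝ) : OnePoint ℝ ≃ₜ OnePoint ℝ := (inversion.trans (translation μ)).trans inversion

theorem shear_apply (μ : ℝ) (s : OnePoint ℝ) : shear μ s = invFun (translation μ (invFun s)) := rfl

/-- A homeomorphism of the projective line that preserves the cross ratio. -/
def IsMoebius (m : OnePoint ℝ ≃ₜ OnePoint ℝ) : Prop :=
  ∀ a b c d, crossRatio (m a) (m b) (m c) (m d) = crossRatio a b c d

theorem IsMoebius.trans {m m' : OnePoint ℝ ≃ₜ OnePoint ℝ} (h : IsMoebius m) (h' : IsMoebius m') :
    IsMoebius (m.trans m') := fun a b c d => by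
  rw [← h a b c d, ← h' (m a)]
  rfl

theorem isMoebius_translate (c : ℝ) : IsMoebius (translation c) := by
  have hd : ∀ a b, det (translation c a) (translation c b) = det a b := by
    intro a b
    induction a using OnePoint.rec with
    | infty =>
      induction b using OnePoint.rec with
      | infty => rfl
      | coe t => simp [translation_coe, translation_infty, det, lift]
    | coe s =>
      induction b using OnePoint.rec with
      | infty => simp [translation_coe, translation_infty, det, lift]
      | coe t => simp [translation_coe, det, lift]
  intro p q r s
  simp only [crossRatio, hd]

/-- The factor by which the inversion changes the lifts. -/
def invFactor : OnePoint ℝ → ℝ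
  | OnePoint.infty => 1
  | OnePoint.some t => if t = 0 then 1 else t⁻¹

theorem invFactor_ne_zero (a : OnePoint ℝ) : invFactor a ≠ 0 := by
  induction a using OnePoint.rec with
  | infty => exact one_ne_zero
  | coe t =>
    change (if t = 0 then 1 else t⁻¹) ≠ 0
    split_ifs with h
    · exact one_ne_zero
    · exact inv_ne_zero h

theorem lift_invFun (a : OnePoint ℝ) :
    lift (invFun a) = (invFactor a * (lift a).2, invFactor a * (lift a).1) := by
  induction a using OnePoint.rec with
  | infty => simp [invFun_infty, lift, invFactor]
  | coe t =>
    rcases eq_or_ne t 0 with rfl | ht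
    · simp [invFun_zero, lift, invFactor]
    · rw [invFun_coe ht]
      simp [lift, invFactor, ht]

/-- Inversion swaps the coordinates of a lift up to a factor. Each point occurs once in the
numerator and once in the denominator of the cross ratio, so the factors cancel. -/
theorem isMoebius_inversion : IsMoebius inversion := by
  have hd : ∀ a b, det (inversion a) (inversion b) = -(invFactor a * invFactor b) * det a b := by
    intro a b
    change det (invFun a) (invFun b) = _
    rw [det, lift_invFun, lift_invFun, det]
    ring
  intro p q r s
  simp only [crossRatio, hd]
  rw [← mul_div_mul_left (det p r * det q s) (det p q * det r s)
    (mul_ne_zero (mul_ne_zero (invFactor_ne_zero p) (invFactor_ne_zero q))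
      (mul_ne_zero (invFactor_ne_zero r) (invFactor_ne_zero s)))]
  congr 1 <;> ring

theorem isMoebius_shear (μ : ℝ) : IsMoebius (shear μ) :=
  (isMoebius_inversion.trans (isMoebius_translate μ)).trans isMoebius_inversion

end ProjLine

/-! ### Photons are affine lines of the chart -/

namespace HTTData

section Photons

open LieGrp ProjLine

variable {n : ℕ} {G : Type*} [TopologicalSpace G] [ChartedSpace (EuclideanSpace ℝ (Fin n)) G]
  [Group G] [LieGroup (𝓡 n) ∞ G] (D : HTTData (GroupLieAlgebra (𝓡 n) G))

theorem stdPhoton_coe (t : ℝ) :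
    D.stdPhoton (t : OnePoint ℝ) = ((exp (t • D.vMinus) : G) : D.ShilovBoundary) := rfl

theorem stdPhoton_infty : D.stdPhoton OnePoint.infty =
    ((exp D.vPlus * exp (-D.vMinus) : G) : D.ShilovBoundary) := rfl

/-- At finite points exponents add. At infinity, conjugation by `exp(v⁺) exp(-v⁻)` turns `c v⁻` into
`-c v⁺`, whose exponential lies in `P`, so the point is fixed. -/
theorem exp_smul_stdPhoton (c : ℝ) (s : OnePoint ℝ) :
    (exp (c • D.vMinus) : G) • D.stdPhoton s = D.stdPhoton (translation c s) := by
  induction s using OnePoint.rec with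
  | infty =>
    rw [translation_infty, stdPhoton_infty]
    change ((exp (c • D.vMinus) * (exp D.vPlus * exp (-D.vMinus)) : G) : D.ShilovBoundary) = _
    rw [eq_comm, QuotientGroup.eq]
    have h1 := D.isRankOnePair
    have h2 : (exp D.vPlus * exp (-D.vMinus))⁻¹ *
        (exp (c • D.vMinus) * (exp D.vPlus * exp (-D.vMinus))) =
        exp (Ad (exp D.vPlus * exp (-D.vMinus))⁻¹ (c • D.vMinus)) := by
      rw [exp_conj]
      group
    have h3 : Ad (exp D.vPlus * exp (-D.vMinus) : G)⁻¹ (c • D.vMinus) = (-c) • D.vPlus := by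
      have := congrArg (Ad (exp D.vPlus * exp (-D.vMinus) : G)⁻¹) h1.Ad_infty
      rw [Ad_inv_apply_Ad, map_neg] at this
      rw [map_smul, ← neg_eq_iff_eq_neg.2 this]
      module
    rw [h2, h3]
    exact D.exp_mem_parabolic (Submodule.smul_mem _ _ D.vPlus_mem_degSpace)
  | coe t =>
    rw [translation_coe, stdPhoton_coe, stdPhoton_coe, add_comm, exp_add_smul]
    rfl

/-- Infinity is `exp(v⁺)` applied to the point of parameter `-1`, so its image is `exp(Y + v⁺)`
applied to that finite point, and the rank one formula applies with `μ + 1`, unless `μ = 0`. -/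
theorem exp_smul_stdPhoton_infty {Y : GroupLieAlgebra (𝓡 n) G} (hY : Y ∈ degSpace D.gradingElt 1)
    {μ : ℝ} (hμ : ⁅D.vMinus, ⁅D.vMinus, Y⁆⁆ = (-2 * μ) • D.vMinus) :
    (exp Y : G) • D.stdPhoton OnePoint.infty = D.stdPhoton (invFun (μ : OnePoint ℝ)) := by
  have h1 := D.isRankOnePair
  have h2 : ∀ Z ∈ degSpace D.gradingElt 1, (exp (Y + Z) : G) = exp Y * exp Z := fun Z hZ =>
    exp_add_of_lie_eq_zero (D.isThreeGrading.lie_eq_zero_of_pos hY hZ)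
  have h3 : (exp Y : G) • D.stdPhoton OnePoint.infty =
      ((exp (Y + D.vPlus) * exp (-D.vMinus) : G) : D.ShilovBoundary) := by
    rw [h2 _ h1.mem', mul_assoc]
    rfl
  rcases eq_or_ne μ 0 with rfl | hμ0
  · rw [invFun_zero, h3, add_comm, exp_add_of_lie_eq_zero
      (D.isThreeGrading.lie_eq_zero_of_pos h1.mem' hY), mul_assoc, stdPhoton_infty]
    have h4 := h1.exp_mul_exp hY hμ (s := -1) (s' := -1) (by ring)
    rw [neg_one_smul] at h4
    change (exp D.vPlus : G) • ((exp Y * exp (-D.vMinus) : G) : D.ShilovBoundary) = _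
    rw [h4]
    rfl
  · rw [invFun_coe hμ0, h3, stdPhoton_coe]
    rw [← h1.exp_mul_exp (Y := Y + D.vPlus) (add_mem hY h1.mem') (μ := μ + 1) (s := -1)
      (s' := μ⁻¹) (by rw [lie_add, lie_add, hμ, h1.lie_lie]; module) (by field_simp; ring),
      neg_one_smul]

theorem exp_smul_stdPhoton_shear {Y : GroupLieAlgebra (𝓡 n) G} (hY : Y ∈ degSpace D.gradingElt 1)
    {μ : ℝ} (hμ : ⁅D.vMinus, ⁅D.vMinus, Y⁆⁆ = (-2 * μ) • D.vMinus) (s : OnePoint ℝ) :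
    (exp Y : G) • D.stdPhoton s = D.stdPhoton (shear μ s) := by
  have h1 := D.isRankOnePair
  rw [shear_apply]
  induction s using OnePoint.rec with
  | infty =>
    rw [invFun_infty, translation_coe, zero_add]
    exact D.exp_smul_stdPhoton_infty hY hμ
  | coe t =>
    rcases eq_or_ne t 0 with rfl | ht
    · rw [invFun_zero, translation_infty, invFun_infty, stdPhoton_coe, zero_smul, exp_zero]
      have h4 := h1.exp_mul_exp hY hμ (s := 0) (s' := 0) (by ring)
      rw [zero_smul, exp_zero] at h4
      exact h4
    · rw [invFun_coe ht, translation_coe]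
      by_cases h0 : t⁻¹ + μ = 0
      · rw [h0, invFun_zero]
        -- The pole `t = -1/μ`: the point sent to infinity is the image of infinity under `exp(-Y)`.
        have h5 := D.exp_smul_stdPhoton_infty (neg_mem hY) (μ := -μ) (by
          rw [lie_neg, lie_neg, hμ]
          module)
        have h6 : -μ = t⁻¹ := by linarith
        rw [h6, invFun_coe (inv_ne_zero ht), inv_inv, exp_neg, inv_smul_eq_iff] at h5
        exact h5.symm
      · rw [invFun_coe h0, stdPhoton_coe, stdPhoton_coe]
        have h7 : 1 + t * μ = (t⁻¹ + μ) * t := by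
          field_simp
        exact h1.exp_mul_exp hY hμ (by rw [h7, inv_mul_cancel_left₀ h0])

/-- The direction `Ad l v⁻`. -/
def direction (l : D.levi) : D.negSpace :=
  ⟨Ad (l : G) D.vMinus, (D.Ad_mem_degSpace l.2).2 D.vMinus_mem_degSpace⟩

/-- `l exp(τ v⁻) l⁻¹ = exp(τ Ad(l) v⁻)`, and the remaining factor `l⁻¹` lies in `P`. -/
theorem photonParam_levi_coe (g : G) (X : D.negSpace) (l : D.levi) (τ : ℝ) :
    D.photonParam (g * exp (D.toLie X) * l) (τ : OnePoint ℝ) =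
      D.chartAt g (X + τ • D.direction l) := by
  change _ = g • D.expChart _
  rw [D.expChart_add, smul_smul]
  change ((g * exp (D.toLie X) * l * exp (τ • D.vMinus) : G) : D.ShilovBoundary) =
    ((g * exp (D.toLie X) * exp (D.toLie (τ • D.direction l)) : G) : D.ShilovBoundary)
  have h1 : D.toLie (τ • D.direction l) = Ad (l : G) (τ • D.vMinus) := by
    rw [map_smul]
    rfl
  rw [QuotientGroup.eq, h1, exp_conj]
  have : (g * exp (D.toLie X) * l * exp (τ • D.vMinus))⁻¹ *
      (g * exp (D.toLie X) * (l * exp (τ • D.vMinus) * (l : G)⁻¹)) = (l : G)⁻¹ := by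
    group
  rw [this]
  exact D.levi_le_parabolic (inv_mem l.2)

theorem photonParam_levi_infty (g : G) (X : D.negSpace) (l : D.levi) :
    D.photonParam (g * exp (D.toLie X) * l) OnePoint.infty ∉ range (D.chartAt g) := by
  rintro ⟨Z, hZ⟩
  have h1 := D.isRankOnePair.map l.2
  refine h1.infty_ne (D.toLie_mem (-X + Z)) ?_
  have h2 : (g * exp (D.toLie Z))⁻¹ *
      (g * exp (D.toLie X) * l * (exp D.vPlus * exp (-D.vMinus))) ∈ D.parabolic :=
    QuotientGroup.eq.1 hZ
  have h3 := mul_mem (D.levi_le_parabolic l.2) (inv_mem h2)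
  rw [exp_toLie_add, QuotientGroup.eq, ← map_neg, exp_conj, exp_conj, toLie_neg, exp_neg (D.toLie X)]
  convert h3 using 1
  group

/-- Photons in the chart are affine lines. -/
theorem exists_isMoebius {g g₀ : G} {s₀ : OnePoint ℝ} {X : D.negSpace}
    (h : D.photonParam g s₀ = D.chartAt g₀ X) :
    ∃ (m : OnePoint ℝ ≃ₜ OnePoint ℝ) (l : D.levi), IsMoebius m ∧ m s₀ = ((0 : ℝ) : OnePoint ℝ) ∧
      ∀ s, D.photonParam g s = D.photonParam (g₀ * exp (D.toLie X) * l) (m s) := by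
  -- If the common point has parameter `0`, then `k` differs from `g₀ exp X` by an element `l exp Y`
  -- of `P`; `l` chooses the direction and `exp Y` only reparametrizes the standard photon by a
  -- shear.
  have key0 : ∀ k : G, D.photonParam k ((0 : ℝ) : OnePoint ℝ) = D.chartAt g₀ X →
      ∃ (m : OnePoint ℝ ≃ₜ OnePoint ℝ) (l : D.levi), IsMoebius m ∧
        m ((0 : ℝ) : OnePoint ℝ) = ((0 : ℝ) : OnePoint ℝ) ∧
        ∀ s, D.photonParam k s = D.photonParam (g₀ * exp (D.toLie X) * l) (m s) := by
    intro k hk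
    have h1 : (g₀ * exp (D.toLie X))⁻¹ * k ∈ D.parabolic := by
      rw [← QuotientGroup.eq]
      refine Eq.trans hk.symm ?_
      change k • D.stdPhoton _ = _
      rw [stdPhoton_coe, zero_smul, exp_zero]
      change ((k * 1 : G) : D.ShilovBoundary) = _
      rw [mul_one]
    obtain ⟨l, hl, Y, hY, e⟩ := D.exists_levi_mul_exp h1
    obtain ⟨c, hc⟩ := D.vMinus_rank_one Y
    have hμ : ⁅D.vMinus, ⁅D.vMinus, Y⁆⁆ = (-2 * (-c / 2)) • D.vMinus := by
      rw [hc]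
      congr 1
      ring
    refine ⟨shear (-c / 2), ⟨l, hl⟩, isMoebius_shear _, ?_, fun s => ?_⟩
    · rw [shear_apply, invFun_zero, translation_infty, invFun_infty]
    · change k • D.stdPhoton s = (g₀ * exp (D.toLie X) * l) • D.stdPhoton _
      rw [← D.exp_smul_stdPhoton_shear hY hμ, smul_smul]
      congr 1
      rw [mul_assoc, ← e]
      group
  -- A finite parameter `t` is brought to `0` by the translation coming from `exp(t v⁻)`.
  have key1 : ∀ (k : G) (t : ℝ), D.photonParam k (t : OnePoint ℝ) = D.chartAt g₀ X →
      ∃ (m : OnePoint ℝ ≃ₜ OnePoint ℝ) (l : D.levi), IsMoebius m ∧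
        m (t : OnePoint ℝ) = ((0 : ℝ) : OnePoint ℝ) ∧
        ∀ s, D.photonParam k s = D.photonParam (g₀ * exp (D.toLie X) * l) (m s) := by
    intro k t hk
    have h1 : ∀ s, D.photonParam (k * exp (t • D.vMinus)) (translation (-t) s) =
        D.photonParam k s := by
      intro s
      change (k * exp (t • D.vMinus)) • D.stdPhoton _ = k • D.stdPhoton s
      rw [← exp_smul_stdPhoton, smul_smul, mul_assoc, ← exp_add_smul, add_neg_cancel, zero_smul,
        exp_zero, mul_one]
    have h2 : translation (-t) (t : OnePoint ℝ) = ((0 : ℝ) : OnePoint ℝ) := by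
      rw [translation_coe, add_neg_cancel]
    obtain ⟨m, l, hm, hm0, hs⟩ := key0 (k * exp (t • D.vMinus)) (by rw [← h2, h1, hk])
    refine ⟨(translation (-t)).trans m, l, (isMoebius_translate _).trans hm, ?_, fun s => ?_⟩
    · rw [Homeomorph.trans_apply, h2, hm0]
    · rw [← h1, hs]
      rfl
  induction s₀ using OnePoint.rec with
  | coe t => exact key1 g t h
  | infty =>
    have hμ : ⁅D.vMinus, ⁅D.vMinus, D.vPlus⁆⁆ = (-2 * 1 : ℝ) • D.vMinus := by
      rw [D.vMinus_lie_lie_vPlus, mul_one]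
    have h1 : ∀ s, D.photonParam (g * exp (-D.vPlus)) (shear 1 s) = D.photonParam g s := by
      intro s
      change (g * exp (-D.vPlus)) • D.stdPhoton _ = g • D.stdPhoton s
      rw [← D.exp_smul_stdPhoton_shear D.vPlus_mem_degSpace hμ, smul_smul, mul_assoc, exp_neg,
        inv_mul_cancel, mul_one]
    -- The shear coming from `v⁺` moves infinity to the finite parameter `1`.
    have h2 : shear 1 OnePoint.infty = ((1 : ℝ) : OnePoint ℝ) := by
      rw [shear_apply, invFun_infty, translation_coe, zero_add, invFun_coe one_ne_zero, inv_one]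
    obtain ⟨m, l, hm, hm0, hs⟩ := key1 (g * exp (-D.vPlus)) 1 (by rw [← h2, h1, h])
    refine ⟨(shear 1).trans m, l, (isMoebius_shear _).trans hm, ?_, fun s => ?_⟩
    · rw [Homeomorph.trans_apply, h2, hm0]
    · rw [← h1, hs]
      rfl

end Photons

end HTTData

/-! ### Estimates for the Hilbert metric of an interval -/

namespace ProjLine

theorem hilbert_preimage {m : OnePoint ℝ ≃ₜ OnePoint ℝ} (hm : IsMoebius m)
    (J : Set (OnePoint ℝ)) (s t : OnePoint ℝ) :
    hilbert (m ⁻¹' J) s t = hilbert J (m s) (m t) := by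
  unfold hilbert
  congr 1
  ext c
  rw [← m.preimage_frontier]
  constructor
  · rintro ⟨a, ha, b, hb, rfl⟩
    exact ⟨m a, ha, m b, hb, by rw [hm]⟩
  · rintro ⟨a, ha, b, hb, rfl⟩
    refine ⟨m.symm a, ?_, m.symm b, ?_, ?_⟩
    · rwa [mem_preimage, m.apply_symm_apply]
    · rwa [mem_preimage, m.apply_symm_apply]
    · rw [← hm (m.symm a), m.apply_symm_apply, m.apply_symm_apply]

theorem hilbert_comm (J : Set (OnePoint ℝ)) (s t : OnePoint ℝ) : hilbert J s t = hilbert J t s := by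
  unfold hilbert
  have h : ∀ a b, |Real.log (crossRatio a s t b)| = |Real.log (crossRatio a t s b)| := by
    intro a b
    have : crossRatio a s t b = (crossRatio a t s b)⁻¹ := by
      rw [crossRatio, crossRatio, inv_div]
    rw [this, Real.log_inv, abs_neg]
  simp only [h]

theorem frontier_coe_Ioo {a b : ℝ} (hab : a < b) :
    frontier ((↑) '' Ioo a b : Set (OnePoint ℝ)) = {(a : OnePoint ℝ), (b : OnePoint ℝ)} := by
  have h1 : closure ((↑) '' Ioo a b : Set (OnePoint ℝ)) = (↑) '' Icc a b := by
    refine subset_antisymm ?_ ?_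
    · exact closure_minimal (image_mono Ioo_subset_Icc_self)
        (isCompact_Icc.image OnePoint.continuous_coe).isClosed
    · rw [← closure_Ioo hab.ne]
      exact image_closure_subset_closure_image OnePoint.continuous_coe
  rw [frontier, h1, (OnePoint.isOpenEmbedding_coe.isOpenMap _ isOpen_Ioo).interior_eq,
    ← image_sdiff OnePoint.coe_injective, Icc_sdiff_Ioo_same hab.le, image_pair]

theorem crossRatio_coe (p τ q : ℝ) : crossRatio (p : OnePoint ℝ) ((0 : ℝ) : OnePoint ℝ)
    (τ : OnePoint ℝ) (q : OnePoint ℝ) = ((τ - p) * q) / (-p * (q - τ)) := by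
  have hd : ∀ u v : ℝ, det (u : OnePoint ℝ) (v : OnePoint ℝ) = v - u := by
    intro u v
    simp [det, lift]
  rw [crossRatio, hd, hd, hd, hd]
  ring

theorem log_crossRatio_coe {p τ q : ℝ} (hp : p ≠ 0) (hq : q ≠ 0) (hp1 : 0 < 1 - τ / p)
    (hq1 : 0 < 1 - τ / q) : Real.log (crossRatio (p : OnePoint ℝ) ((0 : ℝ) : OnePoint ℝ)
      (τ : OnePoint ℝ) (q : OnePoint ℝ)) = Real.log (1 - τ / p) - Real.log (1 - τ / q) := by
  rw [crossRatio_coe, ← Real.log_div hp1.ne' hq1.ne']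
  congr 1
  have h1 : 1 - τ / p = (p - τ) / p := by field_simp
  have h2 : 1 - τ / q = (q - τ) / q := by field_simp
  rw [h1, h2, div_div_div_eq, ← neg_div_neg_eq]
  congr 1 <;> ring

theorem abs_log_one_sub_le {u : ℝ} (hu : |u| ≤ 1 / 2) : |Real.log (1 - u)| ≤ 2 * |u| := by
  have h1 := abs_le.1 hu
  have hpos : 0 < 1 - u := by linarith
  have h2 := Real.log_le_sub_one_of_pos hpos
  have h3 := Real.one_sub_inv_le_log_of_pos hpos
  rw [abs_le]
  constructor
  · have h4 : 1 - (1 - u)⁻¹ = -(u / (1 - u)) := by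
      field_simp
      ring
    have h5 : u / (1 - u) ≤ 2 * |u| := by
      rw [div_le_iff₀ hpos]
      nlinarith [le_abs_self u, abs_nonneg u]
    linarith
  · linarith [neg_abs_le u, abs_nonneg u]

/-- Both endpoints `p` satisfy `|p| ≥ ρ`, so `|τ / p| ≤ |τ| / ρ ≤ 1/2`, and each of the two
logarithms is at most `2 |τ| / ρ`. The supremum ranges over all ordered pairs of endpoints, equal
ones included. -/
theorem hilbert_coe_Ioo_le {a b ρ τ : ℝ} (ha : a ≤ -ρ) (hb : ρ ≤ b) (hρ : 0 < ρ)
    (hτ : |τ| ≤ ρ / 2) :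
    hilbert ((↑) '' Ioo a b) ((0 : ℝ) : OnePoint ℝ) (τ : OnePoint ℝ) ≤ 4 * |τ| / ρ := by
  unfold hilbert
  refine Real.sSup_le ?_ (by positivity)
  rw [frontier_coe_Ioo (by linarith : a < b)]
  have h1 : ∀ p : ℝ, ρ ≤ |p| → p ≠ 0 ∧ |τ / p| ≤ 1 / 2 ∧ |τ / p| ≤ |τ| / ρ := by
    intro p hp
    have hp0 : 0 < |p| := hρ.trans_le hp
    have h2 : |τ / p| ≤ |τ| / ρ := by
      rw [abs_div]
      exact div_le_div_of_nonneg_left (abs_nonneg _) hρ hp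
    refine ⟨abs_pos.1 hp0, h2.trans ?_, h2⟩
    rw [div_le_iff₀ hρ]
    linarith
  have h2 : ∀ p q : ℝ, ρ ≤ |p| → ρ ≤ |q| → |Real.log (crossRatio (p : OnePoint ℝ)
      ((0 : ℝ) : OnePoint ℝ) (τ : OnePoint ℝ) (q : OnePoint ℝ))| ≤ 4 * |τ| / ρ := by
    intro p q hp hq
    obtain ⟨p0, p1, p2⟩ := h1 p hp
    obtain ⟨q0, q1, q2⟩ := h1 q hq
    rw [log_crossRatio_coe p0 q0 (by linarith [le_abs_self (τ / p)])
      (by linarith [le_abs_self (τ / q)])]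
    refine (abs_sub _ _).trans ?_
    have h3 := abs_log_one_sub_le p1
    have h4 := abs_log_one_sub_le q1
    have h5 : 4 * |τ| / ρ = 4 * (|τ| / ρ) := by ring
    linarith
  have ha' : ρ ≤ |a| := by
    rw [abs_of_neg (by linarith)]
    linarith
  have hb' : ρ ≤ |b| := hb.trans (le_abs_self b)
  rintro c ⟨_, rfl | rfl, _, rfl | rfl, rfl⟩
  exacts [h2 _ _ ha' ha', h2 _ _ ha' hb', h2 _ _ hb' ha', h2 _ _ hb' hb']

/-- The terms `log (1 - τ/a)` and `-log (1 - τ/b)` have the same sign. The one for the endpoint on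
the side of `τ` already has size at least `|τ| / R`, by `log x ≤ x - 1`. -/
theorem le_hilbert_coe_Ioo {a b R τ : ℝ} (ha : -R ≤ a) (hb : b ≤ R) (ha0 : a < 0) (hb0 : 0 < b)
    (hτ : τ ∈ Ioo a b) :
    |τ| / R ≤ hilbert ((↑) '' Ioo a b) ((0 : ℝ) : OnePoint ℝ) (τ : OnePoint ℝ) := by
  have hR : 0 < R := hb0.trans_le hb
  have h1 : |τ| / R ≤ |Real.log (crossRatio (a : OnePoint ℝ)
      ((0 : ℝ) : OnePoint ℝ) (τ : OnePoint ℝ) (b : OnePoint ℝ))| := by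
    have ha' := ha0.ne
    have ea : 1 - τ / a = (a - τ) / a := by field_simp
    have eb : 1 - τ / b = (b - τ) / b := by field_simp
    have ha1 : 0 < 1 - τ / a := by
      rw [ea]
      exact div_pos_of_neg_of_neg (by linarith [hτ.1]) ha0
    have hb1 : 0 < 1 - τ / b := by
      rw [eb]
      exact div_pos (by linarith [hτ.2]) hb0
    rw [log_crossRatio_coe ha0.ne hb0.ne' ha1 hb1]
    have la := Real.log_le_sub_one_of_pos ha1
    have lb := Real.log_le_sub_one_of_pos hb1
    rcases le_total 0 τ with h | h
    · have h3 : 0 ≤ Real.log (1 - τ / a) :=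
        Real.log_nonneg (by linarith [div_nonpos_of_nonneg_of_nonpos h ha0.le])
      have h4 : τ / R ≤ τ / b := div_le_div_of_nonneg_left h hb0 hb
      rw [abs_of_nonneg h]
      exact le_trans (by linarith) (le_abs_self _)
    · have h3 : 0 ≤ Real.log (1 - τ / b) :=
        Real.log_nonneg (by linarith [div_nonpos_of_nonpos_of_nonneg h hb0.le])
      have h4 : -τ / R ≤ τ / a := by
        rw [← neg_div_neg_eq τ a]
        exact div_le_div_of_nonneg_left (by linarith) (by linarith) (by linarith)
      rw [abs_of_nonpos h]
      exact le_trans (by linarith) (neg_le_abs _)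
  refine h1.trans (le_csSup ?_ ?_)
  · rw [frontier_coe_Ioo (by linarith : a < b)]
    refine ((Set.toFinite ({(a : OnePoint ℝ), (b : OnePoint ℝ)} ×ˢ
      {(a : OnePoint ℝ), (b : OnePoint ℝ)} : Set (OnePoint ℝ × OnePoint ℝ))).image
        fun p => |Real.log (crossRatio p.1 ((0 : ℝ) : OnePoint ℝ) (τ : OnePoint ℝ) p.2)|).bddAbove.mono ?_
    rintro c ⟨p, hp, q, hq, rfl⟩
    exact ⟨(p, q), ⟨hp, hq⟩, rfl⟩
  · rw [frontier_coe_Ioo (by linarith : a < b)]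
    exact ⟨a, by simp, b, by simp, rfl⟩

end ProjLine

theorem IsPreconnected.exists_eq_Ioo {U : Set ℝ} (hU : IsPreconnected U) (ho : IsOpen U)
    (hne : U.Nonempty) (hb : BddBelow U) (hb' : BddAbove U) : ∃ a b, U = Ioo a b := by
  refine ⟨sInf U, sSup U, subset_antisymm ?_
    (IsConnected.Ioo_csInf_csSup_subset ⟨hne, hU⟩ hb hb')⟩
  have h1 : U ⊆ Icc (sInf U) (sSup U) := fun x hx => ⟨csInf_le hb hx, le_csSup hb' hx⟩
  have h2 := interior_mono h1
  rwa [ho.interior_eq, interior_Icc] at h2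

/-! ### `k_Ω` on the affine lines of the chart -/

namespace HTTData

section Lines

open LieGrp ProjLine

variable {n : ℕ} {G : Type*} [TopologicalSpace G] [ChartedSpace (EuclideanSpace ℝ (Fin n)) G]
  [Group G] [LieGroup (𝓡 n) ∞ G] (D : HTTData (GroupLieAlgebra (𝓡 n) G))

theorem direction_ne_zero (l : D.levi) : D.direction l ≠ 0 := fun h =>
  (D.isRankOnePair.map l.2).ne_zero (congrArg D.toLie h)

/-- The intersection of `Ω` with an affine line of the chart. -/
def lineSet (Ω : Set D.ShilovBoundary) (g : G) (X : D.negSpace) (l : D.levi) : Set ℝ :=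
  {τ | D.chartAt g (X + τ • D.direction l) ∈ Ω}

/-- The component of the intersection of `Ω` with an affine line. -/
def lineComponent (Ω : Set D.ShilovBoundary) (g : G) (X : D.negSpace) (l : D.levi) : Set ℝ :=
  connectedComponentIn (D.lineSet Ω g X l) 0

theorem isInducing_line {V : Type*} [NormedAddCommGroup V] [InnerProductSpace ℝ V] (X : V) {w : V}
    (hw : w ≠ 0) : IsInducing fun τ : ℝ => X + τ • w := by
  have h1 : Function.LeftInverse (fun Y : V => inner ℝ w (Y - X) / ‖w‖ ^ 2)
      (fun τ : ℝ => X + τ • w) := by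
    intro τ
    have : ‖w‖ ^ 2 ≠ 0 := by positivity
    simp only [add_sub_cancel_left, inner_smul_right, real_inner_self_eq_norm_sq]
    field_simp
  refine (h1.isEmbedding ?_ ?_).isInducing
  · fun_prop
  · fun_prop

/-- The point at infinity of the photon is outside the chart, hence outside `Ω`, so a component of
the photon in `Ω` is a component of the affine line. The affine parametrization is inducing, which
transfers connectedness both ways. -/
theorem preimage_component {Ω : Set D.ShilovBoundary} {g : G} (hΩ : Ω ⊆ range (D.chartAt g))
    (X : D.negSpace) (l : D.levi) (hX : D.chartAt g X ∈ Ω) :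
    D.photonParam (g * exp (D.toLie X) * l) ⁻¹' connectedComponentIn
      (range (D.photonParam (g * exp (D.toLie X) * l)) ∩ Ω) (D.chartAt g X) =
      (↑) '' D.lineComponent Ω g X l := by
  set k := g * exp (D.toLie X) * (l : G) with hk
  set C := connectedComponentIn (range (D.photonParam k) ∩ Ω) (D.chartAt g X) with hC
  have hCs : C ⊆ range (D.photonParam k) ∩ Ω := connectedComponentIn_subset _ _
  have hj : ∀ τ : ℝ, D.photonParam k (τ : OnePoint ℝ) = D.chartAt g (X + τ • D.direction l) :=
    D.photonParam_levi_coe g X l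
  have h0 : D.chartAt g (X + (0 : ℝ) • D.direction l) = D.chartAt g X := by rw [zero_smul, add_zero]
  have hind : IsInducing fun τ : ℝ => D.chartAt g (X + τ • D.direction l) :=
    (D.isOpenEmbedding_chartAt g).isInducing.comp (isInducing_line X (D.direction_ne_zero l))
  have hxC : D.chartAt g X ∈ C :=
    mem_connectedComponentIn ⟨⟨((0 : ℝ) : OnePoint ℝ), by rw [hj, h0]⟩, hX⟩
  have hinf : ∀ s : OnePoint ℝ, D.photonParam k s ∈ C → ∃ τ : ℝ, s = τ := by
    intro s hs
    induction s using OnePoint.rec with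
    | infty => exact absurd (hΩ (hCs hs).2) (D.photonParam_levi_infty g X l)
    | coe τ => exact ⟨τ, rfl⟩
  refine subset_antisymm ?_ ?_
  · set J : Set ℝ := {τ | D.chartAt g (X + τ • D.direction l) ∈ C} with hJ
    have hJC : (fun τ : ℝ => D.chartAt g (X + τ • D.direction l)) '' J = C := by
      refine subset_antisymm ?_ ?_
      · rintro _ ⟨τ, hτ, rfl⟩
        exact hτ
      · intro y hy
        obtain ⟨s, rfl⟩ := (hCs hy).1
        obtain ⟨τ, rfl⟩ := hinf s hy
        rw [hj] at hy ⊢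
        exact ⟨τ, hy, rfl⟩
    have hJp : IsPreconnected J := by
      rw [← hind.isPreconnected_image, hJC]
      exact isPreconnected_connectedComponentIn
    have hJs : J ⊆ D.lineComponent Ω g X l :=
      hJp.subset_connectedComponentIn (by rw [hJ, mem_ofPred_eq, h0]; exact hxC)
        (fun τ hτ => (hCs hτ).2)
    intro s hs
    obtain ⟨τ, rfl⟩ := hinf s hs
    rw [mem_preimage, hj] at hs
    exact ⟨τ, hJs hs, rfl⟩
  · rintro _ ⟨τ, hτ, rfl⟩
    have h1 : IsPreconnected ((fun τ : ℝ => D.chartAt g (X + τ • D.direction l)) ''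
        D.lineComponent Ω g X l) :=
      isPreconnected_connectedComponentIn.image _ hind.continuous.continuousOn
    have h2 := h1.subset_connectedComponentIn (x := D.chartAt g X)
      (F := range (D.photonParam k) ∩ Ω)
      ⟨0, mem_connectedComponentIn (by rw [lineSet, mem_ofPred_eq, h0]; exact hX), h0⟩ (by
        rintro _ ⟨u, hu, rfl⟩
        have hu' : u ∈ D.lineSet Ω g X l := connectedComponentIn_subset _ _ hu
        exact ⟨⟨(u : OnePoint ℝ), hj u⟩, hu'⟩)
    rw [mem_preimage, hj]
    exact h2 ⟨τ, hτ, rfl⟩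

variable {D}

theorem kob_le {Ω : Set D.ShilovBoundary} {g : G} (hΩ : Ω ⊆ range (D.chartAt g))
    {X : D.negSpace} {l : D.levi} (hX : D.chartAt g X ∈ Ω) {τ : ℝ}
    (hτ : τ ∈ D.lineComponent Ω g X l) :
    D.kob Ω (D.chartAt g X) (D.chartAt g (X + τ • D.direction l)) ≤
      ENNReal.ofReal (hilbert ((↑) '' D.lineComponent Ω g X l) ((0 : ℝ) : OnePoint ℝ)
        (τ : OnePoint ℝ)) := by
  have hp := D.preimage_component hΩ X l hX
  rw [← hp]
  have h1 : (τ : OnePoint ℝ) ∈ D.photonParam (g * exp (D.toLie X) * l) ⁻¹' connectedComponentIn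
      (range (D.photonParam (g * exp (D.toLie X) * l)) ∩ Ω) (D.chartAt g X) := by
    rw [hp]
    exact ⟨τ, hτ, rfl⟩
  rw [mem_preimage, photonParam_levi_coe] at h1
  unfold kob
  refine iInf_le_of_le (g * exp (D.toLie X) * l) (iInf_le_of_le ((0 : ℝ) : OnePoint ℝ)
    (iInf_le_of_le (τ : OnePoint ℝ) (iInf_le_of_le ?_ (iInf_le_of_le ?_
      (iInf_le_of_le ⟨hX, h1⟩ le_rfl)))))
  · rw [photonParam_levi_coe, zero_smul, add_zero]
  · rw [photonParam_levi_coe]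

theorem conjugate_of_mem {Ω : Set D.ShilovBoundary} {g : G} (hΩ : Ω ⊆ range (D.chartAt g))
    {X : D.negSpace} {l : D.levi} (hX : D.chartAt g X ∈ Ω) {τ : ℝ}
    (hτ : τ ∈ D.lineComponent Ω g X l) :
    D.Conjugate Ω (D.chartAt g X) (D.chartAt g (X + τ • D.direction l)) := by
  have hp := D.preimage_component hΩ X l hX
  have h1 : (τ : OnePoint ℝ) ∈ D.photonParam (g * exp (D.toLie X) * l) ⁻¹' connectedComponentIn
      (range (D.photonParam (g * exp (D.toLie X) * l)) ∩ Ω) (D.chartAt g X) := by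
    rw [hp]
    exact ⟨τ, hτ, rfl⟩
  rw [mem_preimage, photonParam_levi_coe] at h1
  refine ⟨_, ⟨g * exp (D.toLie X) * l, rfl⟩, ⟨⟨((0 : ℝ) : OnePoint ℝ), ?_⟩, hX⟩, h1⟩
  rw [photonParam_levi_coe, zero_smul, add_zero]

/-- A lower bound has to handle every parametrized photon through the two points. Each becomes a
standard affine one after a homography, which leaves the Hilbert metric unchanged. -/
theorem le_kob {Ω : Set D.ShilovBoundary} {g : G} (hΩ : Ω ⊆ range (D.chartAt g))
    {X : D.negSpace} {y : D.ShilovBoundary} {c : ℝ≥0∞}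
    (hc : ∀ (l : D.levi), ∀ τ ∈ D.lineComponent Ω g X l,
      y = D.chartAt g (X + τ • D.direction l) →
      c ≤ ENNReal.ofReal (hilbert ((↑) '' D.lineComponent Ω g X l) ((0 : ℝ) : OnePoint ℝ)
        (τ : OnePoint ℝ))) :
    c ≤ D.kob Ω (D.chartAt g X) y := by
  unfold kob
  refine le_iInf fun k => le_iInf fun s => le_iInf fun t => le_iInf fun hs => le_iInf fun ht =>
    le_iInf fun hxy => ?_
  obtain ⟨m, l, hm, hm0, hms⟩ := D.exists_isMoebius hs
  have hp := D.preimage_component hΩ X l hxy.1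
  have hr : range (D.photonParam k) = range (D.photonParam (g * exp (D.toLie X) * l)) := by
    refine subset_antisymm ?_ ?_
    · rintro _ ⟨u, rfl⟩
      exact ⟨m u, (hms u).symm⟩
    · rintro _ ⟨u, rfl⟩
      exact ⟨m.symm u, by rw [hms, m.apply_symm_apply]⟩
  have hpre : D.photonParam k ⁻¹' connectedComponentIn (range (D.photonParam k) ∩ Ω)
      (D.chartAt g X) = m ⁻¹' ((↑) '' D.lineComponent Ω g X l) := by
    rw [← hp, hr]
    ext u
    rw [mem_preimage, mem_preimage, mem_preimage, hms]
  have ht' : t ∈ D.photonParam k ⁻¹' connectedComponentIn (range (D.photonParam k) ∩ Ω)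
      (D.chartAt g X) := by
    rw [mem_preimage, ht]
    exact hxy.2
  rw [hpre] at ht' ⊢
  obtain ⟨τ, hτ, hτe⟩ := ht'
  rw [hilbert_preimage hm, hm0, ← hτe]
  refine hc l τ hτ ?_
  rw [← ht, hms, ← hτe, photonParam_levi_coe]

end Lines

end HTTData

/-- On unit vectors, proportionality to `w` is the closed condition of being equal to the orthogonal
projection on `ℝ w`. -/
theorem isCompact_setOf_norm_eq_one_and {E ι : Type*} [NormedAddCommGroup E]
    [InnerProductSpace ℝ E] [FiniteDimensional ℝ E] {V : Submodule ℝ E} (Q : V → ι → E)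
    (hQ : ∀ i, Continuous fun w => Q w i) :
    IsCompact {w : V | ‖w‖ = 1 ∧ ∀ i, Q w i = inner ℝ (w : E) (Q w i) • (w : E)} := by
  refine (isCompact_sphere (0 : V) 1).of_isClosed_subset ?_ fun w hw => ?_
  · refine (isClosed_eq continuous_norm continuous_const).and ?_
    simp only [Set.ofPred_forall]
    exact isClosed_iInter fun i => isClosed_eq (hQ i)
      ((continuous_subtype_val.inner (hQ i)).smul continuous_subtype_val)
  · rw [mem_sphere_zero_iff_norm]
    exact hw.1

/-! ### Rank one lines leave a proper domain in uniformly bounded length -/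

namespace HTTData

section UniformBound

open LieGrp

variable {n : ℕ} {G : Type*} [TopologicalSpace G] [ChartedSpace (EuclideanSpace ℝ (Fin n)) G]
  [Group G] [LieGroup (𝓡 n) ∞ G] (D : HTTData (GroupLieAlgebra (𝓡 n) G))

/-- The abelian subalgebra `𝔲⁺`, as a subspace of a normed space. -/
def posSpace : Submodule ℝ (EuclideanSpace ℝ (Fin n)) :=
  (degSpace D.gradingElt 1 : Submodule ℝ (GroupLieAlgebra (𝓡 n) G))

/-- The exponential on `𝔲⁺`. -/
def posExp (X : D.posSpace) : G :=
  exp ((X : EuclideanSpace ℝ (Fin n)) : GroupLieAlgebra (𝓡 n) G)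

theorem continuous_posExp : Continuous D.posExp :=
  continuous_exp_of_abelian (degSpace D.gradingElt 1)
    (fun _ hX _ hY => D.isThreeGrading.lie_eq_zero_of_pos hX hY)

/-- The Cartan involution, from `𝔲⁻` to `𝔲⁺`. -/
def σPos : D.negSpace →ₗ[ℝ] D.posSpace where
  toFun X := ⟨D.σ (D.toLie X), by
    have := (map_mem_degSpace D.σ).2 (D.toLie_mem X)
    rw [D.σ_gradingElt, degSpace_neg, neg_neg] at this
    exact this⟩
  map_add' X Y := Subtype.ext (map_add D.σ (D.toLie X) (D.toLie Y))
  map_smul' c X := Subtype.ext (map_smul D.σ c (D.toLie X))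

theorem continuous_σPos : Continuous D.σPos := LinearMap.continuous_of_finiteDimensional _

/-- The quadratic map `(ad w)²`. -/
def adSq (w : D.negSpace) (Y : EuclideanSpace ℝ (Fin n)) : EuclideanSpace ℝ (Fin n) :=
  bracketOp n G w (bracketOp n G w Y)

theorem adSq_apply (w : D.negSpace) (Y : GroupLieAlgebra (𝓡 n) G) :
    D.adSq w Y = ⁅D.toLie w, ⁅D.toLie w, Y⁆⁆ :=
  (bracketOp_apply (D.toLie w) _).trans
    (congrArg (fun Z : GroupLieAlgebra (𝓡 n) G => ⁅D.toLie w, Z⁆) (bracketOp_apply (D.toLie w) Y))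

theorem continuous_adSq_comp {T : Type*} [TopologicalSpace T] {w : T → D.negSpace}
    {Y : T → EuclideanSpace ℝ (Fin n)} (hw : Continuous w) (hY : Continuous Y) :
    Continuous fun x => D.adSq (w x) (Y x) := by
  have h1 : Continuous fun x => bracketOp n G (w x : EuclideanSpace ℝ (Fin n)) :=
    (bracketOp n G).continuous.comp (continuous_subtype_val.comp hw)
  exact h1.clm_apply (h1.clm_apply hY)

/-- The unit vectors of rank one. -/
def unitRankOne : Set D.negSpace :=
  {w | ‖w‖ = 1 ∧ ∀ Y, D.adSq w Y = inner ℝ (w : EuclideanSpace ℝ (Fin n)) (D.adSq w Y) •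
    (w : EuclideanSpace ℝ (Fin n))}

theorem isCompact_unitRankOne : IsCompact D.unitRankOne :=
  isCompact_setOf_norm_eq_one_and (E := EuclideanSpace ℝ (Fin n)) (V := D.negSpace)
    (fun (w : D.negSpace) (Y : EuclideanSpace ℝ (Fin n)) => D.adSq w Y) fun Y =>
      D.continuous_adSq_comp (T := D.negSpace) continuous_id (continuous_const (y := Y))

/-- The coefficient `λ` in `[w, [w, σ w]] = λ w`. -/
def coeffσ (w : D.negSpace) : ℝ :=
  inner ℝ (w : EuclideanSpace ℝ (Fin n)) (D.adSq w (D.σPos w))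

theorem continuous_coeffσ : Continuous D.coeffσ := by
  have h1 : Continuous fun w : D.negSpace => D.adSq w (D.σPos w) :=
    D.continuous_adSq_comp continuous_id (continuous_subtype_val.comp D.continuous_σPos)
  exact continuous_subtype_val.inner h1

/-- The companion of a vector of rank one. -/
def companion (w : D.negSpace) : D.posSpace := (-2 / D.coeffσ w) • D.σPos w

variable {D}

theorem ne_zero_of_unitRankOne {w : D.negSpace} (hw : w ∈ D.unitRankOne) : w ≠ 0 := by
  rintro rfl
  have := hw.1
  rw [norm_zero] at this
  exact zero_ne_one this

theorem isRankOnePair_companion {w : D.negSpace} (hw : w ∈ D.unitRankOne) :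
    D.IsRankOnePair (D.toLie w) ((D.companion w : EuclideanSpace ℝ (Fin n)) : GroupLieAlgebra (𝓡 n) G) :=
  D.isRankOnePair_σ (D.toLie_mem w) (fun h => ne_zero_of_unitRankOne hw (D.toLie_injective h))
    (fun Y => ⟨_, (D.adSq_apply w Y).symm.trans (hw.2 Y)⟩)
    ((D.adSq_apply w (D.σ (D.toLie w))).symm.trans (hw.2 (D.σPos w)))

theorem coeffσ_ne_zero {w : D.negSpace} (hw : w ∈ D.unitRankOne) : D.coeffσ w ≠ 0 := by
  intro h
  have h1 : D.adSq w (D.σPos w) = D.coeffσ w • (w : EuclideanSpace ℝ (Fin n)) := hw.2 (D.σPos w)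
  rw [h, zero_smul] at h1
  exact D.lie_lie_σ_ne_zero (D.toLie_mem w)
    (fun h => ne_zero_of_unitRankOne hw (D.toLie_injective h)) ((D.adSq_apply w (D.σ (D.toLie w))).symm.trans h1)

theorem unit_direction_mem (l : D.levi) :
    ‖D.direction l‖⁻¹ • D.direction l ∈ D.unitRankOne := by
  have h0 := D.direction_ne_zero l
  set w := ‖D.direction l‖⁻¹ • D.direction l with hw
  have h1 : ‖w‖ = 1 := norm_smul_inv_norm (𝕜 := ℝ) h0
  refine ⟨h1, fun Y => ?_⟩
  obtain ⟨c, hc⟩ := (D.isRankOnePair.map l.2).rank_one Y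
  have hc' : D.adSq (D.direction l) Y = c • ((D.direction l : D.negSpace) :
    EuclideanSpace ℝ (Fin n)) := (D.adSq_apply _ Y).trans hc
  have h2 : D.adSq w Y = (‖D.direction l‖⁻¹ * c) • (w : EuclideanSpace ℝ (Fin n)) := by
    have h3 : D.adSq w Y = (‖D.direction l‖⁻¹ * ‖D.direction l‖⁻¹) • D.adSq (D.direction l) Y := by
      simp only [adSq, hw, Submodule.coe_smul, map_smul, smul_apply, smul_smul]
    rw [h3, hc', hw, Submodule.coe_smul, smul_smul, smul_smul]
    congr 1
    ring
  have h4 : inner ℝ (w : EuclideanSpace ℝ (Fin n)) (w : EuclideanSpace ℝ (Fin n)) = (1 : ℝ) := by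
    have h5 : ‖(w : EuclideanSpace ℝ (Fin n))‖ = 1 := h1
    rw [real_inner_self_eq_norm_sq, h5, one_pow]
  rw [h2, inner_smul_right, h4, mul_one]

/-- The points of the photons, near infinity. -/
def nearInfty (g : G) (p : (D.negSpace × ℝ) × D.negSpace) : D.ShilovBoundary :=
  ((g * exp (D.toLie p.1.1) * (D.posExp ((1 + p.1.2) • D.companion p.2) *
    exp (D.toLie (-p.2))) : G) : D.ShilovBoundary)

/-- `companion` divides by `coeffσ`, which is nonzero at unit vectors of rank one. The real
coordinate stands for `τ⁻¹`, so `0` is the point at infinity of the line. -/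
theorem continuousAt_nearInfty (g : G) (X : D.negSpace) {w : D.negSpace} (hw : w ∈ D.unitRankOne) :
    ContinuousAt (nearInfty g) ((X, 0), w) := by
  have := isTopologicalGroup n G
  have h1 : ContinuousAt D.companion w :=
    ContinuousAt.smul (M := ℝ) (continuousAt_const.div D.continuous_coeffσ.continuousAt
      (coeffσ_ne_zero hw)) D.continuous_σPos.continuousAt
  have h2 : ContinuousAt (fun p : (D.negSpace × ℝ) × D.negSpace => D.companion p.2) ((X, 0), w) :=
    Filter.Tendsto.comp (f := Prod.snd) h1 continuousAt_snd
  have h3 : ContinuousAt (fun p : (D.negSpace × ℝ) × D.negSpace =>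
      (1 + p.1.2) • D.companion p.2) ((X, 0), w) := by
    have h8 : ContinuousAt (fun p : (D.negSpace × ℝ) × D.negSpace => (1 + p.1.2 : ℝ)) ((X, 0), w) := by
      fun_prop
    exact h8.smul h2
  have h4 := D.continuous_posExp.continuousAt.comp h3
  have h5 := D.continuous_exp_toLie
  have h6 : Continuous (fun p : (D.negSpace × ℝ) × D.negSpace => g * exp (D.toLie p.1.1)) :=
    continuous_const.mul (h5.comp (continuous_fst.comp continuous_fst))
  have h7 : Continuous (fun p : (D.negSpace × ℝ) × D.negSpace => (exp (D.toLie (-p.2)) : G)) :=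
    h5.comp continuous_snd.neg
  exact (continuous_quotient_mk'.continuousAt).comp
    (h6.continuousAt.mul (h4.mul h7.continuousAt))

/-- This is `g exp X` applied to the point at infinity in direction `w`; `infty_ne` separates it
from every `exp Z P`. -/
theorem nearInfty_zero (g : G) (X : D.negSpace) {w : D.negSpace} (hw : w ∈ D.unitRankOne) :
    nearInfty g ((X, 0), w) ∉ range (D.chartAt g) := by
  rintro ⟨Z, hZ⟩
  have hr := isRankOnePair_companion hw
  refine hr.infty_ne (D.toLie_mem (-X + Z)) ?_
  have h1 : (g * exp (D.toLie Z))⁻¹ * (g * exp (D.toLie X) *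
      (D.posExp ((1 + 0 : ℝ) • D.companion w) * exp (D.toLie (-w)))) ∈ D.parabolic :=
    QuotientGroup.eq.1 hZ
  rw [add_zero, one_smul] at h1
  rw [exp_toLie_add, QuotientGroup.eq, toLie_neg, exp_neg (D.toLie X)]
  convert inv_mem h1 using 1
  simp only [toLie_neg, posExp]
  group

theorem chartAt_eq_nearInfty (g : G) (X : D.negSpace) {w : D.negSpace} (hw : w ∈ D.unitRankOne)
    {τ : ℝ} (hτ : τ ≠ 0) : D.chartAt g (X + τ • w) = nearInfty g ((X, τ⁻¹), w) := by
  have h1 := (isRankOnePair_companion hw).exp_smul_eq hτ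
  unfold chartAt nearInfty
  rw [expChart_add, smul_smul]
  exact congrArg (fun y => (g * exp (D.toLie X)) • y) h1

/-- Lines of rank one through points close to `X₀` leave `Ω` in uniformly bounded time. -/
theorem exists_uniform_bound {Ω : Set D.ShilovBoundary} {g : G}
    (hΩ : closure Ω ⊆ range (D.chartAt g)) (X₀ : D.negSpace) :
    ∃ δ > 0, ∃ R > 0, ∀ X, ‖X - X₀‖ < δ → ∀ (l : D.levi) (τ : ℝ), R ≤ |τ| * ‖D.direction l‖ →
      D.chartAt g (X + τ • D.direction l) ∉ Ω := by
  -- The point at infinity avoids the closed set `closure Ω`, so nearby parameters do too;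
  -- compactness of the unit rank one vectors makes the neighbourhood uniform in the direction.
  have h1 : ∀ w ∈ D.unitRankOne, ∀ᶠ z : (D.negSpace × ℝ) × D.negSpace in 𝓝 ((X₀, 0), w),
      nearInfty g (z.1, z.2) ∉ closure Ω := by
    intro w hw
    have h2 : (closure Ω)ᶜ ∈ 𝓝 (nearInfty g ((X₀, 0), w)) :=
      isClosed_closure.isOpen_compl.mem_nhds fun h => nearInfty_zero g X₀ hw (hΩ h)
    exact continuousAt_nearInfty g X₀ hw h2
  have h2 := D.isCompact_unitRankOne.eventually_forall_of_forall_eventually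
    (P := fun z w => nearInfty g (z, w) ∉ closure Ω) h1
  obtain ⟨δ, hδ, h3⟩ := Metric.eventually_nhds_iff.1 h2
  -- With `R = 2 / δ`, the inverse parameter of the unit direction is at most `δ / 2 < δ`.
  refine ⟨δ, hδ, 2 / δ, by positivity, fun X hX l τ hτ hmem => ?_⟩
  have hw := unit_direction_mem l
  have hn : 0 < ‖D.direction l‖ := norm_pos_iff.2 (D.direction_ne_zero l)
  have hτ0 : τ * ‖D.direction l‖ ≠ 0 := by
    intro h
    have h5 : |τ| * ‖D.direction l‖ = 0 := by
      rw [← abs_of_pos hn, ← abs_mul, h, abs_zero]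
    have : 0 < 2 / δ := by positivity
    linarith
  have e1 : X + τ • D.direction l =
      X + (τ * ‖D.direction l‖) • (‖D.direction l‖⁻¹ • D.direction l) := by
    rw [smul_smul, mul_assoc, mul_inv_cancel₀ hn.ne', mul_one]
  rw [e1, chartAt_eq_nearInfty g X hw hτ0] at hmem
  refine h3 (y := (X, (τ * ‖D.direction l‖)⁻¹)) ?_ _ hw (subset_closure hmem)
  rw [Prod.dist_eq, max_lt_iff]
  refine ⟨by rwa [dist_eq_norm], ?_⟩
  rw [dist_zero_right, Real.norm_eq_abs, abs_inv, abs_mul, abs_of_pos hn]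
  calc (|τ| * ‖D.direction l‖)⁻¹ ≤ (2 / δ)⁻¹ := inv_anti₀ (by positivity) hτ
    _ = δ / 2 := by rw [inv_div]
    _ < δ := by linarith

end UniformBound

end HTTData

theorem HasDerivAt.mem_submodule {E : Type*} [NormedAddCommGroup E] [NormedSpace ℝ E]
    [FiniteDimensional ℝ E] {W : Submodule ℝ E} {f : ℝ → E} {f' : E} {x : ℝ}
    (hf : HasDerivAt f f' x) (hW : ∀ t, f t ∈ W) : f' ∈ W := by
  have h1 := hasDerivAt_iff_tendsto_slope.1 hf
  refine W.closed_of_finiteDimensional.mem_of_tendsto h1 (Filter.Eventually.of_forall fun t => ?_)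
  rw [slope_def_module]
  exact W.smul_mem _ (W.sub_mem (hW t) (hW x))

/-! ### Formal properties of the Kobayashi pseudo-metric -/

namespace HTTData

section Pseudometric

variable {n : ℕ} {G : Type*} [TopologicalSpace G] [ChartedSpace (EuclideanSpace ℝ (Fin n)) G]
  [Group G] [LieGroup (𝓡 n) ∞ G] {D : HTTData (GroupLieAlgebra (𝓡 n) G)}
  {Ω : Set D.ShilovBoundary}

theorem kob_comm (x y : D.ShilovBoundary) : D.kob Ω x y = D.kob Ω y x := by
  have key : ∀ x y, D.kob Ω x y ≤ D.kob Ω y x := by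
    intro x y
    unfold kob
    refine le_iInf fun g => le_iInf fun s => le_iInf fun t => le_iInf fun hs => le_iInf fun ht =>
      le_iInf fun h => ?_
    have e := connectedComponentIn_eq h.2
    rw [e, ProjLine.hilbert_comm]
    exact iInf_le_of_le g (iInf_le_of_le t (iInf_le_of_le s (iInf_le_of_le ht (iInf_le_of_le hs
      (iInf_le_of_le ⟨(connectedComponentIn_subset _ _ h.2).2,
        e ▸ mem_connectedComponentIn ⟨⟨s, hs⟩, h.1⟩⟩ le_rfl)))))
  exact le_antisymm (key x y) (key y x)

theorem Conjugate.symm {x y : D.ShilovBoundary} (h : D.Conjugate Ω x y) : D.Conjugate Ω y x := by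
  obtain ⟨Λ, hΛ, hx, hy⟩ := h
  exact ⟨Λ, hΛ, connectedComponentIn_subset _ _ hy,
    connectedComponentIn_eq hy ▸ mem_connectedComponentIn hx⟩

theorem kobayashi_le {x y : D.ShilovBoundary} {N : ℕ} {c : ℕ → D.ShilovBoundary} (hN : 1 ≤ N)
    (hc : D.IsChain Ω x y N c) :
    D.kobayashi Ω x y ≤ ∑ i ∈ Finset.range N, D.kob Ω (c i) (c (i + 1)) :=
  iInf_le_of_le N (iInf_le_of_le hN (iInf_le_of_le c (iInf_le_of_le hc le_rfl)))

theorem kobayashi_le_kob {x y : D.ShilovBoundary} (hx : x ∈ Ω) (hy : y ∈ Ω)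
    (h : D.Conjugate Ω x y) : D.kobayashi Ω x y ≤ D.kob Ω x y := by
  have hc : D.IsChain Ω x y 1 (fun i => if i = 0 then x else y) := by
    refine ⟨fun i _ => ?_, rfl, rfl, fun i hi => ?_⟩
    · split_ifs
      exacts [hx, hy]
    · obtain rfl : i = 0 := by omega
      exact h
  exact (kobayashi_le le_rfl hc).trans (by simp)

theorem IsChain.reverse {x y : D.ShilovBoundary} {N : ℕ} {c : ℕ → D.ShilovBoundary}
    (hc : D.IsChain Ω x y N c) : D.IsChain Ω y x N (fun i => c (N - i)) where
  mem i _ := hc.mem _ (Nat.sub_le _ _)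
  start := hc.finish
  finish := by
    rw [Nat.sub_self]
    exact hc.start
  conj i hi := by
    have h1 := (hc.conj (N - (i + 1)) (by omega)).symm
    have h2 : N - (i + 1) + 1 = N - i := by omega
    rwa [h2] at h1

theorem kobayashi_comm (x y : D.ShilovBoundary) : D.kobayashi Ω x y = D.kobayashi Ω y x := by
  have key : ∀ x y, D.kobayashi Ω x y ≤ D.kobayashi Ω y x := by
    intro x y
    refine le_iInf fun N => le_iInf fun hN => le_iInf fun c => le_iInf fun hc => ?_
    refine (kobayashi_le hN hc.reverse).trans_eq ?_
    rw [← Finset.sum_range_reflect]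
    refine Finset.sum_congr rfl fun i hi => ?_
    have hi' := Finset.mem_range.1 hi
    rw [kob_comm]
    congr 2 <;> omega
  exact le_antisymm (key x y) (key y x)

theorem kobayashi_triangle (x y z : D.ShilovBoundary) :
    D.kobayashi Ω x z ≤ D.kobayashi Ω x y + D.kobayashi Ω y z := by
  conv_rhs => unfold kobayashi
  simp only [ENNReal.iInf_add, ENNReal.add_iInf]
  refine le_iInf fun N' => le_iInf fun _ => le_iInf fun c' => le_iInf fun hc' =>
    le_iInf fun N => le_iInf fun hN => le_iInf fun c => le_iInf fun hc => ?_
  set d : ℕ → D.ShilovBoundary := fun i => if i ≤ N then c i else c' (i - N) with hd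
  have h1 : ∀ i ≤ N, d i = c i := fun i hi => if_pos hi
  have h2 : ∀ i, d (N + i) = c' i := by
    intro i
    rcases Nat.eq_zero_or_pos i with rfl | hi
    · rw [add_zero, h1 N le_rfl, hc.finish, hc'.start]
    · simp only [hd]
      rw [if_neg (by omega), Nat.add_sub_cancel_left]
  have hdc : D.IsChain Ω x z (N + N') d := by
    refine ⟨fun i hi => ?_, by rw [h1 0 (Nat.zero_le _), hc.start], by rw [h2, hc'.finish],
      fun i hi => ?_⟩
    · rcases le_or_gt i N with h | h
      · rw [h1 i h]
        exact hc.mem i h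
      · obtain ⟨j, rfl⟩ := Nat.exists_eq_add_of_lt h
        rw [add_assoc, h2]
        exact hc'.mem _ (by omega)
    · rcases lt_or_ge i N with h | h
      · rw [h1 i h.le, h1 (i + 1) h]
        exact hc.conj i h
      · obtain ⟨j, rfl⟩ := Nat.exists_eq_add_of_le h
        rw [add_assoc, h2, h2]
        exact hc'.conj _ (by omega)
  refine (kobayashi_le (by omega) hdc).trans_eq ?_
  rw [Finset.sum_range_add]
  congr 1
  · refine Finset.sum_congr rfl fun i hi => ?_
    have hi' := Finset.mem_range.1 hi
    rw [h1 i hi'.le, h1 (i + 1) hi']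
  · exact Finset.sum_congr rfl fun i _ => by rw [h2, add_assoc, h2]

/-- A function that is `1`-Lipschitz for `k_Ω` is `1`-Lipschitz for `K_Ω`. -/
theorem le_add_kobayashi {F : D.ShilovBoundary → ℝ≥0∞}
    (hF : ∀ x ∈ Ω, ∀ y ∈ Ω, F y ≤ F x + D.kob Ω x y) (x y : D.ShilovBoundary) :
    F y ≤ F x + D.kobayashi Ω x y := by
  unfold kobayashi
  simp only [ENNReal.add_iInf]
  refine le_iInf fun N => le_iInf fun _ => le_iInf fun c => le_iInf fun hc => ?_
  have key : ∀ m ≤ N, F (c m) ≤ F x + ∑ i ∈ Finset.range m, D.kob Ω (c i) (c (i + 1)) := by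
    intro m
    induction m with
    | zero =>
      intro _
      rw [hc.start, Finset.sum_range_zero, add_zero]
    | succ k ih =>
      intro hk
      rw [Finset.sum_range_succ, ← add_assoc]
      exact (hF _ (hc.mem k (by omega)) _ (hc.mem (k + 1) hk)).trans
        (add_le_add_left (ih (by omega)) _)
  have := key N le_rfl
  rwa [hc.finish] at this

end Pseudometric

/-! ### Comparison of `K_Ω` with the norm of the chart -/

section Estimates

open LieGrp

variable {n : ℕ} {G : Type*} [TopologicalSpace G] [ChartedSpace (EuclideanSpace ℝ (Fin n)) G]
  [Group G] [LieGroup (𝓡 n) ∞ G] (D : HTTData (GroupLieAlgebra (𝓡 n) G))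

/-- The span is nonzero and stable under the Levi subgroup, hence, by differentiation, under degree
`0`; simplicity of `𝔤` leaves only the whole degree `-1` part. -/
theorem span_Ad_vMinus : Submodule.span ℝ (range fun l : D.levi => Ad (l : G) D.vMinus) =
    degSpace D.gradingElt (-1) := by
  have := D.isSimple
  refine D.isThreeGrading.eq_degSpace_neg_one ?_ ?_ fun z hz w hw => ?_
  · rw [Submodule.span_le]
    rintro _ ⟨l, rfl⟩
    exact (D.direction l).2
  · intro h
    have h1 : Ad ((1 : D.levi) : G) D.vMinus ∈
        Submodule.span ℝ (range fun l : D.levi => Ad (l : G) D.vMinus) :=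
      Submodule.subset_span ⟨1, rfl⟩
    rw [h, Submodule.mem_bot] at h1
    exact (D.isRankOnePair.map (1 : D.levi).2).ne_zero h1
  · set W := Submodule.span ℝ (range fun l : D.levi => Ad (l : G) D.vMinus)
    have h1 : ∀ l : D.levi, ∀ v ∈ W, Ad (l : G) v ∈ W := by
      intro l v hv
      induction hv using Submodule.span_induction with
      | mem v hv =>
        obtain ⟨l', rfl⟩ := hv
        refine Submodule.subset_span ⟨l * l', ?_⟩
        exact Ad_mul_apply _ _ _
      | zero =>
        rw [map_zero]
        exact W.zero_mem
      | add v v' _ _ hv hv' =>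
        rw [map_add]
        exact W.add_mem hv hv'
      | smul c v _ hv =>
        rw [map_smul]
        exact W.smul_mem c hv
    -- The curve `Ad(exp(t z)) w` stays in the closed subspace `W`, so its velocity `⁅z, w⁆` does
    -- too.
    have h2 := hasDerivAt_adOp_exp (G := G) z w 0
    have h3 := HasDerivAt.mem_submodule (W := (W : Submodule ℝ (EuclideanSpace ℝ (Fin n)))) h2
      fun t => h1 ⟨exp (t • z), D.exp_mem_levi (Submodule.smul_mem _ _ hz)⟩ w hw
    have h4 : adOp (n := n) (exp ((0 : ℝ) • z) : G) (bracketOp n G z w) = ⁅z, w⁆ := by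
      rw [zero_smul, exp_zero, adOp_one]
      exact bracketOp_apply z w
    rw [h4] at h3
    exact h3

theorem span_direction : Submodule.span ℝ (range D.direction) = ⊤ := by
  have h1 : (Submodule.span ℝ (range D.direction)).map D.negSpace.subtype =
      Submodule.map D.negSpace.subtype ⊤ := by
    rw [Submodule.map_span, Submodule.map_top, Submodule.range_subtype, ← range_comp]
    exact D.span_Ad_vMinus
  exact Submodule.map_injective_of_injective D.negSpace.injective_subtype h1

theorem exists_basis_direction : ∃ (ι : Type) (_ : Fintype ι) (b : Module.Basis ι ℝ D.negSpace),
    ∀ i, ∃ l, b i = D.direction l := by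
  let b := Module.Basis.ofSpan D.span_direction.ge
  refine ⟨_, FiniteDimensional.fintypeBasisIndex b, b, fun i => ?_⟩
  obtain ⟨l, hl⟩ := Module.Basis.ofSpan_subset D.span_direction.ge (mem_range_self i)
  exact ⟨l, hl.symm⟩

variable {D} {Ω : Set D.ShilovBoundary} {g : G}

theorem isOpen_lineSet (ho : IsOpen Ω) (X : D.negSpace) (l : D.levi) :
    IsOpen (D.lineSet Ω g X l) :=
  ho.preimage ((D.isOpenEmbedding_chartAt g).continuous.comp
    (by fun_prop : Continuous fun τ : ℝ => X + τ • D.direction l))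

theorem zero_mem_lineSet {X : D.negSpace} (hX : D.chartAt g X ∈ Ω) (l : D.levi) :
    (0 : ℝ) ∈ D.lineSet Ω g X l := by
  rwa [lineSet, mem_ofPred_eq, zero_smul, add_zero]

theorem exists_lineComponent_eq_Ioo (ho : IsOpen Ω) {X : D.negSpace} (hX : D.chartAt g X ∈ Ω)
    {l : D.levi} {R : ℝ}
    (hR : ∀ τ : ℝ, R ≤ |τ| * ‖D.direction l‖ → D.chartAt g (X + τ • D.direction l) ∉ Ω) :
    ∃ a b, D.lineComponent Ω g X l = Ioo a b ∧ a < 0 ∧ 0 < b ∧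
      -(R / ‖D.direction l‖) ≤ a ∧ b ≤ R / ‖D.direction l‖ := by
  have hn : 0 < ‖D.direction l‖ := norm_pos_iff.2 (D.direction_ne_zero l)
  have h0 : (0 : ℝ) ∈ D.lineComponent Ω g X l := mem_connectedComponentIn (zero_mem_lineSet hX l)
  have hs : D.lineComponent Ω g X l ⊆ Ioo (-(R / ‖D.direction l‖)) (R / ‖D.direction l‖) := by
    intro τ hτ
    have h1 : τ ∈ D.lineSet Ω g X l := connectedComponentIn_subset _ _ hτ
    rw [mem_Ioo, ← abs_lt, lt_div_iff₀ hn]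
    by_contra h2
    exact hR τ (not_lt.1 h2) h1
  obtain ⟨a, b, hab⟩ := IsPreconnected.exists_eq_Ioo (U := D.lineComponent Ω g X l)
    isPreconnected_connectedComponentIn (isOpen_lineSet ho X l).connectedComponentIn ⟨0, h0⟩
    (bddBelow_Ioo.mono hs) (bddAbove_Ioo.mono hs)
  rw [hab] at h0 hs
  have h2 := (Ioo_subset_Ioo_iff (h0.1.trans h0.2)).1 hs
  exact ⟨a, b, hab, h0.1, h0.2, h2.1, h2.2⟩

/-- Locally, `K_Ω` is bounded below by the distance in a chart. -/
theorem exists_le_kobayashi (ho : IsOpen Ω) (hΩ : closure Ω ⊆ range (D.chartAt g))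
    (X₀ : D.negSpace) : ∃ δ > 0, ∃ R > 0, ∀ Y,
      ENNReal.ofReal (min δ ‖Y - X₀‖ / R) ≤ D.kobayashi Ω (D.chartAt g X₀) (D.chartAt g Y) := by
  obtain ⟨δ, hδ, R, hR, hb⟩ := exists_uniform_bound hΩ X₀
  refine ⟨δ, hδ, R, hR, fun Y => ?_⟩
  have hΩ' := subset_closure.trans hΩ
  have hinj := (D.isOpenEmbedding_chartAt g).injective
  -- The distance to `X₀`, truncated at `δ`. The uniform bound is only known near `X₀`, and the
  -- truncation makes the Lipschitz inequality automatic from points farther than `δ`, where `F` is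
  -- maximal.
  set F : D.ShilovBoundary → ℝ≥0∞ := fun x =>
    ENNReal.ofReal (min δ ‖Function.invFun (D.chartAt g) x - X₀‖ / R) with hF
  have hFc : ∀ Z, F (D.chartAt g Z) = ENNReal.ofReal (min δ ‖Z - X₀‖ / R) := by
    intro Z
    simp only [hF]
    rw [Function.leftInverse_invFun hinj]
  have key := le_add_kobayashi (Ω := Ω) (F := F) ?_ (D.chartAt g X₀) (D.chartAt g Y)
  · rw [hFc, hFc, sub_self, norm_zero, min_eq_right hδ.le, zero_div, ENNReal.ofReal_zero,
      zero_add] at key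
    exact key
  intro x hx y hy
  obtain ⟨X, rfl⟩ := hΩ' hx
  obtain ⟨Z, rfl⟩ := hΩ' hy
  rw [hFc, hFc]
  rcases lt_or_ge ‖X - X₀‖ δ with h | h
  · have h1 : ENNReal.ofReal (‖Z - X‖ / R) ≤ D.kob Ω (D.chartAt g X) (D.chartAt g Z) := by
      refine le_kob hΩ' fun l τ hτ hZ => ENNReal.ofReal_le_ofReal ?_
      obtain ⟨a, b, hab, ha0, hb0, ha, hb'⟩ := exists_lineComponent_eq_Ioo ho hx (hb X h l)
      rw [hab] at hτ ⊢
      refine le_trans (le_of_eq ?_) (ProjLine.le_hilbert_coe_Ioo ha hb' ha0 hb0 hτ)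
      rw [hinj hZ, add_sub_cancel_left, norm_smul, Real.norm_eq_abs, div_div_eq_mul_div]
    refine le_trans ?_ (add_le_add_right h1 _)
    rw [← ENNReal.ofReal_add (by positivity) (by positivity), ← add_div]
    refine ENNReal.ofReal_le_ofReal (div_le_div_of_nonneg_right ?_ hR.le)
    rw [min_eq_right h.le]
    refine (min_le_right _ _).trans ?_
    rw [add_comm, ← sub_add_sub_cancel Z X X₀]
    exact norm_add_le _ _
  · refine le_trans ?_ le_self_add
    refine ENNReal.ofReal_le_ofReal (div_le_div_of_nonneg_right ?_ hR.le)
    rw [min_eq_left h]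
    exact min_le_left _ _

/-- Since the ball of radius `ρ` lies in `Ω`, the component on the line contains the parameters of
size less than `ρ / ‖direction‖`, and the upper estimate of the Hilbert metric applies. -/
theorem kobayashi_line_le (ho : IsOpen Ω) (hΩ : closure Ω ⊆ range (D.chartAt g)) {X : D.negSpace}
    {ρ : ℝ} (hρ : 0 < ρ) (hX : ∀ Y, ‖Y - X‖ < ρ → D.chartAt g Y ∈ Ω) (l : D.levi) {τ : ℝ}
    (hτ : |τ| * ‖D.direction l‖ ≤ ρ / 2) :
    D.kobayashi Ω (D.chartAt g X) (D.chartAt g (X + τ • D.direction l)) ≤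
      ENNReal.ofReal (4 / ρ * (|τ| * ‖D.direction l‖)) := by
  have hn : 0 < ‖D.direction l‖ := norm_pos_iff.2 (D.direction_ne_zero l)
  have hΩ' := subset_closure.trans hΩ
  have hX0 : D.chartAt g X ∈ Ω := hX X (by rwa [sub_self, norm_zero])
  obtain ⟨δ, hδ, R, hR, hb⟩ := exists_uniform_bound hΩ X
  obtain ⟨a, b, hab, ha0, hb0, -, -⟩ := exists_lineComponent_eq_Ioo ho hX0
    (hb X (by rwa [sub_self, norm_zero]) l)
  have hr : 0 < ρ / ‖D.direction l‖ := by positivity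
  have hsub : Ioo (-(ρ / ‖D.direction l‖)) (ρ / ‖D.direction l‖) ⊆ D.lineComponent Ω g X l := by
    refine isPreconnected_Ioo.subset_connectedComponentIn ⟨by linarith, hr⟩ fun t ht => ?_
    rw [lineSet, mem_ofPred_eq]
    refine hX _ ?_
    rw [add_sub_cancel_left, norm_smul, Real.norm_eq_abs, ← lt_div_iff₀ hn]
    exact abs_lt.2 ht
  have hτ' : |τ| ≤ ρ / ‖D.direction l‖ / 2 := by
    rw [div_right_comm, le_div_iff₀ hn]
    exact hτ
  have hmem : τ ∈ D.lineComponent Ω g X l := hsub (abs_lt.1 (by linarith))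
  have hc := conjugate_of_mem hΩ' hX0 hmem
  have hmem' : D.chartAt g (X + τ • D.direction l) ∈ Ω := by
    have h1 : τ ∈ D.lineSet Ω g X l := connectedComponentIn_subset _ _ hmem
    exact h1
  refine (kobayashi_le_kob hX0 hmem' hc).trans ((kob_le hΩ' hX0 hmem).trans ?_)
  rw [hab] at hsub ⊢
  obtain ⟨h1, h2⟩ := (Ioo_subset_Ioo_iff (by linarith)).1 hsub
  refine ENNReal.ofReal_le_ofReal ((ProjLine.hilbert_coe_Ioo_le h1 h2 hr hτ').trans_eq ?_)
  field_simp

/-- `K_Ω` is continuous on the diagonal. -/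
theorem tendsto_kobayashi (ho : IsOpen Ω) (hΩ : closure Ω ⊆ range (D.chartAt g))
    {x : D.ShilovBoundary} (hx : x ∈ Ω) :
    Filter.Tendsto (fun y => D.kobayashi Ω x y) (𝓝 x) (𝓝 0) := by
  obtain ⟨X, rfl⟩ := hΩ (subset_closure hx)
  obtain ⟨ι, _, B, hB⟩ := D.exists_basis_direction
  -- With `ρ = ε / 2`, all points within `ρ / 2` of `X` have their `ρ`-ball in `Ω`, so one constant
  -- serves for every step of the chain.
  have hcont := (D.isOpenEmbedding_chartAt g).continuous
  obtain ⟨ε, hε, hball⟩ := Metric.isOpen_iff.1 (ho.preimage hcont) X hx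
  set ρ := ε / 2 with hρ
  have hρ0 : 0 < ρ := by positivity
  have hball' : ∀ Y, ‖Y - X‖ < 2 * ρ → D.chartAt g Y ∈ Ω := by
    intro Y hY
    refine hball (mem_ball_iff_norm.2 (hY.trans_le (by rw [hρ]; linarith)))
  set S : D.negSpace → ℝ := fun Y => ∑ i, |B.repr (Y - X) i| * ‖B i‖ with hS
  have key : ∀ Y, S Y ≤ ρ / 2 → D.kobayashi Ω (D.chartAt g X) (D.chartAt g Y) ≤
      ENNReal.ofReal (4 / ρ * S Y) := by
    intro Y hY
    set c := B.repr (Y - X) with hc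
    -- Move along one basis vector at a time; `S` is a weighted `ℓ¹` norm that bounds both the total
    -- cost and the displacement of every intermediate point.
    have h1 : ∀ s : Finset ι, D.kobayashi Ω (D.chartAt g X)
        (D.chartAt g (X + ∑ i ∈ s, c i • B i)) ≤
        ENNReal.ofReal (4 / ρ * ∑ i ∈ s, |c i| * ‖B i‖) := by
      intro s
      classical
      induction s using Finset.induction_on with
      | empty =>
        obtain ⟨l⟩ : Nonempty D.levi := inferInstance
        have := kobayashi_line_le ho hΩ hρ0 (fun Y hY => hball' Y (by linarith)) l (τ := 0)
          (by rw [abs_zero, zero_mul]; positivity)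
        rw [Finset.sum_empty, Finset.sum_empty, mul_zero]
        rwa [zero_smul, abs_zero, zero_mul, mul_zero] at this
      | insert j s hj ih =>
        obtain ⟨l, hl⟩ := hB j
        have hle : ∀ u : Finset ι, ∑ i ∈ u, |c i| * ‖B i‖ ≤ ρ / 2 := fun u =>
          (Finset.sum_le_univ_sum_of_nonneg fun i => by positivity).trans hY
        have hn : ‖∑ i ∈ s, c i • B i‖ ≤ ρ / 2 := by
          refine (norm_sum_le _ _).trans (le_trans (le_of_eq ?_) (hle s))
          exact Finset.sum_congr rfl fun i _ => by rw [norm_smul, Real.norm_eq_abs]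
        have h2 := kobayashi_line_le ho hΩ (X := X + ∑ i ∈ s, c i • B i) hρ0 (fun Y hY => by
          refine hball' Y ?_
          have h3 : Y - X = (Y - (X + ∑ i ∈ s, c i • B i)) + ∑ i ∈ s, c i • B i := by abel
          rw [h3]
          exact (norm_add_le _ _).trans_lt (by linarith)) l (τ := c j) (by
            rw [← hl]
            have := hle {j}
            rwa [Finset.sum_singleton] at this)
        rw [← hl] at h2
        rw [Finset.sum_insert hj, Finset.sum_insert hj, add_comm (c j • B j), ← add_assoc]
        refine (kobayashi_triangle _ _ _).trans ((add_le_add ih h2).trans_eq ?_)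
        rw [← ENNReal.ofReal_add (by positivity) (by positivity), ← mul_add, add_comm]
    have h2 := h1 Finset.univ
    rwa [B.sum_repr, add_sub_cancel] at h2
  have hSc : Continuous S := by
    have h1 : ∀ i, Continuous fun Y : D.negSpace => B.repr (Y - X) i := fun i =>
      (LinearMap.continuous_of_finiteDimensional (B.coord i)).comp (continuous_id.sub continuous_const)
    exact continuous_finsetSum _ fun i _ => (h1 i).abs.mul continuous_const
  have hS0 : S X = 0 := by simp [hS]
  rw [← (D.isOpenEmbedding_chartAt g).map_nhds_eq X, Filter.tendsto_map'_iff]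
  have h3 : Filter.Tendsto (fun Y => ENNReal.ofReal (4 / ρ * S Y)) (𝓝 X) (𝓝 0) := by
    have h4 : Continuous fun Y => ENNReal.ofReal (4 / ρ * S Y) :=
      ENNReal.continuous_ofReal.comp (continuous_const.mul hSc)
    have h5 := h4.tendsto X
    rwa [hS0, mul_zero, ENNReal.ofReal_zero] at h5
  refine tendsto_of_tendsto_of_tendsto_of_le_of_le' tendsto_const_nhds h3
    (Filter.Eventually.of_forall fun _ => zero_le) ?_
  have h6 : ∀ᶠ Y in 𝓝 X, S Y < ρ / 2 :=
    hSc.continuousAt.eventually_lt continuousAt_const (by rw [hS0]; positivity)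
  filter_upwards [h6] with Y hY
  exact key Y hY.le

theorem kobayashi_self (ho : IsOpen Ω) (hΩ : closure Ω ⊆ range (D.chartAt g))
    {x : D.ShilovBoundary} (hx : x ∈ Ω) : D.kobayashi Ω x x = 0 := by
  by_contra h
  have h1 := (tendsto_kobayashi ho hΩ hx).eventually (gt_mem_nhds (pos_iff_ne_zero.2 h))
  exact lt_irrefl _ h1.self_of_nhds

end Estimates

end HTTData

/-! ### Finiteness, separation and topology -/

namespace HTTData

section Metric

variable {n : ℕ} {G : Type*} [TopologicalSpace G] [ChartedSpace (EuclideanSpace ℝ (Fin n)) G]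
  [Group G] [LieGroup (𝓡 n) ∞ G] {D : HTTData (GroupLieAlgebra (𝓡 n) G)}
  {Ω : Set D.ShilovBoundary} {g : G}

/-- By the triangle inequality and finiteness near the diagonal, the points of `Ω` at finite
distance from `x` and those at infinite distance form two open sets; `Ω` is connected. -/
theorem kobayashi_ne_top (ho : IsOpen Ω) (hc : IsPreconnected Ω)
    (hΩ : closure Ω ⊆ range (D.chartAt g)) {x y : D.ShilovBoundary} (hx : x ∈ Ω) (hy : y ∈ Ω) :
    D.kobayashi Ω x y ≠ ⊤ := by
  have hnear : ∀ z ∈ Ω, ∀ᶠ w in 𝓝 z, D.kobayashi Ω z w ≠ ⊤ := fun z hz =>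
    ((tendsto_kobayashi ho hΩ hz).eventually (gt_mem_nhds one_pos)).mono
      fun w hw => (hw.trans ENNReal.one_lt_top).ne
  have htri : ∀ z w, D.kobayashi Ω x z ≠ ⊤ → D.kobayashi Ω z w ≠ ⊤ → D.kobayashi Ω x w ≠ ⊤ :=
    fun z w h1 h2 => ne_top_of_le_ne_top (ENNReal.add_ne_top.2 ⟨h1, h2⟩) (kobayashi_triangle _ _ _)
  have h1 : IsOpen (Ω ∩ {w | D.kobayashi Ω x w ≠ ⊤}) := by
    refine isOpen_iff_mem_nhds.2 fun z hz => ?_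
    filter_upwards [ho.mem_nhds hz.1, hnear z hz.1] with w hw hw'
    exact ⟨hw, htri z w hz.2 hw'⟩
  have h2 : IsOpen (Ω ∩ {w | D.kobayashi Ω x w = ⊤}) := by
    refine isOpen_iff_mem_nhds.2 fun z hz => ?_
    filter_upwards [ho.mem_nhds hz.1, hnear z hz.1] with w hw hw'
    refine ⟨hw, ?_⟩
    by_contra h
    exact htri w z h (by rwa [kobayashi_comm]) hz.2
  intro h
  obtain ⟨z, -, hz, hz'⟩ := hc _ _ h1 h2 (fun w hw => by
      by_cases h3 : D.kobayashi Ω x w = ⊤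
      exacts [Or.inr ⟨hw, h3⟩, Or.inl ⟨hw, h3⟩])
    ⟨x, hx, hx, by simp [kobayashi_self ho hΩ hx]⟩ ⟨y, hy, hy, h⟩
  exact hz.2 hz'.2

theorem eq_of_kobayashi_eq_zero (ho : IsOpen Ω) (hΩ : closure Ω ⊆ range (D.chartAt g))
    {x y : D.ShilovBoundary} (hx : x ∈ Ω) (hy : y ∈ Ω) (h : D.kobayashi Ω x y = 0) : x = y := by
  obtain ⟨X, rfl⟩ := hΩ (subset_closure hx)
  obtain ⟨Y, rfl⟩ := hΩ (subset_closure hy)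
  obtain ⟨δ, hδ, R, hR, hb⟩ := exists_le_kobayashi ho hΩ X
  have h1 := hb Y
  rw [h, nonpos_iff_eq_zero, ENNReal.ofReal_eq_zero, div_le_iff₀ hR, zero_mul, min_le_iff] at h1
  have h2 : Y - X = 0 := norm_le_zero_iff.1 (h1.resolve_left hδ.not_ge)
  rw [sub_eq_zero.1 h2]

/-- A distance below `min δ η / R` forces the truncated norm below `min δ η`, hence the norm below
`η`. -/
theorem exists_kobayashi_lt_imp_mem (ho : IsOpen Ω) (hΩ : closure Ω ⊆ range (D.chartAt g))
    {x : D.ShilovBoundary} (hx : x ∈ Ω) {U : Set D.ShilovBoundary} (hU : U ∈ 𝓝 x) :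
    ∃ ε > 0, ∀ y ∈ Ω, D.kobayashi Ω x y < ENNReal.ofReal ε → y ∈ U := by
  obtain ⟨X, rfl⟩ := hΩ (subset_closure hx)
  obtain ⟨δ, hδ, R, hR, hb⟩ := exists_le_kobayashi ho hΩ X
  obtain ⟨η, hη, hball⟩ := Metric.mem_nhds_iff.1
    ((D.isOpenEmbedding_chartAt g).continuous.continuousAt.preimage_mem_nhds hU)
  refine ⟨min δ η / R, by positivity, fun y hy h => ?_⟩
  obtain ⟨Y, rfl⟩ := hΩ (subset_closure hy)
  refine hball (mem_ball_iff_norm.2 ?_)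
  have h1 := (ENNReal.ofReal_lt_ofReal_iff (by positivity)).1 ((hb Y).trans_lt h)
  rw [div_lt_div_iff_of_pos_right hR] at h1
  by_contra hn
  exact h1.not_ge (min_le_min_left δ (not_lt.1 hn))

/-- The metric `K_Ω`. -/
abbrev kobayashiMetric (ho : IsOpen Ω) (hc : IsPreconnected Ω)
    (hΩ : closure Ω ⊆ range (D.chartAt g)) : MetricSpace Ω where
  dist x y := (D.kobayashi Ω x y).toReal
  dist_self x := by rw [kobayashi_self ho hΩ x.2, ENNReal.toReal_zero]
  dist_comm x y := by rw [kobayashi_comm]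
  dist_triangle x y z := by
    rw [← ENNReal.toReal_add (kobayashi_ne_top ho hc hΩ x.2 y.2) (kobayashi_ne_top ho hc hΩ y.2 z.2)]
    exact ENNReal.toReal_mono (ENNReal.add_ne_top.2 ⟨kobayashi_ne_top ho hc hΩ x.2 y.2,
      kobayashi_ne_top ho hc hΩ y.2 z.2⟩) (kobayashi_triangle _ _ _)
  eq_of_dist_eq_zero {x y} h := Subtype.ext (eq_of_kobayashi_eq_zero ho hΩ x.2 y.2
    (((ENNReal.toReal_eq_zero_iff _).1 h).resolve_right (kobayashi_ne_top ho hc hΩ x.2 y.2)))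

theorem isKobayashiMetric_kobayashiMetric (ho : IsOpen Ω) (hc : IsPreconnected Ω)
    (hΩ : closure Ω ⊆ range (D.chartAt g)) :
    D.IsKobayashiMetric Ω (kobayashiMetric ho hc hΩ) := fun x y =>
  (ENNReal.ofReal_toReal (kobayashi_ne_top ho hc hΩ x.2 y.2)).symm

/-- The lower bound puts small `K_Ω`-balls inside given neighbourhoods, and continuity on the
diagonal makes `K_Ω`-balls neighbourhoods. -/
theorem IsKobayashiMetric.topology_eq (ho : IsOpen Ω) (hΩ : closure Ω ⊆ range (D.chartAt g))
    {m : MetricSpace Ω} (hm : D.IsKobayashiMetric Ω m) :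
    m.toUniformSpace.toTopologicalSpace = (instTopologicalSpaceSubtype : TopologicalSpace Ω) := by
  refine TopologicalSpace.ext_nhds fun x => ?_
  have hB := @Metric.nhds_basis_ball Ω m.toPseudoMetricSpace x
  have hlt : ∀ (y : Ω) (ε : ℝ), 0 < ε →
      (m.dist y x < ε ↔ D.kobayashi Ω x y < ENNReal.ofReal ε) := by
    intro y ε hε
    rw [kobayashi_comm, hm, ENNReal.ofReal_lt_ofReal_iff hε]
  refine le_antisymm ?_ ?_
  · intro S hS
    obtain ⟨U, hU, hUS⟩ := (mem_nhds_subtype _ _ _).1 hS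
    obtain ⟨ε, hε, h⟩ := exists_kobayashi_lt_imp_mem ho hΩ x.2 hU
    exact hB.mem_iff.2 ⟨ε, hε, fun y hy => hUS (h y y.2 ((hlt y ε hε).1 hy))⟩
  · refine hB.ge_iff.2 fun ε hε => ?_
    have h1 := (tendsto_kobayashi ho hΩ x.2).eventually (gt_mem_nhds (ENNReal.ofReal_pos.2 hε))
    filter_upwards [continuous_subtype_val.continuousAt.eventually h1] with y hy
    exact (hlt y ε hε).2 hy

end Metric

end HTTData

end

theorem proposition6p3 {n : ℕ} {G : Type*} [TopologicalSpace G] [Group G]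
    [ChartedSpace (EuclideanSpace ℝ (Fin n)) G] [LieGroup (𝓡 n) ∞ G]
    (D : HTTData (GroupLieAlgebra (𝓡 n) G))
    (Ω : Set D.ShilovBoundary) (hΩ : D.IsFlagDomain Ω) (hproper : D.IsProperSet Ω) :
    D.KobayashiHyperbolic Ω ∧
      ∀ m : MetricSpace Ω, D.IsKobayashiMetric Ω m →
        m.toUniformSpace.toTopologicalSpace = (instTopologicalSpaceSubtype : TopologicalSpace Ω) := by
  obtain ⟨g, hg⟩ := hproper.exists_closure_subset
  exact ⟨⟨_, HTTData.isKobayashiMetric_kobayashiMetric hΩ.1 hΩ.2.isPreconnected hg⟩,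
    fun _ hm => HTTData.IsKobayashiMetric.topology_eq hΩ.1 hg hm⟩
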